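/- Let $D>2$ be an integer. For each $l\ge 0$ let $t_{l,m}$, $m=1,\dots,N(l,D)$, be an orthonormal basis of the $N(l,D)$-dimensional space of totally symmetric, trace-free tensors in $(\mathbb C^D)^{\otimes l}$ (with its natural hermitian inner product), and let $V$ be the free commutative unital $\mathbb C$-algebra on the symbols $T\cdot\partial^l\varphi$, linear in the totally symmetric trace-free tensor $T$ of rank $l$, $l\ge0$. With $c_l=2^l\,\Gamma(l+1)\Gamma(l+D/2-1)/\Gamma(D/2-1)$, a basis of $V$ is given by $$v_a=\prod_{l,m}(a_{l,m}!)^{-1/2}\big(c_l^{-1/2}\,t_{l,m}\cdot\partial^l\varphi\big)^{a_{l,m}},$$ where $a=(a_{l,m})$ runs through the multi-indices of non-negative integers with finitely many non-zero entries. Let $\langle v^a|$ be the dual basis, and let $\alpha_{l,m}v_a=(a_{l,m})^{1/2}v_{a-e_{l,m}}$ and $\alpha^+_{l,m}v_a=(a_{l,m}+1)^{1/2}v_{a+e_{l,m}}$ be the annihilation and creation operators on $V$. Let $Y_{l,m}(\hat x)=k_l\,\bar t_{l,m}\cdot\hat x^{\otimes l}$ be the spherical harmonics on $S^{D-1}$,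 where $k_l>0$ is the constant for which they have unit $L^2(S^{D-1})$-norm. For $x\in\mathbb R^D\setminus\{0\}$, $r=|x|$, $\hat x=x/r$, put $$Y(x,\varphi)=\sqrt{\mathrm{vol}(S^{D-1})}\sum_{l=0}^\infty\sum_{m=1}^{N(l,D)}\sqrt{\tfrac{D-2}{2l+D-2}}\Big[r^l\,Y_{l,m}(\hat x)\,\alpha^+_{l,m}+r^{-l-D+2}\,\overline{Y_{l,m}(\hat x)}\,\alpha_{l,m}\Big],$$ and define $Y(x,v)$ for $v\in V$ by linearity in $v$, $Y(x,\mathbf 1)=\mathrm{id}$, and $$Y\Big(x,\prod_i T_i\cdot\partial^{l_i}\varphi\Big)=\;:\prod_i T_i\cdot\partial^{l_i}\,Y(x,\varphi):\;,$$ where $\partial$ on the right acts on the coefficient functions and $:\ \cdots\ :$ is normal ordering (all creation operators to the left of all annihilation operators). $Y(x,v)$ maps $V$ to formal, possibly infinite, linear combinations of the $v_c$. The OPE coefficients are $$C_{ab}^c(x_1,x_2)=\langle v^c|\,Y(x_1-x_2,v_a)\,|v_b\rangle .$$ **Theorem.** The OPE coefficients satisfy the associativity condition: with $r_{ij}=|x_i-x_j|$,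 for all $x_1,x_2,x_3\in\mathbb R^D$ with $0<r_{12}<r_{23}<r_{13}$ and all multi-indices $a,b,c,d$, $$\sum_e C_{ab}^e(x_1,x_2)\,C_{ec}^d(x_2,x_3)=\sum_e C_{bc}^e(x_2,x_3)\,C_{ae}^d(x_1,x_3),$$ where both sums over all multi-indices $e$ converge absolutely. Equivalently, for all $x,y\in\mathbb R^D$ with $0<|x-y|<|y|<|x|$ and all $u,v\in V$, $$Y(x,u)\,Y(y,v)=Y\big(y,Y(x-y,u)v\big),$$ i.e. for every $w\in V$ and every multi-index $d$ $$\sum_e \langle v^d|Y(x,u)v_e\rangle\,\langle v^e|Y(y,v)w\rangle=\sum_e\langle v^e|Y(x-y,u)v\rangle\,\langle v^d|Y(y,v_e)w\rangle ,$$ both sums converging absolutely. -/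

import Mathlib

open MeasureTheory Module

noncomputable section

namespace FreeField

/-! ### Trace-free symmetric tensors and the space of fields -/

/-- Euclidean space `ℝ^D`. -/
abbrev Pt (D : ℕ) := EuclideanSpace ℝ (Fin D)

/-- `(ℂ^D)^{⊗ l}` in components, with its natural hermitian inner product. -/
abbrev Tensor (D l : ℕ) := EuclideanSpace ℂ (Fin l → Fin D)

/-- The totally symmetric, trace-free tensors of rank `l`. -/
def traceFree (D l : ℕ) : Submodule ℂ (Tensor D l) where
  carrier := {t | (∀ (σ : Equiv.Perm (Fin l)) (μ : Fin l → Fin D), t (μ ∘ σ) = t μ) ∧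
    ∀ i j : Fin l, i ≠ j → ∀ μ : Fin l → Fin D,
      ∑ k : Fin D, t (Function.update (Function.update μ i k) j k) = 0}
  zero_mem' := by simp
  add_mem' := by
    rintro s t ⟨hs, hs'⟩ ⟨ht, ht'⟩
    refine ⟨fun σ μ => by simp [hs σ μ, ht σ μ], fun i j hij μ => ?_⟩
    simp [Finset.sum_add_distrib, hs' i j hij μ, ht' i j hij μ]
  smul_mem' := by
    rintro z t ⟨ht, ht'⟩
    refine ⟨fun σ μ => by simp [ht σ μ], fun i j hij μ => ?_⟩
    simp [← Finset.mul_sum, ht' i j hij μ]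

/-- The space `V` of fields: the free commutative unital `ℂ`-algebra on the symbols `T · ∂^l φ`,
linear in the totally symmetric trace-free tensor `T` of rank `l`, for all `l ≥ 0`. -/
abbrev FieldSpace (D : ℕ) := SymmetricAlgebra ℂ (Π₀ l, traceFree D l)

/-- The field `T · ∂^l φ ∈ V`. -/
def dPhi {D l : ℕ} (T : traceFree D l) : FieldSpace D :=
  SymmetricAlgebra.ι ℂ _ (DFinsupp.lsingle (R := ℂ) (M := fun l => traceFree D l) l T)

/-- A choice, for every `l`, of an orthonormal basis `t_{l,m}` of the trace-free symmetric tensors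
of rank `l`; the index `m` runs over `N(l,D)` values, the dimension of this space. -/
abbrev TensorBasis (D : ℕ) :=
  ∀ l, OrthonormalBasis (Fin (finrank ℂ (traceFree D l))) ℂ (traceFree D l)

/-- The mode labels `(l, m)`. -/
abbrev Mode (D : ℕ) := Σ l : ℕ, Fin (finrank ℂ (traceFree D l))

/-- The multi-indices `a = (a_{l,m})` with finitely many non-zero entries. -/
abbrev Occ (D : ℕ) := Mode D →₀ ℕ

/-- `c_l = 2^l Γ(l+1) Γ(l+D/2-1) / Γ(D/2-1)`. -/
def cConst (D l : ℕ) : ℝ :=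
  2 ^ l * Real.Gamma (l + 1) * Real.Gamma (l + (D : ℝ) / 2 - 1) / Real.Gamma ((D : ℝ) / 2 - 1)

lemma cConst_pos {D : ℕ} (hD : 2 < D) (l : ℕ) : 0 < cConst D l := by
  have h : (2 : ℝ) < D := by exact_mod_cast hD
  have hl : (0 : ℝ) ≤ l := Nat.cast_nonneg l
  have h1 : 0 < Real.Gamma ((l : ℝ) + 1) := Real.Gamma_pos_of_pos (by linarith)
  have h2 : 0 < Real.Gamma ((l : ℝ) + (D : ℝ) / 2 - 1) := Real.Gamma_pos_of_pos (by linarith)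
  have h3 : 0 < Real.Gamma ((D : ℝ) / 2 - 1) := Real.Gamma_pos_of_pos (by linarith)
  unfold cConst
  positivity

variable {D : ℕ}

/-- `v_a = ∏_{l,m} (a_{l,m}!)^{-1/2} (c_l^{-1/2} t_{l,m} · ∂^l φ)^{a_{l,m}}`. -/
def fieldVec (t : TensorBasis D) (a : Occ D) : FieldSpace D :=
  a.prod fun M n => ((√(n.factorial : ℝ))⁻¹ : ℂ) •
    (((√(cConst D M.1))⁻¹ : ℂ) • dPhi (t M.1 M.2)) ^ n

/-- The scalar `∏_{l,m} (a_{l,m}!)^{-1/2} (c_l^{-1/2})^{a_{l,m}}` in the definition of `v_a`. -/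
def occNorm (a : Occ D) : ℂ :=
  a.prod fun M n => ((√(n.factorial : ℝ))⁻¹ : ℂ) * ((√(cConst D M.1))⁻¹ : ℂ) ^ n

lemma occNorm_ne_zero [hD : Fact (2 < D)] (a : Occ D) : occNorm a ≠ 0 := by
  refine Finset.prod_ne_zero_iff.2 fun M _ => mul_ne_zero ?_ (pow_ne_zero _ ?_)
  · simp [Nat.factorial_ne_zero]
  · simpa [Real.sqrt_eq_zero'] using cConst_pos hD.out M.1

/-- The basis `(v_a)` of `V`. -/
def fieldBasis [Fact (2 < D)] (t : TensorBasis D) : Basis (Occ D) ℂ (FieldSpace D) :=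
  ((MvPolynomial.basisMonomials (Mode D) ℂ).map
    (SymmetricAlgebra.equivMvPolynomial
      (DFinsupp.basis fun l => (t l).toBasis)).symm.toLinearEquiv).unitsSMul
    fun a => Units.mk0 (occNorm a) (occNorm_ne_zero a)

lemma fieldBasis_apply [Fact (2 < D)] (t : TensorBasis D) (a : Occ D) :
    fieldBasis t a = fieldVec t a := by
  have h : ∀ M : Mode D, (SymmetricAlgebra.equivMvPolynomial
      (DFinsupp.basis fun l => (t l).toBasis)).symm (MvPolynomial.X M) = dPhi (t M.1 M.2) := by
    intro M
    rw [SymmetricAlgebra.equivMvPolynomial_symm_X]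
    congr 1
    apply (DFinsupp.basis fun l => (t l).toBasis).repr.injective
    rw [Basis.repr_self]
    obtain ⟨l, m⟩ := M
    ext ⟨l', m'⟩
    by_cases hl : l = l'
    · subst hl
      have : (Finsupp.single (⟨l, m⟩ : Mode D) (1 : ℂ)) ⟨l, m'⟩ = if m = m' then 1 else 0 := by
        simp [Finsupp.single_apply]
      rw [this, ← (t l).coe_toBasis]
      simp [DFinsupp.basis, eq_comm]
    · have : (Finsupp.single (⟨l, m⟩ : Mode D) (1 : ℂ)) ⟨l', m'⟩ = 0 := by
        simp [hl]
      rw [this]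
      simp [DFinsupp.basis, hl]
  have h' : (fieldBasis t) a = occNorm a • (SymmetricAlgebra.equivMvPolynomial
      (DFinsupp.basis fun l => (t l).toBasis)).symm (MvPolynomial.monomial a 1) := by
    simp [fieldBasis, Basis.unitsSMul_apply, Units.smul_def]
  rw [h', MvPolynomial.monomial_eq, map_one, one_mul, map_finsuppProd]
  simp only [map_pow, h, occNorm, fieldVec, Finsupp.prod, Algebra.smul_def, map_prod,
    ← Finset.prod_mul_distrib, map_mul, mul_pow, mul_assoc]

/-! ### Creation and annihilation operators -/

/-- The annihilation operator: `α_{l,m} v_a = (a_{l,m})^{1/2} v_{a - e_{l,m}}`. -/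
def annih [Fact (2 < D)] (t : TensorBasis D) (M : Mode D) : FieldSpace D →ₗ[ℂ] FieldSpace D :=
  (fieldBasis t).constr ℂ fun a => (√(a M : ℝ) : ℂ) • fieldBasis t (a - Finsupp.single M 1)

/-- The creation operator: `α⁺_{l,m} v_a = (a_{l,m} + 1)^{1/2} v_{a + e_{l,m}}`. -/
def create [Fact (2 < D)] (t : TensorBasis D) (M : Mode D) : FieldSpace D →ₗ[ℂ] FieldSpace D :=
  (fieldBasis t).constr ℂ fun a => (√(a M + 1 : ℝ) : ℂ) • fieldBasis t (a + Finsupp.single M 1)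

/-- Formal, possibly infinite, linear combinations `∑_c u_c v_c`, given by their components
`u_c = ⟨v^c|u⟩`. This is `Hom(V^*, ℂ)` with `V^*` the span of the dual basis `⟨v^c|`; vertex
operators take values in it. -/
abbrev Formal (D : ℕ) := Occ D → ℂ

/-- The inclusion of `V` into the formal linear combinations. -/
def toFormal [Fact (2 < D)] (t : TensorBasis D) : FieldSpace D →ₗ[ℂ] Formal D :=
  Finsupp.lcoeFun ∘ₗ (fieldBasis t).repr.toLinearMap

/-- The operator `∑_{l,m} G_{l,m} α_{l,m}` on `V`; on each `v_b` only the finitely many modes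
occupied in `b` contribute. -/
def annihSeries [Fact (2 < D)] (t : TensorBasis D) (G : Mode D → ℂ) :
    FieldSpace D →ₗ[ℂ] FieldSpace D :=
  (fieldBasis t).constr ℂ fun b => ∑ M ∈ b.support, G M • annih t M (fieldBasis t b)

/-- The operator `∑_{l,m} F_{l,m} α⁺_{l,m}` on formal linear combinations; only the finitely many
modes occupied in `c` contribute to the `c`-th component, and `α⁺_{l,m}` takes `v_{c'}` to a
multiple of `v_c` only if `c' = c - e_{l,m}`. -/
def createSeries [Fact (2 < D)] (t : TensorBasis D) (F : Mode D → ℂ) :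
    Formal D →ₗ[ℂ] Formal D where
  toFun u c := ∑ M ∈ c.support, F M *
    toFormal t (create t M (fieldBasis t (c - Finsupp.single M 1))) c * u (c - Finsupp.single M 1)
  map_add' u v := by
    ext c
    simp [mul_add, Finset.sum_add_distrib]
  map_smul' z u := by
    ext c
    simp only [Pi.smul_apply, smul_eq_mul, RingHom.id_apply, Finset.mul_sum]
    exact Finset.sum_congr rfl fun M _ => by ring

/-! ### Spherical harmonics and the basic field -/

/-- The polynomial `T̄ · x^{⊗ l}`. -/
def conjContract {l : ℕ} (T : Tensor D l) (x : Pt D) : ℂ :=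
  ∑ μ : Fin l → Fin D, star (T μ) * ∏ i, (x (μ i) : ℂ)

/-- The spherical harmonics `Y_{l,m}(x̂) = k_l t̄_{l,m} · x̂^{⊗ l}`, with the positive constant that
makes the `L²`-norm on the unit sphere, with its surface measure, equal to one. -/
def sphHarm (t : TensorBasis D) (M : Mode D) (x : Pt D) : ℂ :=
  ((√(∫ ω : Metric.sphere (0 : Pt D) 1, ‖conjContract (t M.1 M.2 : Tensor D M.1) (ω : Pt D)‖ ^ 2
    ∂(volume : Measure (Pt D)).toSphere))⁻¹ : ℝ) * conjContract (t M.1 M.2 : Tensor D M.1) x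

/-- `√vol(S^{D-1}) √((D-2)/(2l+D-2))`. -/
def modeConst (D l : ℕ) : ℝ :=
  √((volume : Measure (Pt D)).toSphere.real Set.univ) * √(((D : ℝ) - 2) / (2 * l + D - 2))

/-- The coefficient of `α⁺_{l,m}` in `Y(x, φ)`, as a function of `x`. -/
def createCoeff (t : TensorBasis D) (M : Mode D) (x : Pt D) : ℂ :=
  modeConst D M.1 * ((‖x‖ ^ M.1 : ℝ) * sphHarm t M (‖x‖⁻¹ • x))

/-- The coefficient of `α_{l,m}` in `Y(x, φ)`, as a function of `x`. -/
def annihCoeff (t : TensorBasis D) (M : Mode D) (x : Pt D) : ℂ :=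
  modeConst D M.1 * ((‖x‖ ^ (-(M.1 : ℤ) - D + 2) : ℝ) * star (sphHarm t M (‖x‖⁻¹ • x)))

/-- The derivative `(T · ∂^l f)(x) = ∑_μ T_{μ_1 … μ_l} (∂_{μ_1} ⋯ ∂_{μ_l} f)(x)`. -/
def tensorDeriv {l : ℕ} (T : Tensor D l) (f : Pt D → ℂ) (x : Pt D) : ℂ :=
  ∑ μ : Fin l → Fin D, T μ * iteratedFDeriv ℝ l f x fun i => EuclideanSpace.single (μ i) 1

/-! ### Vertex operators -/

/-- A field differentiated by a trace-free symmetric tensor: the label of `T · ∂^l φ`. -/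
abbrev Deriv (D : ℕ) := Σ l : ℕ, traceFree D l

/-- The maps `V → V` with formal infinite linear combinations as values. -/
abbrev FormalOp (D : ℕ) := FieldSpace D →ₗ[ℂ] Formal D

/-- The map `B ↦ :(T · ∂^l Y(x,φ)) B:` for a normal ordered `B`: the creation part
`∑ (T · ∂^l f_{l',m'})(x) α⁺_{l',m'}` goes to the left of `B`, the annihilation part
`∑ (T · ∂^l g_{l',m'})(x) α_{l',m'}` goes to the right, where `f` and `g` are the coefficients
of `Y(x,φ)`. -/
def normalMul [Fact (2 < D)] (t : TensorBasis D) (x : Pt D) (T : Deriv D) (B : FormalOp D) :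
    FormalOp D :=
  createSeries t (fun M => tensorDeriv (T.2 : Tensor D T.1) (createCoeff t M) x) ∘ₗ B +
    B ∘ₗ annihSeries t (fun M => tensorDeriv (T.2 : Tensor D T.1) (annihCoeff t M) x)

lemma toFormal_create [Fact (2 < D)] (t : TensorBasis D) {M : Mode D} {c : Occ D}
    (h : M ∈ c.support) :
    toFormal t (create t M (fieldBasis t (c - Finsupp.single M 1))) c = √(c M : ℝ) := by
  have h1 : 1 ≤ c M := Nat.one_le_iff_ne_zero.2 (Finsupp.mem_support_iff.1 h)
  have h2 : c - Finsupp.single M 1 + Finsupp.single M 1 = c :=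
    tsub_add_cancel_of_le (Finsupp.single_le_iff.2 h1)
  simp [toFormal, create, Basis.constr_basis, h2, Nat.cast_sub h1]

lemma createSeries_apply [Fact (2 < D)] (t : TensorBasis D) (F : Mode D → ℂ) (u : Formal D)
    (c : Occ D) : createSeries t F u c =
      ∑ M ∈ c.support, F M * √(c M : ℝ) * u (c - Finsupp.single M 1) :=
  Finset.sum_congr rfl fun M hM => by rw [toFormal_create t hM]

/-- On `V`, the operator `z α⁺_{l,m}` is the corresponding one-term series. -/
lemma createSeries_single [Fact (2 < D)] (t : TensorBasis D) (M : Mode D) (z : ℂ)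
    (v : FieldSpace D) :
    createSeries t (Pi.single M z) (toFormal t v) = toFormal t (z • create t M v) := by
  have : createSeries t (Pi.single M z) ∘ₗ toFormal t = toFormal t ∘ₗ (z • create t M) := by
    refine (fieldBasis t).ext fun b => ?_
    ext c
    have hrep : ∀ a c : Occ D, toFormal t (fieldBasis t a) c = if a = c then 1 else 0 := by
      intro a c
      simp [toFormal, Finsupp.single_apply]
    have hcr : (toFormal t ∘ₗ (z • create t M)) (fieldBasis t b) c =
        z * (√(b M + 1 : ℝ) * if b + Finsupp.single M 1 = c then 1 else 0) := by
      simp [create, Basis.constr_basis, hrep]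
    rw [hcr, LinearMap.comp_apply, createSeries_apply]
    rw [Finset.sum_eq_single M (fun N _ hN => by simp [hN])
      (fun h => by simp [Finsupp.notMem_support_iff.1 h]), hrep, Pi.single_eq_same]
    by_cases h : b + Finsupp.single M 1 = c
    · subst h
      simp
    · by_cases hM : c M = 0
      · simp [h, hM]
      · have : ¬ b = c - Finsupp.single M 1 := by
          rintro rfl
          exact h (tsub_add_cancel_of_le
            (Finsupp.single_le_iff.2 (Nat.one_le_iff_ne_zero.2 hM)))
        simp [h, this]
  exact LinearMap.congr_fun this v

lemma annihSeries_basis [Fact (2 < D)] (t : TensorBasis D) (G : Mode D → ℂ) (b : Occ D) :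
    annihSeries t G (fieldBasis t b) =
      ∑ M ∈ b.support, (G M * √(b M : ℝ)) • fieldBasis t (b - Finsupp.single M 1) := by
  simp only [annihSeries, annih, Basis.constr_basis, smul_smul]

/-- Auxiliary symmetry of double sums over occupied modes. -/
lemma occ_sum_comm {A : Type*} [AddCommGroup A] [Module ℂ A] (F G : Mode D → ℂ) (u : Occ D → A)
    (c : Occ D) :
    ∑ M ∈ c.support, (F M * √(c M : ℝ)) • ∑ N ∈ (c - Finsupp.single M 1).support,
        (G N * √((c - Finsupp.single M 1 : Occ D) N : ℝ)) •
          u (c - Finsupp.single M 1 - Finsupp.single N 1) =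
      ∑ M ∈ c.support, (G M * √(c M : ℝ)) • ∑ N ∈ (c - Finsupp.single M 1).support,
        (F N * √((c - Finsupp.single M 1 : Occ D) N : ℝ)) •
          u (c - Finsupp.single M 1 - Finsupp.single N 1) := by
  have key : ∀ (F G : Mode D → ℂ), ∑ M ∈ c.support, (F M * √(c M : ℝ)) •
      ∑ N ∈ (c - Finsupp.single M 1).support, (G N * √((c - Finsupp.single M 1 : Occ D) N : ℝ)) •
          u (c - Finsupp.single M 1 - Finsupp.single N 1) =
      ∑ M ∈ c.support, ∑ N ∈ c.support,
        (F M * G N * (√(c M : ℝ) * √((c - Finsupp.single M 1 : Occ D) N : ℝ) : ℂ)) •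
          u (c - Finsupp.single M 1 - Finsupp.single N 1) := by
    intro F G
    refine Finset.sum_congr rfl fun M _ => ?_
    rw [Finset.smul_sum]
    refine (Finset.sum_subset Finsupp.support_tsub fun N _ hN => ?_).trans
      (Finset.sum_congr rfl fun N _ => ?_)
    · rw [Finsupp.notMem_support_iff.1 hN]
      simp
    · rw [smul_smul]
      congr 1
      ring
  rw [key, key, Finset.sum_comm]
  refine Finset.sum_congr rfl fun N _ => Finset.sum_congr rfl fun M _ => ?_
  rw [tsub_right_comm]
  congr 1
  by_cases h : M = N
  · subst h
    ring
  · simp only [Finsupp.tsub_apply, Finsupp.single_apply, h, Ne.symm h, if_false, tsub_zero]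
    ring

lemma createSeries_comm [Fact (2 < D)] (t : TensorBasis D) (F G : Mode D → ℂ) (u : Formal D) :
    createSeries t F (createSeries t G u) = createSeries t G (createSeries t F u) := by
  ext c
  simp only [createSeries_apply]
  simpa only [smul_eq_mul] using occ_sum_comm F G u c

lemma annihSeries_comm [Fact (2 < D)] (t : TensorBasis D) (F G : Mode D → ℂ) (v : FieldSpace D) :
    annihSeries t F (annihSeries t G v) = annihSeries t G (annihSeries t F v) := by
  have : annihSeries t F ∘ₗ annihSeries t G = annihSeries t G ∘ₗ annihSeries t F := by
    refine (fieldBasis t).ext fun b => ?_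
    simp only [LinearMap.comp_apply, annihSeries_basis, map_sum, map_smul]
    exact occ_sum_comm G F (fieldBasis t) b
  exact LinearMap.congr_fun this v

instance [Fact (2 < D)] (t : TensorBasis D) (x : Pt D) : LeftCommutative (normalMul t x) where
  left_comm S T B := by
    ext v c
    simp only [normalMul, LinearMap.add_apply, LinearMap.comp_apply, map_add, Pi.add_apply]
    rw [createSeries_comm, annihSeries_comm]
    ring

/-- The normal ordered product `: ∏_i T_i · ∂^{l_i} Y(x, φ) :`. -/
def normalProd [Fact (2 < D)] (t : TensorBasis D) (x : Pt D) (s : Multiset (Deriv D)) :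
    FormalOp D :=
  s.foldr (normalMul t x) (toFormal t)

/-- The vertex operators `Y(x, v)`, linear in `v`, with
`Y(x, ∏_i T_i · ∂^{l_i} φ) = : ∏_i T_i · ∂^{l_i} Y(x, φ) :` on the basis of the `v_a`. -/
def vertexOp [Fact (2 < D)] (t : TensorBasis D) (x : Pt D) : FieldSpace D →ₗ[ℂ] FormalOp D :=
  (fieldBasis t).constr ℂ fun a =>
    occNorm a • normalProd t x (a.toMultiset.map fun M => ⟨M.1, t M.1 M.2⟩)

lemma vertexOp_monomial [Fact (2 < D)] (t : TensorBasis D) (x : Pt D) (a : Occ D) :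
    vertexOp t x (a.prod fun M n => dPhi (t M.1 M.2) ^ n) =
      normalProd t x (a.toMultiset.map fun M => ⟨M.1, t M.1 M.2⟩) := by
  have h : fieldBasis t a = occNorm a • (a.prod fun M n => dPhi (t M.1 M.2) ^ n) := by
    rw [fieldBasis_apply]
    simp only [occNorm, fieldVec, Finsupp.prod, Algebra.smul_def, map_prod,
      ← Finset.prod_mul_distrib, map_mul, map_pow, mul_pow, mul_assoc]
  have h' : vertexOp t x (fieldBasis t a) = occNorm a •
      normalProd t x (a.toMultiset.map fun M => ⟨M.1, t M.1 M.2⟩) := by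
    simp only [vertexOp, Basis.constr_basis]
  rw [h, map_smul] at h'
  exact smul_right_injective _ (occNorm_ne_zero a) h'

/-- The defining formula for all field monomials, in recursive form. -/
lemma vertexOp_dPhi_mul [Fact (2 < D)] (t : TensorBasis D) (x : Pt D) {l : ℕ}
    (T : traceFree D l) (v : FieldSpace D) :
    vertexOp t x (dPhi T * v) = normalMul t x ⟨l, T⟩ (vertexOp t x v) := by
  let N : traceFree D l → FormalOp D →ₗ[ℂ] FormalOp D := fun T =>
    { toFun := normalMul t x ⟨l, T⟩
      map_add' := fun B B' => by
        ext w c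
        simp only [normalMul, LinearMap.add_apply, LinearMap.comp_apply, map_add, Pi.add_apply]
        ring
      map_smul' := fun z B => by
        ext w c
        simp only [normalMul, LinearMap.add_apply, LinearMap.comp_apply, map_smul,
          LinearMap.smul_apply, RingHom.id_apply, Pi.add_apply, Pi.smul_apply, smul_eq_mul]
        ring }
  have h1 : ∀ (m : Fin (finrank ℂ (traceFree D l))) (v : FieldSpace D),
      vertexOp t x (dPhi (t l m) * v) = N (t l m) (vertexOp t x v) := by
    intro m v
    have : vertexOp t x ∘ₗ LinearMap.mulLeft ℂ (dPhi (t l m)) = N (t l m) ∘ₗ vertexOp t x := by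
      refine (fieldBasis t).ext fun a => ?_
      have ha : fieldBasis t a = occNorm a • (a.prod fun M n => dPhi (t M.1 M.2) ^ n) := by
        rw [fieldBasis_apply]
        simp only [occNorm, fieldVec, Finsupp.prod, Algebra.smul_def, map_prod,
          ← Finset.prod_mul_distrib, map_mul, map_pow, mul_pow, mul_assoc]
      rw [ha, map_smul, map_smul]
      congr 1
      have hm : dPhi (t l m) * (a.prod fun M n => dPhi (t M.1 M.2) ^ n) =
          (Finsupp.single (⟨l, m⟩ : Mode D) 1 + a).prod fun M n => dPhi (t M.1 M.2) ^ n := by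
        rw [Finsupp.prod_add_index' (by simp) (by simp [pow_add]), Finsupp.prod_single_index]
        · simp
        · simp
      rw [LinearMap.comp_apply, LinearMap.mulLeft_apply, hm, LinearMap.comp_apply,
        vertexOp_monomial, vertexOp_monomial, map_add, Multiset.map_add,
        Finsupp.toMultiset_single, one_smul, Multiset.map_singleton, Multiset.singleton_add]
      simp [normalProd, N]
    exact LinearMap.congr_fun this v
  have hadd : ∀ (ι' : Type) (f : ι' → ℂ) (S : ι' → Tensor D l) (u : Finset ι') (g : Pt D → ℂ),
      tensorDeriv (∑ i ∈ u, f i • S i) g x = ∑ i ∈ u, f i * tensorDeriv (S i) g x := by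
    intro ι' f S u g
    simp only [tensorDeriv, Finset.mul_sum]
    rw [Finset.sum_comm]
    refine Finset.sum_congr rfl fun μ _ => ?_
    simp [Finset.sum_mul, mul_assoc]
  have hT : T = ∑ m, (t l).repr T m • t l m := ((t l).sum_repr T).symm
  have hcs : ∀ (f : Fin (finrank ℂ (traceFree D l)) → ℂ)
      (F : Fin (finrank ℂ (traceFree D l)) → Mode D → ℂ) (u : Formal D),
      createSeries t (fun M => ∑ m, f m * F m M) u = ∑ m, f m • createSeries t (F m) u := by
    intro f F u
    ext c
    simp only [createSeries_apply, Finset.sum_apply, Pi.smul_apply, smul_eq_mul, Finset.mul_sum,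
      Finset.sum_mul]
    rw [Finset.sum_comm]
    exact Finset.sum_congr rfl fun m _ => Finset.sum_congr rfl fun M _ => by ring
  have has : ∀ (f : Fin (finrank ℂ (traceFree D l)) → ℂ)
      (F : Fin (finrank ℂ (traceFree D l)) → Mode D → ℂ),
      annihSeries t (fun M => ∑ m, f m * F m M) = ∑ m, f m • annihSeries t (F m) := by
    intro f F
    refine (fieldBasis t).ext fun b => ?_
    simp only [annihSeries_basis, LinearMap.sum_apply, LinearMap.smul_apply, Finset.smul_sum,
      Finset.sum_mul, Finset.sum_smul, smul_smul]
    rw [Finset.sum_comm]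
    exact Finset.sum_congr rfl fun m _ => Finset.sum_congr rfl fun M _ => by rw [mul_assoc]
  have hN : ∀ B, N T B = ∑ m, (t l).repr T m • N (t l m) B := by
    intro B
    have hT' : (T : Tensor D l) = ∑ m, (t l).repr T m • (t l m : Tensor D l) := by
      conv_lhs => rw [hT]
      simp
    ext w c
    simp only [N, LinearMap.coe_mk, AddHom.coe_mk, normalMul, hT', hadd, LinearMap.add_apply,
      LinearMap.comp_apply, hcs, has, LinearMap.sum_apply, LinearMap.smul_apply, map_sum,
      map_smul, smul_add, Finset.sum_add_distrib]
  have hd : dPhi T = ∑ m, (t l).repr T m • dPhi (t l m) := by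
    conv_lhs => rw [hT]
    simp [dPhi]
  change _ = N T _
  rw [hN, hd, Finset.sum_mul, map_sum]
  exact Finset.sum_congr rfl fun m _ => by rw [smul_mul_assoc, map_smul, h1]

/-- `Y(x, 1) = id`, and `Y(x, ∏_i T_i · ∂^{l_i} φ) = : ∏_i T_i · ∂^{l_i} Y(x, φ) :` for all
trace-free symmetric tensors `T_i`. -/
lemma vertexOp_prod [Fact (2 < D)] (t : TensorBasis D) (x : Pt D) (s : Multiset (Deriv D)) :
    vertexOp t x (s.map fun T => dPhi T.2).prod = normalProd t x s := by
  induction s using Multiset.induction_on with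
  | empty => simpa [normalProd] using vertexOp_monomial t x 0
  | cons T s ih =>
    rw [Multiset.map_cons, Multiset.prod_cons, vertexOp_dPhi_mul, ih]
    simp [normalProd]

/-- The OPE coefficients `C_{ab}^c(x₁, x₂) = ⟨v^c| Y(x₁ - x₂, v_a) |v_b⟩`. -/
def opeCoeff [Fact (2 < D)] (t : TensorBasis D) (a b c : Occ D) (x₁ x₂ : Pt D) : ℂ :=
  vertexOp t (x₁ - x₂) (fieldVec t a) (fieldVec t b) c

end FreeField

end

/-!
Up to the normalization of the basis vectors, the matrix elements of a vertex operator `Y(x, v_a)`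
are those of the normal ordered product of the fields `∑ f_{MN}(x) X_N + ∑ g_{MN}(x) ∂/∂X_N`, each
taken `a_M` times (`vertexOp_fieldBasis`). Here `f_{MN}` and `g_{MN}` (`creMat` and `annMat`) are
the coefficients of `α⁺_N` and `α_N` in `c_M^{-1/2} t_M · ∂^l Y(x, φ)`. Associativity of such
products is a statement about infinite matrices (`wickKernel_assoc`): it holds as soon as
* `g(x) f(y)ᵀ = g(x - y)`, the contraction of two fields,
* `f(x - y) f(y) = f(x)` and `f(x - y) g(y) = g(x)`, the expansion of the field at `x` about `y`,

with absolutely convergent matrix products. The proof raises one entry of `a` at a time: an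
additional annihilation operator on the left is commuted through the second normal ordered product,
and each contraction that this produces is an entry of `g(x - y)`. The rearrangements of double
series that are needed are justified by the same induction for the absolute values of the
coefficients, where only convergence is asserted (`exists_hasSum_comp`, `exists_hasSum_expand`).

The three matrix identities are expansions of harmonic functions. By the value of the norm of the
spherical harmonics (`integral_sphere_contr_sq`), the creation coefficients are
`c_l^{1/2} / l!` times `t̄_M · x^{⊗ l}`, and the annihilation coefficients are
`(-1)^l c_l^{-1/2} t_M · ∂^l` applied to the Newton kernel `|x|^{2-D}` (`createCoeff_eq`,
`annihCoeff_eq_tderiv`). The term of degree `l` in the Taylor series of a harmonic function `f` at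
`y` is therefore a sum over the modes of level `l` of creation coefficients times
`c_l^{-1/2} (t_M · ∂^l f)(y)` (`tderiv_taylorTerm_eq_sum`), by completeness of the `t_{l,m}`. For
`f` a derivative of the Newton kernel this gives the first and the third identity, the first one
with the displacement `-y` from `x` and the parity of the creation coefficients; for `f` a creation
coefficient, a polynomial, it gives the second.

There remains the absolute convergence for a displacement `z` from `y` with `|z| < |y|`. The sum of
the squares of the creation coefficients of level `l` is a multiple of `|z|^{2l}`
(`sum_createCoeff_sq`), where the factor is the binomial coefficient found by restricting the Newton
kernel to a ray, and grows polynomially in `l`. Since the coefficients are harmonic, applying the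
Laplacian to such an identity gives the sum of the squares of the gradients (`sum_gradient_sq`), and
by iteration the sum of the squares of all derivatives of a given order, with a further factor that
is polynomial in `l`. The annihilation coefficients are treated in the same way. Cauchy's
inequality then bounds the terms of level `l` by a polynomial times `(|z| / |y|)^l`
(`exists_sum_norm_le`). The sum of the Taylor series is the function itself because
both are real-analytic along the segment from `y` to `y + z` (`hasSum_taylorTerm`).
-/

namespace FreeField

open Finset

noncomputable section

/-! ### Normal ordered products as infinite matrices -/

section Kernel

variable {I R : Type*} [CommSemiring R]

/-- Multiplication by the linear form `∑ F_N X_N` on formal power series in variables `X_N`,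
in terms of coefficients. -/
def creOp (F : I → R) (u : (I →₀ ℕ) → R) (d : I →₀ ℕ) : R :=
  ∑ N ∈ d.support, F N * u (d - Finsupp.single N 1)

/-- The transpose of the derivation `∑ G_N ∂/∂X_N` on polynomials in variables `X_N`: if `u b` is
the value of a linear map at `X^b`, this is its value at the derivative of `X^b`. -/
def annOp (G : I → R) (u : (I →₀ ℕ) → R) (b : I →₀ ℕ) : R :=
  ∑ N ∈ b.support, G N * (b N : R) * u (b - Finsupp.single N 1)

lemma mem_support_tsub_iff (d : I →₀ ℕ) (M N : I) :
    (M ∈ d.support ∧ N ∈ (d - Finsupp.single M 1).support) ↔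
      (M ∈ (d - Finsupp.single N 1).support ∧ N ∈ d.support) := by
  classical
  by_cases h : M = N
  · subst h; tauto
  · simp [h, Ne.symm h]

lemma creOp_comm (F G : I → R) (u : (I →₀ ℕ) → R) (d : I →₀ ℕ) :
    creOp F (creOp G u) d = creOp G (creOp F u) d := by
  simp only [creOp, mul_sum]
  rw [sum_comm' (t' := d.support) (s' := fun N => (d - Finsupp.single N 1).support)
    (fun M N => mem_support_tsub_iff d M N)]
  refine sum_congr rfl fun N _ => sum_congr rfl fun M _ => ?_
  rw [tsub_right_comm]
  ring

lemma annOp_comm (F G : I → R) (u : (I →₀ ℕ) → R) (d : I →₀ ℕ) :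
    annOp F (annOp G u) d = annOp G (annOp F u) d := by
  classical
  simp only [annOp, mul_sum]
  rw [sum_comm' (t' := d.support) (s' := fun N => (d - Finsupp.single N 1).support)
    (fun M N => mem_support_tsub_iff d M N)]
  refine sum_congr rfl fun N _ => sum_congr rfl fun M _ => ?_
  rw [tsub_right_comm]
  by_cases h : M = N
  · subst h; ring
  · simp only [Finsupp.tsub_apply, Finsupp.single_apply, h, Ne.symm h, if_false, tsub_zero]
    ring

lemma creOp_annOp_comm (F G : I → R) (B : (I →₀ ℕ) → (I →₀ ℕ) → R) (d b : I →₀ ℕ) :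
    creOp F (fun d' => annOp G (B d') b) d =
      annOp G (fun b' => creOp F (fun d' => B d' b') d) b := by
  simp only [creOp, annOp, mul_sum]
  rw [sum_comm]
  exact sum_congr rfl fun _ _ => sum_congr rfl fun _ _ => by ring

lemma annOp_annOp_comm (F G : I → R) (B : (I →₀ ℕ) → (I →₀ ℕ) → R) (d b : I →₀ ℕ) :
    annOp F (fun d' => annOp G (B d') b) d =
      annOp G (fun b' => annOp F (fun d' => B d' b') d) b := by
  simp only [annOp, mul_sum]
  rw [sum_comm]
  exact sum_congr rfl fun _ _ => sum_congr rfl fun _ _ => by ring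

lemma creOp_const_mul (c : R) (F : I → R) (u : (I →₀ ℕ) → R) (d : I →₀ ℕ) :
    c * creOp F u d = creOp F (fun e => c * u e) d := by
  simp only [creOp, mul_sum]
  exact sum_congr rfl fun _ _ => by ring

lemma annOp_const_mul (c : R) (F : I → R) (u : (I →₀ ℕ) → R) (d : I →₀ ℕ) :
    c * annOp F u d = annOp F (fun e => c * u e) d := by
  simp only [annOp, mul_sum]
  exact sum_congr rfl fun _ _ => by ring

lemma creOp_add (F : I → R) (u v : (I →₀ ℕ) → R) (d : I →₀ ℕ) :
    creOp F (fun e => u e + v e) d = creOp F u d + creOp F v d := by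
  simp [creOp, mul_add, sum_add_distrib]

lemma annOp_add (F : I → R) (u v : (I →₀ ℕ) → R) (d : I →₀ ℕ) :
    annOp F (fun e => u e + v e) d = annOp F u d + annOp F v d := by
  simp [annOp, mul_add, sum_add_distrib]

/-- Normal ordered multiplication of an operator, given by its matrix `B`, with the field
`∑ F_N X_N + ∑ G_N ∂/∂X_N`. -/
def wickMul (p : (I → R) × (I → R)) (B : (I →₀ ℕ) → (I →₀ ℕ) → R) (d b : I →₀ ℕ) : R :=
  creOp p.1 (fun d' => B d' b) d + annOp p.2 (B d) b

instance : LeftCommutative (wickMul (I := I) (R := R)) where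
  left_comm p q B := by
    ext d b
    have h : ∀ p : (I → R) × (I → R), wickMul p B = fun d b =>
        creOp p.1 (fun d' => B d' b) d + annOp p.2 (B d) b := fun _ => rfl
    simp only [h, wickMul, creOp_add, annOp_add]
    rw [creOp_comm, annOp_comm, creOp_annOp_comm, ← creOp_annOp_comm q.1]
    ring

open Classical in
/-- The matrix of the normal ordered product `:∏_M (∑ f_{MN} X_N + ∑ g_{MN} ∂/∂X_N)^{a_M}:` in the
basis of monomials: `wickKernel f g d a b` is the coefficient of `X^d` in its value at `X^b`. -/
def wickKernel (f g : I → I → R) (d a b : I →₀ ℕ) : R :=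
  (a.toMultiset.map fun M => (f M, g M)).foldr wickMul (fun d b => if d = b then 1 else 0) d b

lemma wickKernel_zero [DecidableEq I] (f g : I → I → R) (d b : I →₀ ℕ) :
    wickKernel f g d 0 b = if d = b then 1 else 0 := by
  simp [wickKernel]

lemma wickKernel_add_single (f g : I → I → R) (d a b : I →₀ ℕ) (K : I) :
    wickKernel f g d (a + Finsupp.single K 1) b =
      creOp (f K) (fun d' => wickKernel f g d' a b) d + annOp (g K) (wickKernel f g d a) b := by
  classical
  rw [wickKernel, map_add, Finsupp.toMultiset_single, one_smul, add_comm, Multiset.singleton_add,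
    Multiset.map_cons, Multiset.foldr_cons, wickMul]
  rfl

/-- Induction on multi-indices, raising one entry at a time. -/
lemma occ_induction {P : (I →₀ ℕ) → Prop} (zero : P 0)
    (add : ∀ a K, P a → P (a + Finsupp.single K 1)) (a : I →₀ ℕ) : P a := by
  classical
  have : ∀ s : Multiset I, P (Multiset.toFinsupp s) := by
    intro s
    induction s using Multiset.induction_on with
    | empty => simpa using zero
    | cons K s ih =>
      have := add _ K ih
      rwa [← Multiset.toFinsupp_singleton, ← map_add, add_comm, Multiset.singleton_add] at this
  simpa using this a.toMultiset

lemma tsub_single_add_single {e : I →₀ ℕ} {N : I} (hN : N ∈ e.support) :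
    e - Finsupp.single N 1 + Finsupp.single N 1 = e :=
  tsub_add_cancel_of_le (Finsupp.single_le_iff.2
    (Nat.one_le_iff_ne_zero.2 (Finsupp.mem_support_iff.1 hN)))

lemma support_add_single [DecidableEq I] (e : I →₀ ℕ) (M : I) :
    (e + Finsupp.single M 1).support = insert M e.support := by
  ext N
  by_cases h : M = N
  · subst h; simp
  · simp [Ne.symm h]

/-- The commutation relation of a derivation `∂/∂X_M` and a creation operator, for the matrix
entries. -/
lemma raise_creOp (F : I → R) (u : (I →₀ ℕ) → R) (e : I →₀ ℕ) (M : I) :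
    ((e M : R) + 1) * creOp F u (e + Finsupp.single M 1) =
      F M * u e + creOp F (fun e' => ((e' M : R) + 1) * u (e' + Finsupp.single M 1)) e := by
  classical
  have key : ∀ N ∈ e.support, N ≠ M → ((e M : R) + 1) * (F N * u (e + Finsupp.single M 1 -
      Finsupp.single N 1)) = F N * ((((e - Finsupp.single N 1 : I →₀ ℕ) M : ℕ) + 1 : R) *
        u (e - Finsupp.single N 1 + Finsupp.single M 1)) := by
    intro N hN hNM
    have h1 : e + Finsupp.single M 1 - Finsupp.single N 1 =
        e - Finsupp.single N 1 + Finsupp.single M 1 :=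
      (tsub_add_eq_add_tsub (Finsupp.single_le_iff.2
        (Nat.one_le_iff_ne_zero.2 (Finsupp.mem_support_iff.1 hN)))).symm
    rw [h1]
    simp only [Finsupp.tsub_apply, Finsupp.single_apply, hNM, if_false, tsub_zero]
    ring
  have hu : u (e + Finsupp.single M 1 - Finsupp.single M 1) = u e := by simp
  simp only [creOp]
  rw [support_add_single]
  by_cases hM : M ∈ e.support
  · rw [insert_eq_of_mem hM, ← add_sum_erase _ _ hM, ← add_sum_erase _ _ hM, mul_add, mul_sum,
      sum_congr rfl fun N hN => key N (mem_of_mem_erase hN) (ne_of_mem_erase hN), hu,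
      tsub_single_add_single hM]
    have h2 : (((e - Finsupp.single M 1 : I →₀ ℕ) M : ℕ) : R) + 1 = (e M : R) := by
      have := DFunLike.congr_fun (tsub_single_add_single hM) M
      simp only [Finsupp.add_apply, Finsupp.single_eq_same] at this
      exact_mod_cast congrArg (Nat.cast (R := R)) this
    rw [h2]
    ring
  · rw [sum_insert hM, mul_add, mul_sum,
      sum_congr rfl fun N hN => key N hN (fun h => hM (h ▸ hN)), hu,
      Finsupp.notMem_support_iff.1 hM]
    simp

/-- The commutation relation of a derivation and the multiplication by `X_K`, for the matrix
entries. -/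
lemma raise_annOp (γ : I → R) (u : (I →₀ ℕ) → R) (a : I →₀ ℕ) (K : I) :
    annOp γ u (a + Finsupp.single K 1) =
      γ K * u a + annOp γ (fun a' => u (a' + Finsupp.single K 1)) a := by
  classical
  have key : ∀ N ∈ a.support, N ≠ K → γ N * ((a + Finsupp.single K 1 : I →₀ ℕ) N : R) *
      u (a + Finsupp.single K 1 - Finsupp.single N 1) = γ N * (a N : R) *
        u (a - Finsupp.single N 1 + Finsupp.single K 1) := by
    intro N hN hNM
    have h1 : a + Finsupp.single K 1 - Finsupp.single N 1 =
        a - Finsupp.single N 1 + Finsupp.single K 1 :=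
      (tsub_add_eq_add_tsub (Finsupp.single_le_iff.2
        (Nat.one_le_iff_ne_zero.2 (Finsupp.mem_support_iff.1 hN)))).symm
    rw [h1]
    simp [Ne.symm hNM]
  have hu : u (a + Finsupp.single K 1 - Finsupp.single K 1) = u a := by simp
  simp only [annOp]
  rw [support_add_single]
  by_cases hK : K ∈ a.support
  · rw [insert_eq_of_mem hK, ← add_sum_erase _ _ hK, ← add_sum_erase _ _ hK,
      sum_congr rfl fun N hN => key N (mem_of_mem_erase hN) (ne_of_mem_erase hN), hu,
      tsub_single_add_single hK]
    simp only [Finsupp.add_apply, Finsupp.single_eq_same]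
    push_cast
    ring
  · rw [sum_insert hK, sum_congr rfl fun N hN => key N hN (fun h => hK (h ▸ hN)), hu]
    simp [Finsupp.notMem_support_iff.1 hK]

end Kernel

/-! ### Series of normal ordered products -/

section Series

section

variable {I R : Type*} [CommSemiring R] [TopologicalSpace R] {fx gx fy gy fz gz : I → I → R}

lemma hasSum_of_eq {β : Type*} {u v : β → R} {S : R} (h : ∀ i, v i = u i) (hu : HasSum u S) :
    HasSum v S := by
  rwa [funext h]

lemma hasSum_comp_zero (d a b : I →₀ ℕ) :
    HasSum (fun e => wickKernel fx gx d 0 e * wickKernel fy gy e a b) (wickKernel fy gy d a b) := by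
  classical
  have := hasSum_single (f := fun e => wickKernel fx gx d 0 e * wickKernel fy gy e a b) d
    fun e he => by rw [wickKernel_zero, if_neg he.symm, zero_mul]
  simpa [wickKernel_zero] using this

lemma hasSum_expand_zero (d a b : I →₀ ℕ) :
    HasSum (fun e => wickKernel fz gz e 0 a * wickKernel fy gy d e b) (wickKernel fy gy d a b) := by
  classical
  have := hasSum_single (f := fun e => wickKernel fz gz e 0 a * wickKernel fy gy d e b) a
    fun e he => by rw [wickKernel_zero, if_neg he, zero_mul]
  simpa [wickKernel_zero] using this

end

variable {I R : Type*} [CommSemiring R] [TopologicalSpace R] [IsTopologicalSemiring R]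

lemma hasSum_creOp {β : Type*} (F : I → R) {u : β → (I →₀ ℕ) → R} {U : (I →₀ ℕ) → R}
    (h : ∀ e, HasSum (fun i => u i e) (U e)) (d : I →₀ ℕ) :
    HasSum (fun i => creOp F (u i) d) (creOp F U d) :=
  hasSum_sum fun N _ => (h _).mul_left (F N)

lemma hasSum_annOp {β : Type*} (F : I → R) {u : β → (I →₀ ℕ) → R} {U : (I →₀ ℕ) → R}
    (h : ∀ e, HasSum (fun i => u i e) (U e)) (d : I →₀ ℕ) :
    HasSum (fun i => annOp F (u i) d) (annOp F U d) :=
  hasSum_sum fun N _ => (h _).mul_left (F N * (d N : R))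

/-- The commutator of the derivation `∑ G_M ∂/∂X_M` with a normal ordered product, in matrix
form: the derivation contracts with each factor of the product, and `γ` collects these
contractions. -/
lemma hasSum_wickKernel_contract (f g : I → I → R) (G γ : I → R)
    (h : ∀ N, HasSum (fun M => G M * f N M) (γ N)) (a : I →₀ ℕ) : ∀ e b : I →₀ ℕ,
    HasSum (fun M => G M * (((e M : R) + 1) * wickKernel f g (e + Finsupp.single M 1) a b))
      (annOp G (wickKernel f g e a) b + annOp γ (fun a' => wickKernel f g e a' b) a) := by
  classical
  induction a using occ_induction with
  | zero =>
    intro e b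
    have h0 : annOp γ (fun a' => wickKernel f g e a' b) 0 = 0 := by simp [annOp]
    rw [h0, add_zero]
    simp only [wickKernel_zero, annOp]
    have : ∀ M ∉ b.support, G M * (((e M : R) + 1) *
        if e + Finsupp.single M 1 = b then 1 else 0) = 0 := by
      intro M hM
      rw [if_neg, mul_zero, mul_zero]
      rintro rfl
      simp at hM
    have h1 : ∑ M ∈ b.support, G M * (b M : R) * (if e = b - Finsupp.single M 1 then 1 else 0) =
        ∑ M ∈ b.support, G M * (((e M : R) + 1) *
          if e + Finsupp.single M 1 = b then 1 else 0) := by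
      refine sum_congr rfl fun M hM => ?_
      by_cases hb : e + Finsupp.single M 1 = b
      · subst hb
        simp
      · have : ¬ e = b - Finsupp.single M 1 := by
          rintro rfl
          exact hb (tsub_single_add_single hM)
        simp [hb, this]
    rw [h1]
    exact hasSum_sum_of_ne_finset_zero this
  | add a K ih =>
    intro e b
    have h1 := (h K).mul_right (wickKernel f g e a b)
    have h2 := hasSum_creOp (f K) (fun e' => ih e' b) e
    have h3 := hasSum_annOp (g K) (fun b' => ih e b') b
    have h4 : annOp G (wickKernel f g e (a + Finsupp.single K 1)) b +
        annOp γ (fun a' => wickKernel f g e a' b) (a + Finsupp.single K 1) =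
        γ K * wickKernel f g e a b + creOp (f K) (fun e' => annOp G (wickKernel f g e' a) b +
          annOp γ (fun a' => wickKernel f g e' a' b) a) e +
        annOp (g K) (fun b' => annOp G (wickKernel f g e a) b' +
          annOp γ (fun a' => wickKernel f g e a' b') a) b := by
      have h5 : wickKernel f g e (a + Finsupp.single K 1) = fun b =>
          creOp (f K) (fun e' => wickKernel f g e' a b) e +
            annOp (g K) (wickKernel f g e a) b :=
        funext fun b => wickKernel_add_single f g e a b K
      rw [raise_annOp, h5]
      simp only [wickKernel_add_single, creOp_add, annOp_add]
      rw [creOp_annOp_comm, annOp_comm G, creOp_annOp_comm (f K) γ (fun e' a' =>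
        wickKernel f g e' a' b), annOp_annOp_comm (g K) γ (fun b' a' => wickKernel f g e a' b')]
      ring
    rw [h4]
    refine hasSum_of_eq (fun M => ?_) ((h1.add h2).add h3)
    rw [wickKernel_add_single, mul_add, raise_creOp, mul_add, mul_add, creOp_const_mul,
      annOp_const_mul, annOp_const_mul, mul_assoc]

/-- If the fields at a point are expanded in the fields `f`, `g` at another point with coefficients
`F`, the corresponding normal ordered products are expanded in the same way. -/
lemma hasSum_wickKernel_expand (f g : I → I → R) (F φ χ : I → R)
    (hf : ∀ N, HasSum (fun M => F M * f M N) (φ N))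
    (hg : ∀ N, HasSum (fun M => F M * g M N) (χ N)) (d e b : I →₀ ℕ) :
    HasSum (fun M => F M * wickKernel f g d (e + Finsupp.single M 1) b)
      (creOp φ (fun d' => wickKernel f g d' e b) d + annOp χ (wickKernel f g d e) b) := by
  have h1 : HasSum (fun M => ∑ N ∈ d.support, F M * f M N *
      wickKernel f g (d - Finsupp.single N 1) e b) _ :=
    hasSum_sum fun N _ => (hf N).mul_right _
  have h2 : HasSum (fun M => ∑ N ∈ b.support, F M * g M N *
      (b N * wickKernel f g d e (b - Finsupp.single N 1))) _ :=
    hasSum_sum fun N _ => (hg N).mul_right _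
  simp only [creOp, annOp, mul_assoc] at h1 h2 ⊢
  refine hasSum_of_eq (fun M => ?_) (h1.add h2)
  rw [wickKernel_add_single, mul_add, creOp_const_mul, annOp_const_mul]
  simp only [creOp, annOp]
  congr 1 <;> exact sum_congr rfl fun _ _ => by ring

/-- Summation over the pairs of a multi-index and an additional mode, sorted by their sum. -/
lemma hasSum_sum_lower [RegularSpace R] {h : (I →₀ ℕ) × I → R} {S : R} (hh : HasSum h S) :
    HasSum (fun e : I →₀ ℕ => ∑ M ∈ e.support, h (e - Finsupp.single M 1, M)) S := by
  classical
  let E : (Σ e : I →₀ ℕ, e.support) ≃ (I →₀ ℕ) × I :=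
    { toFun := fun q => (q.1 - Finsupp.single q.2.1 1, q.2.1)
      invFun := fun q => ⟨q.1 + Finsupp.single q.2 1, q.2, by simp⟩
      left_inv := by
        rintro ⟨e, M, hM⟩
        exact Sigma.subtype_ext (tsub_single_add_single hM) rfl
      right_inv := by
        rintro ⟨e, M⟩
        simp }
  have h1 : HasSum (h ∘ E) S := (Equiv.hasSum_iff E).2 hh
  refine h1.sigma fun e => ?_
  rw [← sum_coe_sort]
  exact hasSum_fintype _

variable {fx gx fy gy fz gz : I → I → R} {p : I →₀ ℕ} {W : (I →₀ ℕ) → (I →₀ ℕ) → (I →₀ ℕ) → R}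
  {K : I}

/-- The iterated sum of the double series in `hasSum_comp_raise`, the inner sum over the contracted
mode being given by `hasSum_wickKernel_contract`. -/
lemma hasSum_comp_outer
    (ih : ∀ d a b, HasSum (fun e => wickKernel fx gx d p e * wickKernel fy gy e a b) (W d a b))
    (d a b : I →₀ ℕ) :
    HasSum (fun e => wickKernel fx gx d p e * (annOp (gx K) (wickKernel fy gy e a) b +
      annOp (gz K) (fun a' => wickKernel fy gy e a' b) a))
      (annOp (gx K) (W d a) b + annOp (gz K) (fun a' => W d a' b) a) := by
  refine hasSum_of_eq (fun e => ?_) ((hasSum_annOp (gx K) (fun b' => ih d a b') b).add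
    (hasSum_annOp (gz K) (fun a' => ih d a' b) a))
  rw [mul_add, annOp_const_mul, annOp_const_mul]

/-- Products of vertex operators, where the first one acquires a further factor. -/
lemma hasSum_comp_raise [T3Space R]
    (ih : ∀ d a b, HasSum (fun e => wickKernel fx gx d p e * wickKernel fy gy e a b) (W d a b))
    (h : ∀ N, HasSum (fun M => gx K M * fy N M) (gz K N)) (d a b : I →₀ ℕ)
    (hs : Summable fun q : (I →₀ ℕ) × I => wickKernel fx gx d p q.1 *
      (gx K q.2 * (((q.1 q.2 : R) + 1) * wickKernel fy gy (q.1 + Finsupp.single q.2 1) a b))) :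
    HasSum (fun e => wickKernel fx gx d (p + Finsupp.single K 1) e * wickKernel fy gy e a b)
      (creOp (fx K) (fun d' => W d' a b) d +
        (annOp (gx K) (W d a) b + annOp (gz K) (fun a' => W d a' b) a)) := by
  have h4 := hs.hasSum.prod_fiberwise fun e =>
    (hasSum_wickKernel_contract fy gy (gx K) (gz K) h a e b).mul_left (wickKernel fx gx d p e)
  have h6 := hasSum_sum_lower hs.hasSum
  rw [h4.unique (hasSum_comp_outer ih d a b)] at h6
  refine hasSum_of_eq (fun e => ?_) ((hasSum_creOp (fx K) (fun d' => ih d' a b) d).add h6)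
  rw [wickKernel_add_single, add_mul, mul_comm (creOp _ _ _), creOp_const_mul]
  congr 1
  · congr 1
    ext d'
    ring
  · rw [annOp, sum_mul]
    refine sum_congr rfl fun M hM => ?_
    dsimp only
    rw [tsub_single_add_single hM]
    have h2 : (((e - Finsupp.single M 1 : I →₀ ℕ) M : ℕ) : R) + 1 = (e M : R) := by
      have := DFunLike.congr_fun (tsub_single_add_single hM) M
      simp only [Finsupp.add_apply, Finsupp.single_eq_same] at this
      exact_mod_cast congrArg (Nat.cast (R := R)) this
    rw [h2]
    ring

/-- The iterated sum of the double series in `hasSum_expand_raise`, the inner sum being given by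
`hasSum_wickKernel_expand`. -/
lemma hasSum_expand_outer
    (ih : ∀ d a b, HasSum (fun e => wickKernel fz gz e p a * wickKernel fy gy d e b) (W d a b))
    (d a b : I →₀ ℕ) :
    HasSum (fun e => wickKernel fz gz e p a *
      (creOp (fx K) (fun d' => wickKernel fy gy d' e b) d +
        annOp (gx K) (wickKernel fy gy d e) b))
      (creOp (fx K) (fun d' => W d' a b) d + annOp (gx K) (W d a) b) := by
  refine hasSum_of_eq (fun e => ?_) ((hasSum_creOp (fx K) (fun d' => ih d' a b) d).add
    (hasSum_annOp (gx K) (fun b' => ih d a b') b))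
  rw [mul_add, annOp_const_mul, creOp_const_mul]

/-- Vertex operators of the expansion of a product, where the first factor of the product acquires
a further factor. -/
lemma hasSum_expand_raise [T3Space R]
    (ih : ∀ d a b, HasSum (fun e => wickKernel fz gz e p a * wickKernel fy gy d e b) (W d a b))
    (hf : ∀ N, HasSum (fun M => fz K M * fy M N) (fx K N))
    (hg : ∀ N, HasSum (fun M => fz K M * gy M N) (gx K N)) (d a b : I →₀ ℕ)
    (hs : Summable fun q : (I →₀ ℕ) × I => wickKernel fz gz q.1 p a *
      (fz K q.2 * wickKernel fy gy d (q.1 + Finsupp.single q.2 1) b)) :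
    HasSum (fun e => wickKernel fz gz e (p + Finsupp.single K 1) a * wickKernel fy gy d e b)
      (creOp (fx K) (fun d' => W d' a b) d +
        (annOp (gx K) (W d a) b + annOp (gz K) (fun a' => W d a' b) a)) := by
  have h4 := hs.hasSum.prod_fiberwise fun e =>
    (hasSum_wickKernel_expand fy gy (fz K) (fx K) (gx K) hf hg d e b).mul_left
      (wickKernel fz gz e p a)
  have h6 := hasSum_sum_lower hs.hasSum
  rw [h4.unique (hasSum_expand_outer ih d a b)] at h6
  rw [← add_assoc]
  refine hasSum_of_eq (fun e => ?_) (h6.add (hasSum_annOp (gz K) (fun a' => ih d a' b) a))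
  rw [wickKernel_add_single, add_mul, mul_comm (annOp _ _ _), annOp_const_mul]
  congr 1
  · rw [creOp, sum_mul]
    refine sum_congr rfl fun M hM => ?_
    dsimp only
    rw [tsub_single_add_single hM]
    ring
  · congr 1
    ext d'
    ring

end Series

/-! ### Non-negative coefficients -/

section NNReal

lemma summable_nnnorm_iff {α : Type*} {u : α → ℂ} : (Summable fun i => ‖u i‖₊) ↔ Summable u := by
  rw [← NNReal.summable_coe]
  exact summable_norm_iff

open scoped NNReal

variable {I : Type*}

lemma nnreal_summable_prod_of_hasSum {α β : Type*} {h : α × β → ℝ≥0} {k : α → ℝ≥0} {S : ℝ≥0}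
    (h1 : ∀ a, HasSum (fun b => h (a, b)) (k a)) (h2 : HasSum k S) : Summable h := by
  rw [← NNReal.summable_coe, summable_prod_of_nonneg fun _ => NNReal.coe_nonneg _]
  refine ⟨fun a => NNReal.summable_coe.2 (h1 a).summable, ?_⟩
  have : (fun a => ∑' b, ((h (a, b) : ℝ≥0) : ℝ)) = fun a => (k a : ℝ) := by
    ext a
    rw [← NNReal.coe_tsum, (h1 a).tsum_eq]
  rw [this]
  exact NNReal.summable_coe.2 h2.summable

lemma nnnorm_wickKernel_le (f g : I → I → ℂ) (a : I →₀ ℕ) : ∀ d b : I →₀ ℕ,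
    ‖wickKernel f g d a b‖₊ ≤ wickKernel (fun M N => ‖f M N‖₊) (fun M N => ‖g M N‖₊) d a b := by
  classical
  induction a using occ_induction with
  | zero =>
    intro d b
    rw [wickKernel_zero, wickKernel_zero]
    split_ifs <;> simp
  | add a K ih =>
    intro d b
    rw [wickKernel_add_single, wickKernel_add_single]
    refine (nnnorm_add_le _ _).trans (add_le_add ?_ ?_)
    · refine (nnnorm_sum_le _ _).trans (sum_le_sum fun N _ => ?_)
      rw [nnnorm_mul]
      exact mul_le_mul_right (ih _ _) _
    · refine (nnnorm_sum_le _ _).trans (sum_le_sum fun N _ => ?_)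
      rw [nnnorm_mul, nnnorm_mul, Complex.nnnorm_natCast]
      exact mul_le_mul_right (ih _ _) _

variable {fx gx fy gy fz gz : I → I → ℝ≥0}

/-- For non-negative coefficients, the convergence of the iterated sum is enough to rearrange the
double series in `hasSum_comp_raise`. -/
lemma summable_comp {p : I →₀ ℕ} {W : (I →₀ ℕ) → (I →₀ ℕ) → (I →₀ ℕ) → ℝ≥0}
    (ih : ∀ d a b, HasSum (fun e => wickKernel fx gx d p e * wickKernel fy gy e a b) (W d a b))
    {K : I} (h : ∀ N, HasSum (fun M => gx K M * fy N M) (gz K N)) (d a b : I →₀ ℕ) :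
    Summable fun q : (I →₀ ℕ) × I => wickKernel fx gx d p q.1 *
      (gx K q.2 * (((q.1 q.2 : ℝ≥0) + 1) * wickKernel fy gy (q.1 + Finsupp.single q.2 1) a b)) :=
  nnreal_summable_prod_of_hasSum (fun e =>
    (hasSum_wickKernel_contract fy gy (gx K) (gz K) h a e b).mul_left (wickKernel fx gx d p e))
    (hasSum_comp_outer ih d a b)

/-- For non-negative coefficients, products of vertex operators are defined as soon as the
contractions of two fields are. -/
lemma exists_hasSum_comp (h : ∀ K N, HasSum (fun M => gx K M * fy N M) (gz K N)) (p : I →₀ ℕ) :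
    ∃ W : (I →₀ ℕ) → (I →₀ ℕ) → (I →₀ ℕ) → ℝ≥0, ∀ d a b,
      HasSum (fun e => wickKernel fx gx d p e * wickKernel fy gy e a b) (W d a b) := by
  induction p using occ_induction with
  | zero => exact ⟨_, hasSum_comp_zero⟩
  | add p K ih =>
    obtain ⟨W, ih⟩ := ih
    exact ⟨_, fun d a b => hasSum_comp_raise ih (h K) d a b (summable_comp ih (h K) d a b)⟩

/-- For non-negative coefficients, the convergence of the iterated sum is enough to rearrange the
double series in `hasSum_expand_raise`. -/
lemma summable_expand {p : I →₀ ℕ} {W : (I →₀ ℕ) → (I →₀ ℕ) → (I →₀ ℕ) → ℝ≥0}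
    (ih : ∀ d a b, HasSum (fun e => wickKernel fz gz e p a * wickKernel fy gy d e b) (W d a b))
    {K : I} (hf : ∀ N, HasSum (fun M => fz K M * fy M N) (fx K N))
    (hg : ∀ N, HasSum (fun M => fz K M * gy M N) (gx K N)) (d a b : I →₀ ℕ) :
    Summable fun q : (I →₀ ℕ) × I => wickKernel fz gz q.1 p a *
      (fz K q.2 * wickKernel fy gy d (q.1 + Finsupp.single q.2 1) b) :=
  nnreal_summable_prod_of_hasSum (fun e =>
    (hasSum_wickKernel_expand fy gy (fz K) (fx K) (gx K) hf hg d e b).mul_left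
      (wickKernel fz gz e p a)) (hasSum_expand_outer ih d a b)

/-- For non-negative coefficients, the vertex operator of an expanded product is defined as soon
as the expansions of the fields converge. -/
lemma exists_hasSum_expand (hf : ∀ K N, HasSum (fun M => fz K M * fy M N) (fx K N))
    (hg : ∀ K N, HasSum (fun M => fz K M * gy M N) (gx K N)) (p : I →₀ ℕ) :
    ∃ W : (I →₀ ℕ) → (I →₀ ℕ) → (I →₀ ℕ) → ℝ≥0, ∀ d a b,
      HasSum (fun e => wickKernel fz gz e p a * wickKernel fy gy d e b) (W d a b) := by
  induction p using occ_induction with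
  | zero => exact ⟨_, hasSum_expand_zero⟩
  | add p K ih =>
    obtain ⟨W, ih⟩ := ih
    exact ⟨_, fun d a b => hasSum_expand_raise ih (hf K) (hg K) d a b
      (summable_expand ih (hf K) (hg K) d a b)⟩

end NNReal

/-! ### Associativity of normal ordered products -/

section Associativity

variable {I : Type*} {fx gx fy gy fz gz : I → I → ℂ}

/-- Associativity for normal ordered products of fields: if the coefficients `(fx, gx)`,
`(fy, gy)`, `(fz, gz)` of three families of fields are related by `gx fyᵀ = gz`, `fz fy = fx` and
`fz gy = gx` as infinite matrices, then both ways to compose three normal ordered products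
converge absolutely and agree. -/
theorem wickKernel_assoc (h : ∀ K N, HasSum (fun M => gx K M * fy N M) (gz K N))
    (hf : ∀ K N, HasSum (fun M => fz K M * fy M N) (fx K N))
    (hg : ∀ K N, HasSum (fun M => fz K M * gy M N) (gx K N)) (p : I →₀ ℕ) :
    ∃ W : (I →₀ ℕ) → (I →₀ ℕ) → (I →₀ ℕ) → ℂ, ∀ d a b,
      HasSum (fun e => wickKernel fx gx d p e * wickKernel fy gy e a b) (W d a b) ∧
      HasSum (fun e => wickKernel fz gz e p a * wickKernel fy gy d e b) (W d a b) := by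
  -- Absolute convergence of all double series follows by comparison with non-negative coefficients.
  have nn : ∀ {u v : I → ℂ} {s : ℂ}, HasSum (fun M => u M * v M) s →
      HasSum (fun M => ‖u M‖₊ * ‖v M‖₊) (∑' M, ‖u M‖₊ * ‖v M‖₊) := by
    intro u v s h
    have := summable_nnnorm_iff.2 h.summable
    simp only [nnnorm_mul] at this
    exact this.hasSum
  have hcast : ∀ n : ℕ, ‖(n : ℂ) + 1‖₊ = (n : NNReal) + 1 := by
    intro n
    rw [← Nat.cast_one (R := ℂ), ← Nat.cast_add, Complex.nnnorm_natCast]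
    push_cast
    rfl
  induction p using occ_induction with
  | zero => exact ⟨_, fun d a b => ⟨hasSum_comp_zero d a b, hasSum_expand_zero d a b⟩⟩
  | add p K ih =>
    obtain ⟨W, ih⟩ := ih
    obtain ⟨W₁, ih₁⟩ := exists_hasSum_comp (fx := fun M N => ‖fx M N‖₊)
      (gy := fun M N => ‖gy M N‖₊) (fun K N => nn (h K N)) p
    obtain ⟨W₂, ih₂⟩ := exists_hasSum_expand (gz := fun M N => ‖gz M N‖₊)
      (fun K N => nn (hf K N)) (fun K N => nn (hg K N)) p
    refine ⟨_, fun d a b => ⟨hasSum_comp_raise (fun d a b => (ih d a b).1) (h K) d a b ?_,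
      hasSum_expand_raise (fun d a b => (ih d a b).2) (hf K) (hg K) d a b ?_⟩⟩
    · refine summable_nnnorm_iff.1 (NNReal.summable_of_le (fun q => ?_)
        (summable_comp (gz := fun K N => ∑' M, ‖gx K M‖₊ * ‖fy N M‖₊) ih₁ (fun N => nn (h K N))
          d a b))
      simp only [nnnorm_mul, hcast]
      gcongr <;> apply nnnorm_wickKernel_le
    · refine summable_nnnorm_iff.1 (NNReal.summable_of_le (fun q => ?_)
        (summable_expand (fx := fun K N => ∑' M, ‖fz K M‖₊ * ‖fy M N‖₊)
          (gx := fun K N => ∑' M, ‖fz K M‖₊ * ‖gy M N‖₊) ih₂ (fun N => nn (hf K N))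
          (fun N => nn (hg K N)) d a b))
      simp only [nnnorm_mul]
      gcongr <;> apply nnnorm_wickKernel_le

end Associativity

/-! ### Matrix elements of vertex operators -/

section Link

lemma finsupp_prod_add_single {I R : Type*} [CommMonoid R] {h : I → ℕ → R} (h0 : ∀ i, h i 0 = 1)
    (a : I →₀ ℕ) (K : I) {r : R} (hr : h K (a K + 1) = r * h K (a K)) :
    (a + Finsupp.single K 1).prod h = r * a.prod h := by
  classical
  rw [Finsupp.prod_of_support_subset (a + Finsupp.single K 1) (s := insert K a.support)
      (support_add_single a K).subset _ (fun i _ => h0 i),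
    Finsupp.prod_of_support_subset a (s := insert K a.support) (subset_insert _ _) _
      (fun i _ => h0 i),
    ← mul_prod_erase _ _ (mem_insert_self K a.support),
    ← mul_prod_erase _ (fun x => h x (a x)) (mem_insert_self K a.support), ← mul_assoc, ← hr]
  congr 1
  · simp
  · refine prod_congr rfl fun i hi => ?_
    simp [(ne_of_mem_erase hi).symm]

/-- `a! = ∏_M a_M!`. -/
def occFact {D : ℕ} (a : Occ D) : ℝ := a.prod fun _ n => (n.factorial : ℝ)

lemma occFact_pos {D : ℕ} (a : Occ D) : 0 < occFact a :=
  prod_pos fun _ _ => by positivity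

lemma occFact_add_single {D : ℕ} (a : Occ D) (K : Mode D) :
    occFact (a + Finsupp.single K 1) = (a K + 1) * occFact a :=
  finsupp_prod_add_single (by simp) a K (by rw [Nat.factorial_succ]; push_cast; ring)

lemma occFact_of_mem {D : ℕ} {a : Occ D} {K : Mode D} (h : K ∈ a.support) :
    occFact a = a K * occFact (a - Finsupp.single K 1) := by
  have h1 := occFact_add_single (a - Finsupp.single K 1) K
  have h2 : (((a - Finsupp.single K 1 : Occ D) K : ℕ) : ℝ) + 1 = a K := by
    have := DFunLike.congr_fun (tsub_single_add_single h) K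
    simp only [Finsupp.add_apply, Finsupp.single_eq_same] at this
    exact_mod_cast congrArg (Nat.cast (R := ℝ)) this
  rwa [tsub_single_add_single h, h2] at h1

lemma occFact_zero {D : ℕ} : occFact (0 : Occ D) = 1 := by simp [occFact]

attribute [irreducible] occFact

variable {D : ℕ} [Fact (2 < D)] (t : TensorBasis D)

lemma fieldBasis_zero : fieldBasis t 0 = 1 := by
  simp [fieldBasis_apply, fieldVec]

lemma fieldBasis_add_single (a : Occ D) (K : Mode D) :
    fieldBasis t (a + Finsupp.single K 1) = ((√(a K + 1 : ℝ) : ℂ)⁻¹ * (√(cConst D K.1) : ℂ)⁻¹) •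
      (dPhi (t K.1 K.2) * fieldBasis t a) := by
  rw [fieldBasis_apply, fieldBasis_apply, fieldVec, finsupp_prod_add_single (by simp) a K
    (r := ((√(a K + 1 : ℝ) : ℂ)⁻¹ * (√(cConst D K.1) : ℂ)⁻¹) • dPhi (t K.1 K.2)), smul_mul_assoc]
  · rfl
  · have : (√(((a K + 1).factorial : ℕ) : ℝ)) = √(a K + 1 : ℝ) * √((a K).factorial : ℝ) := by
      rw [← Real.sqrt_mul (by positivity), Nat.factorial_succ]
      push_cast
      rfl
    rw [this, pow_succ']
    simp only [Complex.ofReal_mul, mul_inv, smul_mul_assoc, mul_smul_comm,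
      smul_smul]
    congr 1
    ring

/-- The coefficient of the creation operator `α⁺_N` in `c_M^{-1/2} t_M · ∂^l Y(z, φ)`. -/
def creMat (z : Pt D) (M N : Mode D) : ℂ :=
  (√(cConst D M.1) : ℂ)⁻¹ * tensorDeriv (t M.1 M.2 : Tensor D M.1) (createCoeff t N) z

/-- The coefficient of the annihilation operator `α_N` in `c_M^{-1/2} t_M · ∂^l Y(z, φ)`. -/
def annMat (z : Pt D) (M N : Mode D) : ℂ :=
  (√(cConst D M.1) : ℂ)⁻¹ * tensorDeriv (t M.1 M.2 : Tensor D M.1) (annihCoeff t N) z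

/-- The matrix elements of the vertex operators, up to the normalization of the vectors `v_a`, are
those of normal ordered products. -/
lemma vertexOp_fieldBasis (z : Pt D) (a : Occ D) : ∀ d b : Occ D,
    vertexOp t z (fieldBasis t a) (fieldBasis t b) d =
      (√(occFact d) / (√(occFact a) * √(occFact b)) : ℝ) *
        wickKernel (creMat t z) (annMat t z) d a b := by
  have hpos : ∀ a : Occ D, (√(occFact a) : ℂ) ≠ 0 := fun a => by
    exact_mod_cast (Real.sqrt_pos.2 (occFact_pos a)).ne'
  induction a using occ_induction with
  | zero =>
    intro d b
    have h1 : vertexOp t z (fieldBasis t 0) = toFormal t := by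
      rw [fieldBasis_zero]
      simpa [normalProd] using vertexOp_prod t z 0
    classical
    rw [h1, wickKernel_zero, occFact_zero]
    by_cases h : d = b
    · subst h
      simp [toFormal, hpos d]
    · simp [toFormal, h]
  | add a K ih =>
    intro d b
    have hc : ∀ {e : Occ D} {M : Mode D}, M ∈ e.support →
        √(occFact e) = √(e M : ℝ) * √(occFact (e - Finsupp.single M 1)) := by
      intro e M h
      rw [occFact_of_mem h, Real.sqrt_mul (by positivity)]
    have ha : √(occFact (a + Finsupp.single K 1)) = √(a K + 1 : ℝ) * √(occFact a) := by
      rw [occFact_add_single, Real.sqrt_mul (by positivity)]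
    rw [fieldBasis_add_single, map_smul, vertexOp_dPhi_mul, wickKernel_add_single, ha]
    simp only [normalMul, LinearMap.smul_apply, Pi.smul_apply, LinearMap.add_apply, Pi.add_apply,
      LinearMap.comp_apply, createSeries_apply, annihSeries_basis, map_sum, map_smul,
      Finset.sum_apply, ih, smul_eq_mul, mul_add, creOp, annOp, mul_sum]
    have hK : (√(a K + 1 : ℝ) : ℂ) ≠ 0 := by
      exact_mod_cast (Real.sqrt_pos.2 (by positivity)).ne'
    have hC : (√(cConst D K.1) : ℂ) ≠ 0 := by
      exact_mod_cast (Real.sqrt_pos.2 (cConst_pos Fact.out K.1)).ne'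
    congr 1
    · refine sum_congr rfl fun M hM => ?_
      have := hpos (d - Finsupp.single M 1)
      have := hpos a
      have := hpos b
      rw [hc hM, creMat]
      push_cast
      generalize tensorDeriv _ _ _ = T
      generalize wickKernel (creMat t z) (annMat t z) _ _ _ = B
      field_simp
    · refine sum_congr rfl fun M hM => ?_
      have := hpos (b - Finsupp.single M 1)
      have := hpos a
      have := hpos d
      have hM' : (√(b M : ℝ) : ℂ) ≠ 0 := by
        have : 0 < b M := Nat.pos_of_ne_zero (Finsupp.mem_support_iff.1 hM)
        exact_mod_cast (Real.sqrt_pos.2 (by exact_mod_cast this : (0 : ℝ) < b M)).ne'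
      have hsq : (b M : ℂ) = (√(b M : ℝ) : ℂ) * (√(b M : ℝ) : ℂ) := by
        rw [← Complex.ofReal_mul, Real.mul_self_sqrt (by positivity)]
        simp
      have hcb := hc hM
      simp only [hcb, annMat, hsq]
      push_cast
      generalize tensorDeriv _ _ _ = T
      generalize wickKernel (creMat t z) (annMat t z) _ _ _ = B
      generalize (√(b M : ℝ) : ℂ) = m at *
      field_simp

/-- Associativity of the vertex operators, given the expansions of the coefficients of the field
about one point in terms of another. -/
lemma vertexOp_assoc {x y : Pt D}
    (h : ∀ K N, HasSum (fun M => annMat t x K M * creMat t y N M) (annMat t (x - y) K N))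
    (hf : ∀ K N, HasSum (fun M => creMat t (x - y) K M * creMat t y M N) (creMat t x K N))
    (hg : ∀ K N, HasSum (fun M => creMat t (x - y) K M * annMat t y M N) (annMat t x K N))
    (u v w : FieldSpace D) (d : Occ D) :
    ∃ S : ℂ, HasSum (fun e => vertexOp t x u (fieldVec t e) d * vertexOp t y v w e) S ∧
      HasSum (fun e => vertexOp t (x - y) u v e * vertexOp t y (fieldVec t e) w d) S := by
  have hpos : ∀ a : Occ D, (√(occFact a) : ℂ) ≠ 0 := fun a => by
    exact_mod_cast (Real.sqrt_pos.2 (occFact_pos a)).ne'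
  simp only [← fieldBasis_apply]
  -- Both series are linear in `u`, `v` and `w`, so these may be taken from the basis.
  have key : ∀ p : FieldSpace D → Prop, p 0 → (∀ v w, p v → p w → p (v + w)) →
      (∀ (c : ℂ) v, p v → p (c • v)) → (∀ a, p (fieldBasis t a)) → ∀ v, p v := by
    intro p h0 hadd hsmul hb v
    refine Submodule.span_induction (p := fun v _ => p v) ?_ h0 (fun v w _ _ => hadd v w)
      (fun c v _ => hsmul c v) ((fieldBasis t).mem_span v)
    rintro _ ⟨a, rfl⟩
    exact hb a
  revert u
  refine key _ ⟨0, by simp [hasSum_zero], by simp [hasSum_zero]⟩ ?_ ?_ fun p => ?_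
  · rintro u u' ⟨S, h1, h2⟩ ⟨S', h1', h2'⟩
    exact ⟨S + S', by simpa [add_mul] using h1.add h1', by simpa [add_mul] using h2.add h2'⟩
  · rintro c u ⟨S, h1, h2⟩
    exact ⟨c * S, hasSum_of_eq (fun e => by
      simp only [map_smul, LinearMap.smul_apply, Pi.smul_apply, smul_eq_mul]; ring) (h1.mul_left c),
      hasSum_of_eq (fun e => by
      simp only [map_smul, LinearMap.smul_apply, Pi.smul_apply, smul_eq_mul]; ring) (h2.mul_left c)⟩
  revert v
  refine key _ ⟨0, by simp [hasSum_zero], by simp [hasSum_zero]⟩ ?_ ?_ fun a => ?_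
  · rintro u u' ⟨S, h1, h2⟩ ⟨S', h1', h2'⟩
    exact ⟨S + S', by simpa [mul_add] using h1.add h1', by simpa [add_mul] using h2.add h2'⟩
  · rintro c u ⟨S, h1, h2⟩
    exact ⟨c * S, hasSum_of_eq (fun e => by
      simp only [map_smul, LinearMap.smul_apply, Pi.smul_apply, smul_eq_mul]; ring) (h1.mul_left c),
      hasSum_of_eq (fun e => by
      simp only [map_smul, Pi.smul_apply, smul_eq_mul]; ring) (h2.mul_left c)⟩
  revert w
  refine key _ ⟨0, by simp [hasSum_zero], by simp [hasSum_zero]⟩ ?_ ?_ fun b => ?_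
  · rintro u u' ⟨S, h1, h2⟩ ⟨S', h1', h2'⟩
    exact ⟨S + S', by simpa [mul_add] using h1.add h1', by simpa [mul_add] using h2.add h2'⟩
  · rintro c u ⟨S, h1, h2⟩
    exact ⟨c * S, hasSum_of_eq (fun e => by
      simp only [map_smul, Pi.smul_apply, smul_eq_mul]; ring) (h1.mul_left c),
      hasSum_of_eq (fun e => by
      simp only [map_smul, Pi.smul_apply, smul_eq_mul]; ring) (h2.mul_left c)⟩
  obtain ⟨W, hW⟩ := wickKernel_assoc h hf hg p
  have e1 := (hW d a b).1.mul_left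
    ((√(occFact d) / (√(occFact p) * √(occFact a) * √(occFact b)) : ℝ) : ℂ)
  have e2 := (hW d a b).2.mul_left
    ((√(occFact d) / (√(occFact p) * √(occFact a) * √(occFact b)) : ℝ) : ℂ)
  refine ⟨_, hasSum_of_eq (fun e => ?_) e1, hasSum_of_eq (fun e => ?_) e2⟩
  all_goals
    rw [vertexOp_fieldBasis, vertexOp_fieldBasis]
    have := hpos e
    have := hpos p
    have := hpos a
    have := hpos b
    push_cast
    field_simp

end Link

/-! ### Iterated partial derivatives -/

section PartialDerivatives

variable {D : ℕ}

/-- The partial derivative `∂_k f`. -/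
def pderiv (k : Fin D) (f : Pt D → ℂ) (x : Pt D) : ℂ :=
  fderiv ℝ f x (EuclideanSpace.single k 1)

/-- The iterated partial derivative along a list of indices, the head being the outermost. -/
def pderivs (L : List (Fin D)) (f : Pt D → ℂ) : Pt D → ℂ := L.foldr pderiv f

@[simp] lemma pderivs_nil (f : Pt D → ℂ) : pderivs [] f = f := rfl

lemma pderivs_cons (k : Fin D) (L : List (Fin D)) (f : Pt D → ℂ) :
    pderivs (k :: L) f = pderiv k (pderivs L f) := rfl

lemma pderivs_append (L L' : List (Fin D)) (f : Pt D → ℂ) :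
    pderivs (L ++ L') f = pderivs L (pderivs L' f) := List.foldr_append

/-- `∑_μ T_μ ∂_{μ_1} ⋯ ∂_{μ_l} f`, in terms of iterated partial derivatives. -/
def tderiv {l : ℕ} (T : (Fin l → Fin D) → ℂ) (f : Pt D → ℂ) (x : Pt D) : ℂ :=
  ∑ μ : Fin l → Fin D, T μ * pderivs (List.ofFn μ) f x

/-- The component `T_{k ⋯}` of a tensor, a tensor of lower rank. -/
def slice {l : ℕ} {R : Type*} (T : (Fin (l + 1) → Fin D) → R) (k : Fin D) : (Fin l → Fin D) → R :=
  fun μ => T (Fin.cons k μ)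

lemma sum_cons {l : ℕ} {R : Type*} [AddCommMonoid R] (F : (Fin (l + 1) → Fin D) → R) :
    ∑ μ, F μ = ∑ k, ∑ ν : Fin l → Fin D, F (Fin.cons k ν) := by
  rw [← (Fin.consEquiv fun _ => Fin D).sum_comp, Fintype.sum_prod_type]
  rfl

variable {U : Set (Pt D)} {f g : Pt D → ℂ}

lemma analyticOnNhd_pderiv (hf : AnalyticOnNhd ℝ f U) (k : Fin D) :
    AnalyticOnNhd ℝ (pderiv k f) U := fun x hx =>
  ((ContinuousLinearMap.apply ℝ ℂ (EuclideanSpace.single k (1 : ℝ))).analyticAt _).comp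
    (hf x hx).fderiv

lemma analyticOnNhd_pderivs (hf : AnalyticOnNhd ℝ f U) (L : List (Fin D)) :
    AnalyticOnNhd ℝ (pderivs L f) U := by
  induction L with
  | nil => exact hf
  | cons k L ih => exact analyticOnNhd_pderiv ih k

lemma analyticOnNhd_tderiv (hf : AnalyticOnNhd ℝ f U) {l : ℕ} (T : (Fin l → Fin D) → ℂ) :
    AnalyticOnNhd ℝ (tderiv T f) U := fun x hx =>
  Finset.analyticAt_fun_sum _ fun _ _ => analyticAt_const.mul (analyticOnNhd_pderivs hf _ x hx)

lemma pderiv_congr (hU : IsOpen U) (h : Set.EqOn f g U) (k : Fin D) :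
    Set.EqOn (pderiv k f) (pderiv k g) U := fun x hx => by
  rw [pderiv, (h.eventuallyEq_of_mem (hU.mem_nhds hx)).fderiv_eq, pderiv]

lemma pderivs_congr (hU : IsOpen U) (h : Set.EqOn f g U) (L : List (Fin D)) :
    Set.EqOn (pderivs L f) (pderivs L g) U := by
  induction L with
  | nil => exact h
  | cons k L ih => exact pderiv_congr hU ih k

lemma tderiv_congr (hU : IsOpen U) (h : Set.EqOn f g U) {l : ℕ} (T : (Fin l → Fin D) → ℂ) :
    Set.EqOn (tderiv T f) (tderiv T g) U := fun x hx =>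
  sum_congr rfl fun μ _ => by rw [pderivs_congr hU h _ hx]

variable {x : Pt D}

lemma pderiv_const (c : ℂ) (k : Fin D) : pderiv k (fun _ => c) x = 0 := by
  simp [pderiv]

lemma pderiv_add (hf : DifferentiableAt ℝ f x) (hg : DifferentiableAt ℝ g x) (k : Fin D) :
    pderiv k (fun x => f x + g x) x = pderiv k f x + pderiv k g x := by
  simp [pderiv, fderiv_fun_add hf hg]

lemma pderiv_sum {ι : Type*} {s : Finset ι} {F : ι → Pt D → ℂ}
    (hF : ∀ i ∈ s, DifferentiableAt ℝ (F i) x) (k : Fin D) :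
    pderiv k (fun x => ∑ i ∈ s, F i x) x = ∑ i ∈ s, pderiv k (F i) x := by
  simp [pderiv, fderiv_fun_sum hF]

lemma pderiv_mul (hf : DifferentiableAt ℝ f x) (hg : DifferentiableAt ℝ g x) (k : Fin D) :
    pderiv k (fun x => f x * g x) x = pderiv k f x * g x + f x * pderiv k g x := by
  simp only [pderiv, fderiv_fun_mul hf hg, add_apply,
    smul_apply, smul_eq_mul]
  ring

lemma pderiv_const_mul (hf : DifferentiableAt ℝ f x) (c : ℂ) (k : Fin D) :
    pderiv k (fun x => c * f x) x = c * pderiv k f x := by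
  rw [pderiv_mul (differentiableAt_const c) hf, pderiv_const, zero_mul, zero_add]

lemma pderiv_star (hf : DifferentiableAt ℝ f x) (k : Fin D) :
    pderiv k (fun x => star (f x)) x = star (pderiv k f x) := by
  have h := Complex.conjCLE.toContinuousLinearMap.hasFDerivAt.comp x hf.hasFDerivAt
  have : HasFDerivAt (fun x => star (f x)) _ x := h
  rw [pderiv, this.fderiv]
  simp [pderiv]

lemma pderivs_const_mul (hU : IsOpen U) (hf : AnalyticOnNhd ℝ f U) (c : ℂ) (L : List (Fin D)) :
    Set.EqOn (pderivs L fun x => c * f x) (fun x => c * pderivs L f x) U := by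
  induction L with
  | nil => exact fun _ _ => rfl
  | cons k L ih =>
    intro x hx
    rw [pderivs_cons, pderiv_congr hU ih k hx,
      pderiv_const_mul (analyticOnNhd_pderivs hf L x hx).differentiableAt, pderivs_cons]

lemma pderivs_sum {ι : Type*} {s : Finset ι} {F : ι → Pt D → ℂ} (hU : IsOpen U)
    (hF : ∀ i ∈ s, AnalyticOnNhd ℝ (F i) U) (L : List (Fin D)) :
    Set.EqOn (pderivs L fun x => ∑ i ∈ s, F i x) (fun x => ∑ i ∈ s, pderivs L (F i) x) U := by
  induction L with
  | nil => exact fun _ _ => rfl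
  | cons k L ih =>
    intro x hx
    rw [pderivs_cons, pderiv_congr hU ih k hx,
      pderiv_sum fun i hi => (analyticOnNhd_pderivs (hF i hi) L x hx).differentiableAt]
    rfl

lemma pderiv_comm (hf : AnalyticAt ℝ f x) (i j : Fin D) :
    pderiv i (pderiv j f) x = pderiv j (pderiv i f) x := by
  have h : ∀ i j : Fin D, pderiv i (pderiv j f) x =
      fderiv ℝ (fderiv ℝ f) x (EuclideanSpace.single i 1) (EuclideanSpace.single j 1) := by
    intro i j
    have h1 : HasFDerivAt (pderiv j f) _ x :=
      (ContinuousLinearMap.apply ℝ ℂ (EuclideanSpace.single j (1 : ℝ))).hasFDerivAt.comp x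
        hf.fderiv.differentiableAt.hasFDerivAt
    rw [pderiv, h1.fderiv]
    rfl
  rw [h, h]
  exact (hf.contDiffAt (n := 2)).isSymmSndFDerivAt (by simp) _ _

lemma pderivs_perm (hU : IsOpen U) (hf : AnalyticOnNhd ℝ f U) {L L' : List (Fin D)}
    (h : L.Perm L') : Set.EqOn (pderivs L f) (pderivs L' f) U := by
  induction h with
  | nil => exact fun _ _ => rfl
  | cons k _ ih => exact pderiv_congr hU ih k
  | swap i j L => exact fun x hx => pderiv_comm (analyticOnNhd_pderivs hf L x hx) j i
  | trans _ _ ih1 ih2 => exact ih1.trans ih2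

lemma pderivs_comm (hU : IsOpen U) (hf : AnalyticOnNhd ℝ f U) (L L' : List (Fin D)) :
    Set.EqOn (pderivs L (pderivs L' f)) (pderivs L' (pderivs L f)) U := by
  rw [← pderivs_append, ← pderivs_append]
  exact pderivs_perm hU hf List.perm_append_comm

lemma tderiv_const_mul (hU : IsOpen U) (hf : AnalyticOnNhd ℝ f U) (c : ℂ) {l : ℕ}
    (T : (Fin l → Fin D) → ℂ) :
    Set.EqOn (tderiv T fun x => c * f x) (fun x => c * tderiv T f x) U := fun x hx => by
  simp only [tderiv, mul_sum]
  refine sum_congr rfl fun μ _ => ?_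
  rw [pderivs_const_mul hU hf c _ hx]
  ring

lemma tderiv_comm (hU : IsOpen U) (hf : AnalyticOnNhd ℝ f U) {l l' : ℕ}
    (T : (Fin l → Fin D) → ℂ) (T' : (Fin l' → Fin D) → ℂ) :
    Set.EqOn (tderiv T (tderiv T' f)) (tderiv T' (tderiv T f)) U := by
  have h : ∀ {l l' : ℕ} (T : (Fin l → Fin D) → ℂ) (T' : (Fin l' → Fin D) → ℂ), ∀ x ∈ U,
      tderiv T (tderiv T' f) x = ∑ μ, ∑ ν, T μ * T' ν *
        pderivs (List.ofFn μ) (pderivs (List.ofFn ν) f) x := by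
    intro l l' T T' x hx
    refine sum_congr rfl fun μ _ => ?_
    have h1 := pderivs_sum (s := univ) (F := fun ν x => T' ν * pderivs (List.ofFn ν) f x) hU
      (fun ν _ x hx => analyticAt_const.mul (analyticOnNhd_pderivs hf _ x hx)) (List.ofFn μ) hx
    have h2 : ∀ ν : Fin l' → Fin D, _ := fun ν =>
      pderivs_const_mul hU (analyticOnNhd_pderivs hf (List.ofFn ν)) (T' ν) (List.ofFn μ) hx
    change T μ * pderivs (List.ofFn μ) (fun x => ∑ ν, T' ν * pderivs (List.ofFn ν) f x) x = _
    rw [h1, mul_sum]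
    refine sum_congr rfl fun ν _ => ?_
    rw [h2, mul_assoc]
  intro x hx
  rw [h T T' x hx, h T' T x hx, sum_comm]
  refine sum_congr rfl fun ν _ => sum_congr rfl fun μ _ => ?_
  rw [pderivs_comm hU hf _ _ hx]
  ring

/-- The first index of the tensor may be taken to belong to the outermost derivative. -/
lemma tderiv_succ (hf : AnalyticOnNhd ℝ f U) {l : ℕ} (T : (Fin (l + 1) → Fin D) → ℂ)
    (hx : x ∈ U) : tderiv T f x = ∑ k, pderiv k (tderiv (slice T k) f) x := by
  rw [tderiv, sum_cons]
  refine sum_congr rfl fun k _ => ?_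
  have h : ∀ ν : Fin l → Fin D, DifferentiableAt ℝ (pderivs (List.ofFn ν) f) x := fun ν =>
    (analyticOnNhd_pderivs hf _ x hx).differentiableAt
  have : tderiv (slice T k) f = fun x => ∑ ν, slice T k ν * pderivs (List.ofFn ν) f x := rfl
  rw [this, pderiv_sum (F := fun ν x => slice T k ν * pderivs (List.ofFn ν) f x)
    fun ν _ => (differentiableAt_const _).mul (h ν)]
  refine sum_congr rfl fun ν _ => ?_
  rw [pderiv_const_mul (h ν), List.ofFn_cons, pderivs_cons]
  rfl

lemma iteratedFDeriv_eq_pderivs (hU : IsOpen U) (hf : AnalyticOnNhd ℝ f U) (l : ℕ) :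
    ∀ (μ : Fin l → Fin D), ∀ x ∈ U, iteratedFDeriv ℝ l f x
      (fun i => EuclideanSpace.single (μ i) 1) = pderivs (List.ofFn μ) f x := by
  induction l with
  | zero => intro μ x _; simp
  | succ l ih =>
    intro μ x hx
    have hd : DifferentiableAt ℝ (iteratedFDeriv ℝ l f) x :=
      ((hf.iteratedFDeriv l) x hx).differentiableAt
    have h1 : (fun y => iteratedFDeriv ℝ l f y (fun i => EuclideanSpace.single (μ i.succ) 1))
        =ᶠ[nhds x] pderivs (List.ofFn fun i => μ i.succ) f :=
      Filter.eventually_of_mem (hU.mem_nhds hx) fun y hy => ih _ y hy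
    have h2 : HasFDerivAt (fun y => iteratedFDeriv ℝ l f y
        (fun i => EuclideanSpace.single (μ i.succ) (1 : ℝ))) _ x :=
      (ContinuousMultilinearMap.apply ℝ (fun _ : Fin l => Pt D) ℂ
        (fun i => EuclideanSpace.single (μ i.succ) (1 : ℝ))).hasFDerivAt.comp x hd.hasFDerivAt
    rw [List.ofFn_succ, pderivs_cons, pderiv, ← h1.fderiv_eq, h2.fderiv,
      iteratedFDeriv_succ_apply_left]
    rfl

lemma tensorDeriv_eq_tderiv (hU : IsOpen U) (hf : AnalyticOnNhd ℝ f U) {l : ℕ}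
    (T : Tensor D l) (hx : x ∈ U) : tensorDeriv T f x = tderiv (fun μ => T μ) f x :=
  sum_congr rfl fun μ _ => by rw [iteratedFDeriv_eq_pderivs hU hf l μ x hx]

lemma tensorDeriv_congr (hU : IsOpen U) (h : Set.EqOn f g U) {l : ℕ} (T : Tensor D l)
    (hx : x ∈ U) : tensorDeriv T f x = tensorDeriv T g x := by
  have := (h.eventuallyEq_of_mem (hU.mem_nhds hx)).iteratedFDeriv ℝ l
  simp only [tensorDeriv, this.eq_of_nhds]

end PartialDerivatives

/-! ### Harmonic polynomials of symmetric trace-free tensors -/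

section Tensors

variable {D : ℕ}

/-- Totally symmetric, trace-free arrays of components. These are the elements of `traceFree D l` as
plain functions, without the hermitian structure. -/
structure SymTraceFree {l : ℕ} (T : (Fin l → Fin D) → ℂ) : Prop where
  symm : ∀ (σ : Equiv.Perm (Fin l)) (μ : Fin l → Fin D), T (μ ∘ σ) = T μ
  trace : ∀ i j : Fin l, i ≠ j → ∀ μ : Fin l → Fin D,
      ∑ k : Fin D, T (Function.update (Function.update μ i k) j k) = 0

lemma symTraceFree_coe {l : ℕ} (T : traceFree D l) : SymTraceFree fun μ => (T : Tensor D l) μ :=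
  ⟨T.2.1, T.2.2⟩

lemma SymTraceFree.star {l : ℕ} {T : (Fin l → Fin D) → ℂ} (hT : SymTraceFree T) :
    SymTraceFree fun μ => star (T μ) :=
  ⟨fun σ μ => by rw [hT.symm], fun i j hij μ => by rw [← star_sum, hT.trace i j hij, star_zero]⟩

lemma SymTraceFree.slice {l : ℕ} {T : (Fin (l + 1) → Fin D) → ℂ} (hT : SymTraceFree T)
    (k : Fin D) : SymTraceFree (slice T k) := by
  refine ⟨fun σ μ => ?_, fun i j hij μ => ?_⟩
  · rw [FreeField.slice, FreeField.slice,
      ← hT.symm (Equiv.Perm.decomposeFin.symm (0, σ)) (Fin.cons k μ)]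
    congr 1
    ext i
    refine Fin.cases ?_ (fun i => ?_) i <;> simp
  · simp only [FreeField.slice, Fin.cons_update]
    exact hT.trace i.succ j.succ (by simpa using hij) _

lemma SymTraceFree.sum_slice_slice {l : ℕ} {T : (Fin (l + 2) → Fin D) → ℂ} (hT : SymTraceFree T)
    (μ : Fin l → Fin D) : ∑ k, FreeField.slice (FreeField.slice T k) k μ = 0 := by
  rcases isEmpty_or_nonempty (Fin D) with h | ⟨⟨k₀⟩⟩
  · simp
  · rw [← hT.trace 0 1 (by simp) (Fin.cons k₀ (Fin.cons k₀ μ))]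
    refine sum_congr rfl fun k _ => ?_
    rw [Fin.update_cons_zero, ← Fin.succ_zero_eq_one, ← Fin.cons_update, Fin.update_cons_zero]
    rfl

/-- By symmetry, two slices may be taken in either order. -/
lemma SymTraceFree.slice_comm {l : ℕ} {T : (Fin (l + 2) → Fin D) → ℂ} (hT : SymTraceFree T)
    (i j : Fin D) :
    FreeField.slice (FreeField.slice T i) j = FreeField.slice (FreeField.slice T j) i := by
  ext μ
  simp only [FreeField.slice]
  rw [← hT.symm (Equiv.swap 0 1)]
  congr 1
  ext n
  refine Fin.cases ?_ (fun n => Fin.cases ?_ (fun n => ?_) n) n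
  · simp
  · simp
  · have : Equiv.swap (0 : Fin (l + 2)) 1 n.succ.succ = n.succ.succ :=
      Equiv.swap_apply_of_ne_of_ne (by simp) (by simp [Fin.ext_iff])
    simp [this]

/-- The polynomial `T · x^{⊗ l}`. -/
def contr {l : ℕ} (T : (Fin l → Fin D) → ℂ) (x : Pt D) : ℂ :=
  ∑ μ : Fin l → Fin D, T μ * ∏ i, (x (μ i) : ℂ)

lemma star_contr {l : ℕ} (T : (Fin l → Fin D) → ℂ) (x : Pt D) :
    star (contr T x) = contr (fun μ => star (T μ)) x := by
  simp [contr]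

lemma contr_zero (T : (Fin 0 → Fin D) → ℂ) (x : Pt D) : contr T x = T Fin.elim0 := by
  simp [contr, Subsingleton.elim default (Fin.elim0 : Fin 0 → Fin D)]

lemma contr_succ {l : ℕ} (T : (Fin (l + 1) → Fin D) → ℂ) (x : Pt D) :
    contr T x = ∑ k, (x k : ℂ) * contr (slice T k) x := by
  rw [contr, sum_cons]
  refine sum_congr rfl fun k _ => ?_
  rw [contr, mul_sum]
  refine sum_congr rfl fun ν _ => ?_
  rw [Fin.prod_univ_succ]
  simp only [Fin.cons_zero, Fin.cons_succ, slice]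
  ring

lemma contr_smul {l : ℕ} (T : (Fin l → Fin D) → ℂ) (r : ℝ) (x : Pt D) :
    contr T (r • x) = (r : ℂ) ^ l * contr T x := by
  simp only [contr, mul_sum, PiLp.smul_apply, smul_eq_mul, Complex.ofReal_mul, prod_mul_distrib,
    prod_const, card_univ, Fintype.card_fin]
  exact sum_congr rfl fun _ _ => by ring

lemma analyticAt_coord (k : Fin D) (x : Pt D) : AnalyticAt ℝ (fun x : Pt D => (x k : ℂ)) x :=
  (Complex.ofRealCLM.comp (EuclideanSpace.proj k)).analyticAt x

lemma analyticOnNhd_contr {l : ℕ} (T : (Fin l → Fin D) → ℂ) (U : Set (Pt D)) :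
    AnalyticOnNhd ℝ (contr T) U := fun x _ =>
  Finset.analyticAt_fun_sum _ fun _ _ => analyticAt_const.mul
    (Finset.analyticAt_fun_prod _ fun _ _ => analyticAt_coord _ x)

lemma pderiv_coord (j k : Fin D) (x : Pt D) :
    pderiv k (fun x : Pt D => (x j : ℂ)) x = if j = k then 1 else 0 := by
  have : HasFDerivAt (fun x : Pt D => (x j : ℂ)) _ x :=
    (Complex.ofRealCLM.comp (EuclideanSpace.proj j : Pt D →L[ℝ] ℝ)).hasFDerivAt
  rw [pderiv, this.fderiv]
  by_cases h : j = k <;> simp [h]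

lemma pderiv_contr_zero (T : (Fin 0 → Fin D) → ℂ) (k : Fin D) (x : Pt D) :
    pderiv k (contr T) x = 0 := by
  rw [show contr T = fun _ => T Fin.elim0 from funext (contr_zero T), pderiv_const]

lemma pderiv_contr {l : ℕ} : ∀ {T : (Fin (l + 1) → Fin D) → ℂ}, SymTraceFree T → ∀ (k : Fin D)
    (x : Pt D), pderiv k (contr T) x = (l + 1) * contr (slice T k) x := by
  induction l with
  | zero =>
    intro T _ k x
    have h : contr T = fun x => ∑ j, (x j : ℂ) * contr (slice T j) x := funext (contr_succ T)
    rw [h, pderiv_sum (F := fun j x => (x j : ℂ) * contr (slice T j) x) fun j _ =>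
      ((analyticAt_coord j x).mul
      (analyticOnNhd_contr _ Set.univ x trivial)).differentiableAt]
    simp only [pderiv_mul (analyticAt_coord _ x).differentiableAt
      (analyticOnNhd_contr _ Set.univ x trivial).differentiableAt, pderiv_coord, pderiv_contr_zero]
    simp
  | succ l ih =>
    intro T hT k x
    have h : contr T = fun x => ∑ j, (x j : ℂ) * contr (slice T j) x := funext (contr_succ T)
    rw [h, pderiv_sum (F := fun j x => (x j : ℂ) * contr (slice T j) x) fun j _ =>
      ((analyticAt_coord j x).mul
      (analyticOnNhd_contr _ Set.univ x trivial)).differentiableAt]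
    simp only [pderiv_mul (analyticAt_coord _ x).differentiableAt
      (analyticOnNhd_contr _ Set.univ x trivial).differentiableAt, pderiv_coord, ih (hT.slice _),
      sum_add_distrib, ite_mul, one_mul, zero_mul, sum_ite_eq', mem_univ, if_true]
    rw [contr_succ (slice T k)]
    simp only [hT.slice_comm k, mul_left_comm _ ((l : ℂ) + 1), ← mul_sum]
    push_cast
    ring

/-- The divergence of the vector field with components `T_{k ⋯} · x^{⊗ l}` is a
multiple of a trace of `T`. -/
lemma sum_pderiv_contr_slice {l : ℕ} {T : (Fin (l + 1) → Fin D) → ℂ} (hT : SymTraceFree T)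
    (x : Pt D) : ∑ k, pderiv k (contr (slice T k)) x = 0 := by
  cases l with
  | zero => simp [pderiv_contr_zero]
  | succ l =>
    simp only [pderiv_contr (hT.slice _), ← mul_sum]
    simp only [contr]
    rw [sum_comm]
    simp only [← sum_mul, hT.sum_slice_slice, zero_mul, sum_const_zero, mul_zero]

/-- Polynomials `T · x^{⊗ l}` with trace-free `T` are harmonic. -/
lemma laplacian_contr {l : ℕ} {T : (Fin l → Fin D) → ℂ} (hT : SymTraceFree T) (x : Pt D) :
    ∑ k, pderiv k (pderiv k (contr T)) x = 0 := by
  cases l with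
  | zero =>
    have : ∀ k, pderiv k (contr T) = fun _ => 0 := fun k => funext (pderiv_contr_zero T k)
    simp [this, pderiv_const]
  | succ l =>
    have : ∀ k, pderiv k (contr T) = fun x => ((l : ℂ) + 1) * contr (slice T k) x :=
      fun k => funext (pderiv_contr hT k)
    simp only [this]
    rw [← mul_zero ((l : ℂ) + 1), ← sum_pderiv_contr_slice hT x, mul_sum]
    exact sum_congr rfl fun k _ =>
      pderiv_const_mul (analyticOnNhd_contr _ Set.univ x trivial).differentiableAt _ _

end Tensors

/-! ### Gaussian integrals of harmonic polynomials -/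

section Gaussian

variable {D : ℕ}

/-- The Gaussian weight `exp(-|x|²/2)`. -/
def gaussWeight (x : Pt D) : ℝ := Real.exp (-(1 / 2) * ‖x‖ ^ 2)

lemma gaussWeight_pos (x : Pt D) : 0 < gaussWeight x := Real.exp_pos _

lemma hasFDerivAt_gaussWeight (x : Pt D) : HasFDerivAt (fun x : Pt D => (gaussWeight x : ℂ))
    (Complex.ofRealCLM.comp (gaussWeight x • (-(1 / 2 : ℝ)) • (2 • innerSL ℝ x))) x := by
  have h : HasFDerivAt (fun x : Pt D => ‖x‖ ^ 2) (2 • innerSL ℝ x) x := by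
    simpa using (hasFDerivAt_id x).norm_sq
  exact Complex.ofRealCLM.hasFDerivAt.comp x ((h.const_mul (-(1 / 2))).exp)

lemma inner_single (x : Pt D) (k : Fin D) :
    inner ℝ x (EuclideanSpace.single k (1 : ℝ)) = x k := by
  simp [EuclideanSpace.inner_single_right]

lemma pderiv_gaussWeight (k : Fin D) (x : Pt D) :
    pderiv k (fun x : Pt D => (gaussWeight x : ℂ)) x = -(x k : ℂ) * gaussWeight x := by
  rw [pderiv, (hasFDerivAt_gaussWeight x).fderiv]
  simp [inner_single]
  ring

lemma norm_contr_le {l : ℕ} (T : (Fin l → Fin D) → ℂ) (x : Pt D) :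
    ‖contr T x‖ ≤ (∑ μ, ‖T μ‖) * ‖x‖ ^ l := by
  rw [contr, sum_mul]
  refine (norm_sum_le _ _).trans (sum_le_sum fun μ _ => ?_)
  rw [norm_mul, norm_prod]
  refine mul_le_mul_of_nonneg_left ?_ (norm_nonneg _)
  refine (prod_le_prod (fun _ _ => norm_nonneg _) (g := fun _ => ‖x‖) fun i _ => ?_).trans (by simp)
  rw [Complex.norm_real]
  exact PiLp.norm_apply_le x (μ i)

lemma continuous_contr {l : ℕ} (T : (Fin l → Fin D) → ℂ) : Continuous (contr T) :=
  continuous_iff_continuousAt.2 fun x =>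
    (analyticOnNhd_contr T Set.univ x trivial).continuousAt

lemma continuous_gaussWeight : Continuous (gaussWeight (D := D)) := by
  unfold gaussWeight
  fun_prop

/-- A form of the derivative that does not depend on whether the rank vanishes, which is all that
integrability needs. -/
lemma exists_pderiv_contr {l : ℕ} {T : (Fin l → Fin D) → ℂ} (hT : SymTraceFree T) (k : Fin D) :
    ∃ (c : ℂ) (m : ℕ) (S : (Fin m → Fin D) → ℂ), ∀ x, pderiv k (contr T) x = c * contr S x := by
  cases l with
  | zero => exact ⟨0, 0, T, fun x => by rw [pderiv_contr_zero, zero_mul]⟩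
  | succ l => exact ⟨_, _, _, pderiv_contr hT k⟩

variable [hD : Fact (2 < D)]

instance : Nontrivial (Pt D) := by
  have : Nonempty (Fin D) := ⟨⟨0, by have := hD.out; omega⟩⟩
  infer_instance

lemma integrable_norm_pow_mul_gaussWeight (n : ℕ) :
    Integrable fun x : Pt D => ‖x‖ ^ n * gaussWeight x := by
  refine (integrable_fun_norm_addHaar volume (E := Pt D)
    (f := fun r => r ^ n * Real.exp (-(1 / 2) * r ^ 2))).2 ?_
  have h := (integrable_rpow_mul_exp_neg_mul_sq (b := 1 / 2) (by norm_num)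
    (s := ((finrank ℝ (Pt D) - 1 + n : ℕ) : ℝ)) (by
      have : (0 : ℝ) ≤ ((finrank ℝ (Pt D) - 1 + n : ℕ) : ℝ) := Nat.cast_nonneg _
      linarith)).integrableOn (s := Set.Ioi 0)
  refine h.congr (ae_of_all _ fun r => ?_)
  simp only [Real.rpow_natCast, smul_eq_mul, pow_add]
  ring

lemma integrable_contr_mul_contr {l m : ℕ} (A : (Fin l → Fin D) → ℂ) (B : (Fin m → Fin D) → ℂ) :
    Integrable fun x : Pt D => contr A x * contr B x * (gaussWeight x : ℂ) := by
  refine ((integrable_norm_pow_mul_gaussWeight (l + m)).const_mul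
    ((∑ μ, ‖A μ‖) * (∑ μ, ‖B μ‖))).mono' ?_ (ae_of_all _ fun x => ?_)
  · exact (((continuous_contr A).mul (continuous_contr B)).mul
      (Complex.continuous_ofReal.comp continuous_gaussWeight)).aestronglyMeasurable
  · rw [norm_mul, norm_mul, Complex.norm_real, Real.norm_of_nonneg (gaussWeight_pos x).le, pow_add]
    calc ‖contr A x‖ * ‖contr B x‖ * gaussWeight x
        ≤ ((∑ μ, ‖A μ‖) * ‖x‖ ^ l) * ((∑ μ, ‖B μ‖) * ‖x‖ ^ m) * gaussWeight x := by
          gcongr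
          · exact (gaussWeight_pos x).le
          · exact norm_contr_le A x
          · exact norm_contr_le B x
      _ = _ := by ring

/-- Integration by parts with respect to the Gaussian measure. -/
lemma integral_coord_mul_gaussWeight {l m : ℕ} {A : (Fin l → Fin D) → ℂ}
    {B : (Fin m → Fin D) → ℂ} (hA : SymTraceFree A) (hB : SymTraceFree B) (k : Fin D) :
    ∫ x : Pt D, (x k : ℂ) * (contr A x * contr B x * (gaussWeight x : ℂ)) =
      (∫ x : Pt D, pderiv k (contr A) x * contr B x * (gaussWeight x : ℂ)) +
        ∫ x : Pt D, contr A x * pderiv k (contr B) x * (gaussWeight x : ℂ) := by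
  have hdA : ∀ x, DifferentiableAt ℝ (contr A) x := fun x =>
    (analyticOnNhd_contr A Set.univ x trivial).differentiableAt
  have hdB : ∀ x, DifferentiableAt ℝ (contr B) x := fun x =>
    (analyticOnNhd_contr B Set.univ x trivial).differentiableAt
  have i1 : Integrable fun x : Pt D => pderiv k (contr A) x * contr B x * (gaussWeight x : ℂ) := by
    obtain ⟨c, n, S, h⟩ := exists_pderiv_contr hA k
    simp only [h, mul_assoc]
    simpa only [mul_assoc] using (integrable_contr_mul_contr S B).const_mul c
  have i2 : Integrable fun x : Pt D => contr A x * pderiv k (contr B) x * (gaussWeight x : ℂ) := by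
    obtain ⟨c, n, S, h⟩ := exists_pderiv_contr hB k
    simp only [h, mul_left_comm _ c, mul_assoc c]
    exact (integrable_contr_mul_contr A S).const_mul c
  have i3 : Integrable fun x : Pt D =>
      (x k : ℂ) * (contr A x * contr B x * (gaussWeight x : ℂ)) := by
    -- The polynomial `x_k` times `A · x^{⊗ l}` is again of the form `S · x^{⊗ (l + 1)}`.
    have h : ∀ x : Pt D, (x k : ℂ) * contr A x = contr (fun μ : Fin (l + 1) → Fin D =>
        if μ 0 = k then A (Fin.tail μ) else 0) x := by
      intro x
      rw [contr_succ, sum_eq_single k]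
      · congr 1
        simp [contr, slice]
      · intro j _ hj
        simp [contr, slice, hj]
      · simp
    simp only [← mul_assoc, h]
    exact integrable_contr_mul_contr _ B
  have hmul : ∀ x, fderiv ℝ (fun x => contr A x * contr B x) x (EuclideanSpace.single k 1) =
      pderiv k (contr A) x * contr B x + contr A x * pderiv k (contr B) x := fun x =>
    pderiv_mul (hdA x) (hdB x) k
  have hg : ∀ x : Pt D, fderiv ℝ (fun x : Pt D => (gaussWeight x : ℂ)) x
      (EuclideanSpace.single k 1) = -(x k : ℂ) * gaussWeight x := fun x => pderiv_gaussWeight k x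
  have key := integral_mul_fderiv_eq_neg_fderiv_mul_of_integrable (μ := (volume : Measure (Pt D)))
    (f := fun x => contr A x * contr B x) (g := fun x : Pt D => (gaussWeight x : ℂ))
    (v := EuclideanSpace.single k (1 : ℝ)) ?_ ?_ (integrable_contr_mul_contr A B)
    (fun x _ => (hdA x).mul (hdB x)) (fun x _ => (hasFDerivAt_gaussWeight x).differentiableAt)
  · simp only [hmul, hg, add_mul] at key
    rw [integral_add i1 i2] at key
    rw [← neg_inj, ← key, ← integral_neg]
    congr 1
    ext x
    ring
  · simp only [hmul, add_mul]
    exact i1.add i2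
  · simp only [hg]
    refine i3.neg.congr (ae_of_all _ fun x => ?_)
    simp only [Pi.neg_apply]
    ring

/-- The Gaussian `L²`-norm of `T · x^{⊗ l}`, for `T` symmetric and trace-free. -/
lemma integral_contr_sq_gaussWeight {l : ℕ} : ∀ {T : (Fin l → Fin D) → ℂ}, SymTraceFree T →
    ∫ x : Pt D, contr T x * contr (fun μ => star (T μ)) x * (gaussWeight x : ℂ) =
      l.factorial * (∑ μ, T μ * star (T μ)) * ∫ x : Pt D, (gaussWeight x : ℂ) := by
  induction l with
  | zero =>
    intro T _
    simp only [contr_zero]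
    rw [integral_const_mul]
    simp [Subsingleton.elim default (Fin.elim0 : Fin 0 → Fin D)]
  | succ l ih =>
    intro T hT
    have h1 : ∀ x : Pt D, contr T x * contr (fun μ => star (T μ)) x * (gaussWeight x : ℂ) =
        ∑ k, (x k : ℂ) * (contr (slice T k) x * contr (fun μ => star (T μ)) x *
          (gaussWeight x : ℂ)) := by
      intro x
      rw [contr_succ T, sum_mul, sum_mul]
      exact sum_congr rfl fun k _ => by ring
    -- Integration by parts moves the coordinate `x_k` to a derivative: on the slice of `T` the
    -- divergence vanishes, and on the conjugate polynomial it lowers the rank.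
    have hsl : ∀ k, slice (fun μ => star (T μ)) k = fun μ => star (slice T k μ) := fun k => rfl
    have i1 : ∀ k, Integrable fun x : Pt D => pderiv k (contr (slice T k)) x *
        contr (fun μ => star (T μ)) x * (gaussWeight x : ℂ) := by
      intro k
      obtain ⟨c, n, S, h⟩ := exists_pderiv_contr (hT.slice k) k
      simp only [h, mul_assoc]
      simpa only [mul_assoc] using (integrable_contr_mul_contr S _).const_mul c
    have i3 : ∀ k, Integrable fun x : Pt D => (x k : ℂ) * (contr (slice T k) x *
        contr (fun μ => star (T μ)) x * (gaussWeight x : ℂ)) := by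
      intro k
      have h : ∀ x : Pt D, (x k : ℂ) * contr (slice T k) x = contr (fun μ : Fin (l + 1) → Fin D =>
          if μ 0 = k then slice T k (Fin.tail μ) else 0) x := by
        intro x
        rw [contr_succ, sum_eq_single k]
        · congr 1
          simp [contr, slice]
        · intro j _ hj
          simp [contr, slice, hj]
        · simp
      simp only [← mul_assoc, h]
      exact integrable_contr_mul_contr _ _
    simp only [h1]
    rw [integral_finsetSum _ fun k _ => i3 k]
    simp only [integral_coord_mul_gaussWeight (hT.slice _) hT.star, pderiv_contr hT.star, hsl]
    rw [sum_add_distrib, ← integral_finsetSum _ fun k _ => i1 k]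
    have h2 : ∀ x : Pt D, ∑ k, pderiv k (contr (slice T k)) x * contr (fun μ => star (T μ)) x *
        (gaussWeight x : ℂ) = 0 := by
      intro x
      rw [← sum_mul, ← sum_mul, sum_pderiv_contr_slice hT, zero_mul, zero_mul]
    simp only [h2, integral_zero, zero_add, mul_left_comm _ ((l : ℂ) + 1), mul_assoc ((l : ℂ) + 1)]
    simp only [integral_const_mul, ih (hT.slice _)]
    rw [sum_cons, ← mul_sum, ← sum_mul, ← mul_sum, Nat.factorial_succ]
    push_cast
    simp only [slice]
    ring

end Gaussian

/-! ### Norms of spherical harmonics -/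

section Sphere

variable {D : ℕ} [hD : Fact (2 < D)]

/-- Gaussian integrals of homogeneous functions in polar coordinates. -/
lemma integral_homogeneous_gaussWeight {h : Pt D → ℝ} {n : ℕ}
    (hh : ∀ (r : ℝ) (x : Pt D), h (r • x) = r ^ n * h x) :
    ∫ x : Pt D, h x * gaussWeight x =
      (∫ ω : Metric.sphere (0 : Pt D) 1, h ω ∂(volume : Measure (Pt D)).toSphere) *
        ((1 / 2 : ℝ) ^ (-((D + n : ℕ) : ℝ) / 2) * (1 / 2) *
          Real.Gamma (((D + n : ℕ) : ℝ) / 2)) := by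
  have hpos : 1 ≤ D := by have := hD.out; omega
  calc
    ∫ x : Pt D, h x * gaussWeight x = ∫ x : ({(0)}ᶜ : Set (Pt D)), h x.1 * gaussWeight x.1
        ∂((volume : Measure (Pt D)).comap (↑)) := by
      rw [integral_subtype_comap (measurableSet_singleton _).compl
        fun x : Pt D => h x * gaussWeight x, restrict_compl_singleton]
    _ = ∫ p, h p.1 * (p.2.1 ^ n * Real.exp (-(1 / 2) * p.2.1 ^ 2))
        ∂(volume : Measure (Pt D)).toSphere.prod (.volumeIoiPow (finrank ℝ (Pt D) - 1)) := by
      rw [← (volume : Measure (Pt D)).measurePreserving_homeomorphUnitSphereProd.integral_comp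
        (Homeomorph.measurableEmbedding _)]
      congr 1
      ext x
      have hx : ‖x.1‖ ≠ 0 := norm_ne_zero_iff.2 x.2
      have h1 : h x.1 = ‖x.1‖ ^ n * h (‖x.1‖⁻¹ • x.1) := by
        rw [← hh, smul_smul, mul_inv_cancel₀ hx, one_smul]
      rw [h1, gaussWeight]
      simp only [homeomorphUnitSphereProd_apply_fst_coe, homeomorphUnitSphereProd_apply_snd_coe]
      ring
    _ = _ := by
      rw [integral_prod_mul (fun ω : Metric.sphere (0 : Pt D) 1 => h ω)
        (fun r : Set.Ioi (0 : ℝ) => r.1 ^ n * Real.exp (-(1 / 2) * r.1 ^ 2))]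
      congr 1
      have hI := integral_rpow_mul_exp_neg_mul_rpow (p := 2) (q := ((D - 1 + n : ℕ) : ℝ))
        (b := 1 / 2) (by norm_num) (by
          have : (0 : ℝ) ≤ ((D - 1 + n : ℕ) : ℝ) := Nat.cast_nonneg _
          linarith) (by norm_num)
      have hq : ((D - 1 + n : ℕ) : ℝ) + 1 = ((D + n : ℕ) : ℝ) := by
        exact_mod_cast congrArg (Nat.cast (R := ℝ)) (by omega : D - 1 + n + 1 = D + n)
      rw [hq] at hI
      rw [← hI]
      simp only [Measure.volumeIoiPow, ENNReal.ofReal, finrank_euclideanSpace, Fintype.card_fin]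
      rw [integral_withDensity_eq_integral_smul,
        integral_subtype_comap measurableSet_Ioi fun a : ℝ =>
          Real.toNNReal (a ^ (D - 1)) • (a ^ n * Real.exp (-(1 / 2) * a ^ 2)),
        setIntegral_congr_fun measurableSet_Ioi fun x hx ↦ ?_]
      · simp only [NNReal.smul_def, Real.coe_toNNReal _ (pow_nonneg (le_of_lt hx) _), smul_eq_mul,
          Real.rpow_natCast, pow_add, Real.rpow_ofNat]
        ring
      · exact (measurable_subtype_coe.pow_const _).real_toNNReal

/-- The `L²`-norm on the unit sphere of `T · x^{⊗ l}`, for `T` symmetric and trace-free: the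
Gaussian integral of the homogeneous function `|T · x^{⊗ l}|²` is computed in polar
coordinates. -/
lemma integral_sphere_contr_sq {l : ℕ} {T : (Fin l → Fin D) → ℂ} (hT : SymTraceFree T) :
    ∫ ω : Metric.sphere (0 : Pt D) 1, ‖contr T (ω : Pt D)‖ ^ 2
      ∂(volume : Measure (Pt D)).toSphere =
      (volume : Measure (Pt D)).toSphere.real Set.univ * l.factorial * (∑ μ, ‖T μ‖ ^ 2) *
        Real.Gamma (D / 2) / (2 ^ l * Real.Gamma (l + D / 2)) := by
  have hD0 : (0 : ℝ) < D := by
    have := hD.out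
    exact_mod_cast (by omega : 0 < D)
  have h1 := integral_homogeneous_gaussWeight (h := fun x : Pt D => ‖contr T x‖ ^ 2) (n := 2 * l)
    fun r x => by
      rw [contr_smul, norm_mul, norm_pow, Complex.norm_real, Real.norm_eq_abs, mul_pow, ← pow_mul,
        mul_comm l 2, pow_mul |r|, sq_abs, ← pow_mul]
  have h2 := integral_homogeneous_gaussWeight (h := fun _ : Pt D => (1 : ℝ)) (n := 0)
    fun r x => by simp
  have h3 := integral_contr_sq_gaussWeight hT
  have h4 : ∀ z : ℂ, z * star z = ((‖z‖ ^ 2 : ℝ) : ℂ) := by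
    intro z
    rw [Complex.star_def, Complex.mul_conj, Complex.normSq_eq_norm_sq]
  simp only [← star_contr, h4, ← Complex.ofReal_mul, ← Complex.ofReal_sum] at h3
  rw [integral_complex_ofReal, integral_complex_ofReal, ← Complex.ofReal_natCast,
    ← Complex.ofReal_mul, ← Complex.ofReal_mul, Complex.ofReal_inj] at h3
  simp only [one_mul, integral_const, smul_eq_mul, mul_one, add_zero] at h2
  rw [h1, h2] at h3
  have hg1 : 0 < Real.Gamma ((D : ℝ) / 2) := Real.Gamma_pos_of_pos (by positivity)
  have hg2 : 0 < Real.Gamma ((l : ℝ) + (D : ℝ) / 2) := Real.Gamma_pos_of_pos (by positivity)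
  have e1 : (((D + 2 * l : ℕ) : ℝ)) / 2 = l + (D : ℝ) / 2 := by push_cast; ring
  have e2 : (1 / 2 : ℝ) ^ (-((D + 2 * l : ℕ) : ℝ) / 2) = 2 ^ l * (1 / 2 : ℝ) ^ (-(D : ℝ) / 2) := by
    have : -((D + 2 * l : ℕ) : ℝ) / 2 = -(D : ℝ) / 2 - (l : ℝ) := by push_cast; ring
    rw [this, Real.rpow_sub (by norm_num), Real.rpow_natCast]
    simp [div_eq_mul_inv, mul_comm]
  rw [e1, e2] at h3
  have hp : (0 : ℝ) < (1 / 2 : ℝ) ^ (-(D : ℝ) / 2) := by positivity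
  rw [eq_div_iff (by positivity)]
  refine mul_right_cancel₀ (mul_pos hp (by norm_num : (0 : ℝ) < 1 / 2)).ne' ?_
  linear_combination h3

end Sphere

/-! ### Radial functions and the Newton kernel -/

section Radial

variable {D : ℕ}

/-- The function `|x|^{2s}`, with complex values. -/
def radPow (s : ℝ) (x : Pt D) : ℂ := (((‖x‖ ^ 2) ^ s : ℝ) : ℂ)

lemma isOpen_compl_zero : IsOpen ({0}ᶜ : Set (Pt D)) := isOpen_compl_singleton

lemma norm_sq_pos {x : Pt D} (hx : x ≠ 0) : 0 < ‖x‖ ^ 2 := by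
  have := norm_pos_iff.2 hx
  positivity

lemma radPow_add (s r : ℝ) {x : Pt D} (hx : x ≠ 0) :
    radPow (s + r) x = radPow s x * radPow r x := by
  rw [radPow, Real.rpow_add (norm_sq_pos hx), Complex.ofReal_mul, radPow, radPow]

lemma radPow_one (x : Pt D) : radPow 1 x = ∑ k, (x k : ℂ) * (x k : ℂ) := by
  rw [radPow, Real.rpow_one, EuclideanSpace.real_norm_sq_eq]
  push_cast
  exact sum_congr rfl fun k _ => by ring

lemma hasFDerivAt_radPow (s : ℝ) {x : Pt D} (hx : x ≠ 0) : HasFDerivAt (radPow (D := D) s)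
    (Complex.ofRealCLM.comp ((s * (‖x‖ ^ 2) ^ (s - 1)) • (2 • innerSL ℝ x))) x := by
  have h : HasFDerivAt (fun x : Pt D => ‖x‖ ^ 2) (2 • innerSL ℝ x) x := by
    simpa using (hasFDerivAt_id x).norm_sq
  exact Complex.ofRealCLM.hasFDerivAt.comp x (h.rpow_const (Or.inl (norm_sq_pos hx).ne'))

lemma pderiv_radPow (s : ℝ) (k : Fin D) {x : Pt D} (hx : x ≠ 0) :
    pderiv k (radPow s) x = 2 * s * ((x k : ℂ) * radPow (s - 1) x) := by
  rw [pderiv, (hasFDerivAt_radPow s hx).fderiv]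
  simp [inner_single, radPow]
  ring

lemma analyticAt_rpow_const (s : ℝ) {r : ℝ} (hr : 0 < r) : AnalyticAt ℝ (fun r : ℝ => r ^ s) r := by
  have h : AnalyticAt ℝ (fun r : ℝ => Real.exp (Real.log r * s)) r :=
    ((analyticAt_id.log hr).mul analyticAt_const).rexp
  refine h.congr ?_
  filter_upwards [lt_mem_nhds hr] with y hy
  exact (Real.rpow_def_of_pos hy s).symm

lemma analyticOnNhd_radPow (s : ℝ) : AnalyticOnNhd ℝ (radPow (D := D) s) {0}ᶜ := by
  intro x hx
  have h1 : AnalyticAt ℝ (fun x : Pt D => ‖x‖ ^ 2) x := by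
    have : (fun x : Pt D => ‖x‖ ^ 2) = fun x : Pt D => ∑ k, x k ^ 2 :=
      funext EuclideanSpace.real_norm_sq_eq
    rw [this]
    exact Finset.analyticAt_fun_sum _ fun k _ =>
      ((EuclideanSpace.proj k : Pt D →L[ℝ] ℝ).analyticAt x).pow 2
  have h2 : AnalyticAt ℝ (fun x : Pt D => (‖x‖ ^ 2) ^ s) x :=
    (analyticAt_rpow_const s (norm_sq_pos hx)).fun_comp (f := fun x : Pt D => ‖x‖ ^ 2) h1
  exact (Complex.ofRealCLM.analyticAt _).comp h2

/-- `∏_{j < l} 2 (s - j)`, the factor produced by `l` derivatives of `|x|^{2s}`. -/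
def fallTwo (s : ℝ) (l : ℕ) : ℝ := ∏ j ∈ range l, 2 * (s - j)

lemma fallTwo_succ (s : ℝ) (l : ℕ) : fallTwo s (l + 1) = fallTwo s l * (2 * (s - l)) :=
  prod_range_succ _ _

/-- Derivatives of radial functions contracted with a trace-free tensor: only the terms where all
derivatives act on the radial factor survive. -/
lemma tderiv_radPow (s : ℝ) {l : ℕ} : ∀ {T : (Fin l → Fin D) → ℂ}, SymTraceFree T →
    ∀ x ∈ ({0}ᶜ : Set (Pt D)),
      tderiv T (radPow s) x = fallTwo s l * (radPow (s - l) x * contr T x) := by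
  induction l with
  | zero =>
    intro T _ x _
    simp [tderiv, contr_zero, fallTwo, Subsingleton.elim default (Fin.elim0 : Fin 0 → Fin D)]
    ring
  | succ l ih =>
    intro T hT x hx
    have hd1 : DifferentiableAt ℝ (radPow (s - l)) x :=
      (analyticOnNhd_radPow _ x hx).differentiableAt
    have hd2 : ∀ k, DifferentiableAt ℝ (contr (slice T k)) x := fun k =>
      (analyticOnNhd_contr _ Set.univ x trivial).differentiableAt
    rw [tderiv_succ (analyticOnNhd_radPow s) T hx]
    have h1 : ∀ k, pderiv k (tderiv (slice T k) (radPow s)) x = fallTwo s l *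
        (2 * (s - l) * radPow (s - l - 1) x * ((x k : ℂ) * contr (slice T k) x) +
          radPow (s - l) x * pderiv k (contr (slice T k)) x) := by
      intro k
      rw [pderiv_congr isOpen_compl_zero (fun y hy => ih (hT.slice k) y hy) k hx,
        pderiv_const_mul (hd1.fun_mul (hd2 k)), pderiv_mul hd1 (hd2 k), pderiv_radPow _ _ hx]
      push_cast
      ring
    simp only [h1, ← mul_sum, sum_add_distrib, ← contr_succ, sum_pderiv_contr_slice hT, mul_zero,
      add_zero]
    rw [fallTwo_succ]
    have : s - ((l + 1 : ℕ) : ℝ) = s - l - 1 := by push_cast; ring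
    rw [this]
    push_cast
    ring

/-- The Newton kernel `|x|^{2-D}`. -/
def newton (D : ℕ) : Pt D → ℂ := radPow (1 - (D : ℝ) / 2)

lemma analyticOnNhd_newton : AnalyticOnNhd ℝ (newton D) {0}ᶜ := analyticOnNhd_radPow _

/-- Away from the origin, `|x|^{2s}` satisfies `Δ |x|^{2s} = 2s (2s + D - 2) |x|^{2s-2}`. -/
lemma laplacian_radPow (s : ℝ) {x : Pt D} (hx : x ≠ 0) :
    ∑ k, pderiv k (pderiv k (radPow s)) x = (2 * s * (2 * s + D - 2) : ℝ) * radPow (s - 1) x := by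
  have hd : DifferentiableAt ℝ (radPow (s - 1)) x :=
    (analyticOnNhd_radPow _ x hx).differentiableAt
  have h1 : ∀ k, pderiv k (pderiv k (radPow s)) x =
      2 * s * (radPow (s - 1) x +
        2 * (s - 1) * radPow (s - 1 - 1) x * ((x k : ℂ) * (x k : ℂ))) := by
    intro k
    rw [pderiv_congr isOpen_compl_zero (fun y hy => pderiv_radPow s k hy) k hx,
      pderiv_const_mul ((analyticAt_coord k x).differentiableAt.fun_mul hd),
      pderiv_mul (analyticAt_coord k x).differentiableAt hd, pderiv_coord, pderiv_radPow _ _ hx]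
    simp only [if_true]
    push_cast
    ring
  simp only [h1, ← mul_sum, sum_add_distrib, ← radPow_one, sum_const, card_univ, Fintype.card_fin,
    nsmul_eq_mul]
  have h2 : radPow (s - 1) x = radPow (s - 1 - 1) x * radPow 1 x := by
    rw [← radPow_add _ _ hx, sub_add_cancel]
  rw [mul_assoc _ _ (radPow 1 x), ← h2]
  push_cast
  ring

lemma laplacian_newton {x : Pt D} (hx : x ≠ 0) :
    ∑ k, pderiv k (pderiv k (newton D)) x = 0 := by
  rw [newton, laplacian_radPow _ hx, show 2 * (1 - (D : ℝ) / 2) + D - 2 = 0 by ring]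
  simp

end Radial

/-! ### The coefficients of the basic field -/

section Modes

variable {D : ℕ} (t : TensorBasis D)

/-- The components of the tensor `t_{l,m}`. -/
def modeTensor (M : Mode D) : (Fin M.1 → Fin D) → ℂ := fun μ => (t M.1 M.2 : Tensor D M.1) μ

lemma symTraceFree_modeTensor (M : Mode D) : SymTraceFree (modeTensor t M) := symTraceFree_coe _

lemma star_contr_star {l : ℕ} (T : (Fin l → Fin D) → ℂ) (x : Pt D) :
    star (contr (fun μ => star (T μ)) x) = contr T x := by
  simp only [star_contr, star_star]

lemma conjContract_mode (M : Mode D) (x : Pt D) : conjContract (t M.1 M.2 : Tensor D M.1) x =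
    contr (fun μ => star (modeTensor t M μ)) x := rfl

lemma sum_norm_modeTensor (M : Mode D) : ∑ μ, ‖modeTensor t M μ‖ ^ 2 = 1 := by
  have h : ‖(t M.1 M.2 : Tensor D M.1)‖ = 1 := (t M.1).orthonormal.1 M.2
  have h2 := EuclideanSpace.norm_sq_eq (t M.1 M.2 : Tensor D M.1)
  rw [h] at h2
  simpa [modeTensor] using h2.symm

variable [hD : Fact (2 < D)]

lemma two_lt_cast : (2 : ℝ) < D := by exact_mod_cast hD.out

/-- This is where the constants `c_l` come from. -/
lemma fallTwo_newton (l : ℕ) :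
    fallTwo (1 - (D : ℝ) / 2) l = (-1) ^ l * (cConst D l / l.factorial) := by
  have h2 : (2 : ℝ) < D := two_lt_cast
  have hG : ∀ l : ℕ, Real.Gamma (l + (D : ℝ) / 2 - 1) ≠ 0 := fun l =>
    (Real.Gamma_pos_of_pos (by have : (0 : ℝ) ≤ l := Nat.cast_nonneg l; linarith)).ne'
  induction l with
  | zero =>
    have := hG 0
    simp only [Nat.cast_zero, zero_add] at this
    simp [fallTwo, cConst, this]
  | succ l ih =>
    have h0 : (l : ℝ) + (D : ℝ) / 2 - 1 ≠ 0 := by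
      have : (0 : ℝ) ≤ l := Nat.cast_nonneg l
      intro h; linarith
    have h1 : ((l + 1 : ℕ) : ℝ) + (D : ℝ) / 2 - 1 = ((l : ℝ) + (D : ℝ) / 2 - 1) + 1 := by
      push_cast; ring
    have h3 : Real.Gamma ((D : ℝ) / 2 - 1) ≠ 0 := by simpa using hG 0
    have h4 : ((l.factorial : ℕ) : ℝ) ≠ 0 := by positivity
    have h5 : ((l + 1).factorial : ℝ) ≠ 0 := by positivity
    rw [fallTwo_succ, ih, cConst, cConst, h1, Real.Gamma_add_one h0, Real.Gamma_nat_eq_factorial,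
      Real.Gamma_nat_eq_factorial]
    field_simp
    ring

/-- `c_l^{1/2} / l!`, the normalization of the solid harmonics in the field `Y(x, φ)`. -/
def harmConst (D l : ℕ) : ℝ := √(cConst D l) / l.factorial

/-- The normalization of the spherical harmonics and the constants in `Y(x, φ)` combine to
`c_l^{1/2} / l!`. -/
lemma norm_sphHarm_const (M : Mode D) :
    modeConst D M.1 * (√(∫ ω : Metric.sphere (0 : Pt D) 1,
      ‖conjContract (t M.1 M.2 : Tensor D M.1) (ω : Pt D)‖ ^ 2
        ∂(volume : Measure (Pt D)).toSphere))⁻¹ = harmConst D M.1 := by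
  have h2 : (2 : ℝ) < D := two_lt_cast
  have hl : (0 : ℝ) ≤ M.1 := Nat.cast_nonneg _
  have hv : 0 < (volume : Measure (Pt D)).toSphere.real Set.univ := by
    rw [Measure.real, ENNReal.toReal_pos_iff]
    exact ⟨pos_iff_ne_zero.2 fun h =>
      Measure.toSphere_ne_zero volume (Measure.measure_univ_eq_zero.1 h), measure_lt_top _ _⟩
  have h3 : ∀ x : Pt D,
      ‖conjContract (t M.1 M.2 : Tensor D M.1) x‖ = ‖contr (modeTensor t M) x‖ := by
    intro x
    rw [conjContract_mode, ← star_contr, norm_star]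
  simp only [h3]
  rw [integral_sphere_contr_sq (symTraceFree_modeTensor t M), sum_norm_modeTensor, modeConst,
    harmConst, ← Real.sqrt_inv, ← Real.sqrt_mul (by positivity), ← Real.sqrt_mul (by
      refine mul_nonneg hv.le (div_nonneg (by linarith) (by linarith)))]
  rw [cConst, Real.Gamma_nat_eq_factorial M.1]
  conv_rhs => rw [← Real.sqrt_sq (Nat.cast_nonneg M.1.factorial : (0 : ℝ) ≤ _),
    ← Real.sqrt_div' _ (by positivity)]
  have hg1 : 0 < Real.Gamma ((D : ℝ) / 2 - 1) := Real.Gamma_pos_of_pos (by linarith)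
  have hg2 : 0 < Real.Gamma ((M.1 : ℝ) + (D : ℝ) / 2 - 1) := Real.Gamma_pos_of_pos (by linarith)
  have e1 : Real.Gamma ((D : ℝ) / 2) = ((D : ℝ) / 2 - 1) * Real.Gamma ((D : ℝ) / 2 - 1) := by
    rw [← Real.Gamma_add_one (by linarith), sub_add_cancel]
  have e2 : Real.Gamma ((M.1 : ℝ) + (D : ℝ) / 2) =
      ((M.1 : ℝ) + (D : ℝ) / 2 - 1) * Real.Gamma ((M.1 : ℝ) + (D : ℝ) / 2 - 1) := by
    rw [← Real.Gamma_add_one (by linarith), sub_add_cancel]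
  rw [e1, e2]
  congr 1
  have hf : (0 : ℝ) < M.1.factorial := by positivity
  have h5 : (D : ℝ) - 2 ≠ 0 := by linarith
  have h6 : 2 * (M.1 : ℝ) + D - 2 ≠ 0 := by linarith
  have h7 : (D : ℝ) / 2 - 1 = ((D : ℝ) - 2) / 2 := by ring
  have h8 : (M.1 : ℝ) + (D : ℝ) / 2 - 1 = (2 * (M.1 : ℝ) + D - 2) / 2 := by ring
  rw [h7, h8] at *
  field_simp
  rw [Real.sqrt_sq hf.le]
  ring

lemma createCoeff_eq (M : Mode D) : createCoeff t M =
    fun x => (harmConst D M.1 : ℂ) * contr (fun μ => star (modeTensor t M μ)) x := by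
  ext x
  rw [createCoeff, sphHarm, conjContract_mode, ← norm_sphHarm_const t M]
  generalize (fun μ => star (modeTensor t M μ)) = S
  have h : contr S x = ((‖x‖ : ℝ) : ℂ) ^ M.1 * contr S (‖x‖⁻¹ • x) := by
    rw [← contr_smul, smul_smul]
    by_cases hx : x = 0
    · simp [hx]
    · rw [mul_inv_cancel₀ (norm_ne_zero_iff.2 hx), one_smul]
  rw [h]
  push_cast
  ring

lemma annihCoeff_eq (M : Mode D) {x : Pt D} (hx : x ≠ 0) : annihCoeff t M x =
    (harmConst D M.1 : ℂ) * (radPow (1 - (D : ℝ) / 2 - M.1) x * contr (modeTensor t M) x) := by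
  rw [annihCoeff, sphHarm, conjContract_mode, ← norm_sphHarm_const t M, star_mul',
    star_contr_star]
  have hx' : ‖x‖ ≠ 0 := norm_ne_zero_iff.2 hx
  generalize modeTensor t M = S
  have h : contr S x = ((‖x‖ : ℝ) : ℂ) ^ M.1 * contr S (‖x‖⁻¹ • x) := by
    rw [← contr_smul, smul_smul, mul_inv_cancel₀ hx', one_smul]
  have h2 : radPow (1 - (D : ℝ) / 2 - M.1) x * ((‖x‖ : ℝ) : ℂ) ^ M.1 =
      ((‖x‖ ^ (-(M.1 : ℤ) - D + 2) : ℝ) : ℂ) := by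
    rw [radPow, ← Complex.ofReal_pow, ← Complex.ofReal_mul]
    congr 1
    rw [← Real.rpow_natCast ‖x‖ M.1, ← Real.rpow_natCast ‖x‖ 2, ← Real.rpow_mul (norm_nonneg _),
      ← Real.rpow_add (norm_pos_iff.2 hx), ← Real.rpow_intCast]
    congr 1
    push_cast
    ring
  rw [h, ← mul_assoc (radPow _ x), h2, Complex.star_def, Complex.conj_ofReal]
  push_cast
  ring

/-- The annihilation coefficients are derivatives of the Newton kernel. -/
lemma annihCoeff_eq_tderiv (M : Mode D) : Set.EqOn (annihCoeff t M)
    (fun x => ((-1) ^ M.1 * (√(cConst D M.1))⁻¹ : ℝ) * tderiv (modeTensor t M) (newton D) x)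
    {0}ᶜ := by
  intro x hx
  have hc : √(cConst D M.1) ≠ 0 := (Real.sqrt_pos.2 (cConst_pos hD.out _)).ne'
  dsimp only
  rw [annihCoeff_eq t M hx, newton, tderiv_radPow _ (symTraceFree_modeTensor t M) x hx,
    fallTwo_newton, ← mul_assoc (Complex.ofReal _) (Complex.ofReal _), ← Complex.ofReal_mul]
  congr 2
  have h1 : ((-1 : ℝ) ^ M.1) * (-1) ^ M.1 = 1 := by rw [← mul_pow]; simp
  rw [harmConst]
  calc √(cConst D M.1) / M.1.factorial
      = (((-1 : ℝ) ^ M.1) * (-1) ^ M.1) * ((√(cConst D M.1))⁻¹ *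
        (√(cConst D M.1) * √(cConst D M.1)) / M.1.factorial) := by
        rw [h1]; field_simp
    _ = _ := by rw [Real.mul_self_sqrt (cConst_pos hD.out _).le]; ring

lemma creMat_eq (z : Pt D) (M N : Mode D) : creMat t z M N =
    (√(cConst D M.1) : ℂ)⁻¹ * tderiv (modeTensor t M) (createCoeff t N) z := by
  rw [creMat, tensorDeriv_eq_tderiv isOpen_univ (by
    rw [createCoeff_eq]
    exact fun x _ => analyticAt_const.mul (analyticOnNhd_contr _ Set.univ x trivial)) _ trivial]
  rfl

lemma annMat_eq {z : Pt D} (hz : z ≠ 0) (M N : Mode D) : annMat t z M N =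
    (√(cConst D M.1) : ℂ)⁻¹ * (((-1) ^ N.1 * (√(cConst D N.1))⁻¹ : ℝ) *
      tderiv (modeTensor t M) (tderiv (modeTensor t N) (newton D)) z) := by
  have ha := analyticOnNhd_tderiv (analyticOnNhd_newton (D := D)) (modeTensor t N)
  rw [annMat, tensorDeriv_congr isOpen_compl_zero (annihCoeff_eq_tderiv t N) _ hz,
    tensorDeriv_eq_tderiv isOpen_compl_zero (fun x hx => analyticAt_const.fun_mul (ha x hx)) _ hz,
    tderiv_const_mul isOpen_compl_zero ha _ _ hz]
  rfl

end Modes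

/-! ### Taylor expansion of harmonic functions -/

section Taylor

variable {D : ℕ}

lemma fderiv_eq_sum_pderiv (f : Pt D → ℂ) (x z : Pt D) :
    fderiv ℝ f x z = ∑ k, (z k : ℂ) * pderiv k f x := by
  have h : z = ∑ k, z k • EuclideanSpace.single k (1 : ℝ) := by
    ext i
    simp [Pi.single_apply]
  conv_lhs => rw [h]
  rw [map_sum]
  refine sum_congr rfl fun k _ => ?_
  rw [map_smul, pderiv, Complex.real_smul]

/-- The derivative tensor `D^l f(y)`. -/
def derivTensor (f : Pt D → ℂ) (y : Pt D) (l : ℕ) : (Fin l → Fin D) → ℂ :=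
  fun μ => pderivs (List.ofFn μ) f y

/-- The term of degree `l` in the Taylor expansion of `f` at `y`, as a polynomial in the
displacement. -/
def taylorTerm (f : Pt D → ℂ) (y : Pt D) (l : ℕ) (z : Pt D) : ℂ :=
  (l.factorial : ℂ)⁻¹ * contr (derivTensor f y l) z

variable {U : Set (Pt D)} {f g : Pt D → ℂ}

lemma hasDerivAt_line {y z : Pt D} {τ : ℝ} (hf : DifferentiableAt ℝ f (y + τ • z)) :
    HasDerivAt (fun τ : ℝ => f (y + τ • z)) (∑ k, (z k : ℂ) * pderiv k f (y + τ • z)) τ := by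
  have h : HasDerivAt (fun τ : ℝ => y + τ • z) z τ := by
    simpa using ((hasDerivAt_id τ).smul_const z).const_add y
  rw [← fderiv_eq_sum_pderiv]
  exact hf.hasFDerivAt.comp_hasDerivAt τ h

lemma pderiv_contr_derivTensor (hf : AnalyticOnNhd ℝ f U) {x : Pt D} (hx : x ∈ U) (l : ℕ)
    (z : Pt D) (k : Fin D) : pderiv k (fun x => contr (derivTensor f x l) z) x =
      contr (slice (derivTensor f x (l + 1)) k) z := by
  have hd : ∀ μ : Fin l → Fin D, DifferentiableAt ℝ (pderivs (List.ofFn μ) f) x := fun μ =>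
    (analyticOnNhd_pderivs hf _ x hx).differentiableAt
  have : (fun x => contr (derivTensor f x l) z) = fun x => ∑ μ : Fin l → Fin D,
      (∏ i, (z (μ i) : ℂ)) * pderivs (List.ofFn μ) f x :=
    funext fun x => sum_congr rfl fun μ _ => mul_comm _ _
  rw [this, pderiv_sum (F := fun μ x => (∏ i, (z (μ i) : ℂ)) * pderivs (List.ofFn μ) f x)
    fun μ _ => (differentiableAt_const _).mul (hd μ), contr]
  refine sum_congr rfl fun μ _ => ?_
  rw [pderiv_const_mul (hd μ), slice, derivTensor, List.ofFn_cons, pderivs_cons, mul_comm]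

/-- The derivatives along a line are contractions of the derivative tensors. -/
lemma iteratedDeriv_line (hU : IsOpen U) (hf : AnalyticOnNhd ℝ f U) (y z : Pt D) (l : ℕ) :
    ∀ τ : ℝ, y + τ • z ∈ U → iteratedDeriv l (fun τ : ℝ => f (y + τ • z)) τ =
      contr (derivTensor f (y + τ • z) l) z := by
  induction l with
  | zero => intro τ _; simp [contr_zero, derivTensor]
  | succ l ih =>
    intro τ hτ
    have hc : Continuous fun τ : ℝ => y + τ • z := by fun_prop
    have h1 : iteratedDeriv l (fun τ : ℝ => f (y + τ • z)) =ᶠ[nhds τ]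
        fun τ => contr (derivTensor f (y + τ • z) l) z :=
      Filter.eventually_of_mem ((hU.preimage hc).mem_nhds hτ) fun s hs => ih s hs
    have hd : DifferentiableAt ℝ (fun x => contr (derivTensor f x l) z) (y + τ • z) :=
      (Finset.analyticAt_fun_sum (f := fun (μ : Fin l → Fin D) x =>
        derivTensor f x l μ * ∏ i, (z (μ i) : ℂ)) _ fun μ _ =>
        ((analyticOnNhd_pderivs hf (List.ofFn μ) _ hτ).fun_mul analyticAt_const)).differentiableAt
    rw [iteratedDeriv_succ, h1.deriv_eq, (hasDerivAt_line hd).deriv, contr_succ]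
    exact sum_congr rfl fun k _ => by rw [pderiv_contr_derivTensor hf hτ]

/-- A real-analytic function on a line segment is the sum of its Taylor series as soon as the
series converges absolutely beyond the segment. -/
lemma hasSum_taylorTerm (hU : IsOpen U) (hf : AnalyticOnNhd ℝ f U) {y z : Pt D} {R : ℝ}
    (hR : 1 < R) (hline : ∀ τ : ℝ, |τ| < R → y + τ • z ∈ U)
    (hs : ∀ ρ : ℝ, 0 ≤ ρ → ρ < R → Summable fun l => ‖taylorTerm f y l z‖ * ρ ^ l) :
    HasSum (fun l => taylorTerm f y l z) (f (y + z)) := by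
  set ψ : ℝ → ℂ := fun τ => f (y + τ • z) with hψ
  have haff : ∀ τ : ℝ, AnalyticAt ℝ (fun τ : ℝ => y + τ • z) τ := fun τ =>
    analyticAt_const.add (analyticAt_id.smul analyticAt_const)
  have hψa : ∀ τ : ℝ, |τ| < R → AnalyticAt ℝ ψ τ := fun τ hτ =>
    (hf _ (hline τ hτ)).fun_comp (f := fun τ : ℝ => y + τ • z) (haff τ)
  have h0 : y + (0 : ℝ) • z ∈ U := hline 0 (by rw [abs_zero]; linarith)
  obtain ⟨p, r, hp⟩ := hψa 0 (by rw [abs_zero]; linarith)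
  have hcoef : ∀ n, p n (fun _ => 1) = taylorTerm f y n z := by
    intro n
    have h1 := hp.factorial_smul 1 n
    have h2 : iteratedFDeriv ℝ n ψ 0 (fun _ => (1 : ℝ)) = iteratedDeriv n ψ 0 := rfl
    rw [h2, iteratedDeriv_line hU hf y z n 0 h0, zero_smul, add_zero] at h1
    have h3 : (n.factorial : ℂ) ≠ 0 := by exact_mod_cast n.factorial_ne_zero
    rw [taylorTerm, ← h1, nsmul_eq_mul, inv_mul_cancel_left₀ h3]
  have hnorm : ∀ n, ‖p n‖ = ‖taylorTerm f y n z‖ := fun n => by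
    rw [← hcoef, FormalMultilinearSeries.norm_apply_eq_norm_coef]
    rfl
  have happ : ∀ (n : ℕ) (τ : ℝ), p n (fun _ => τ) = (τ : ℂ) ^ n * taylorTerm f y n z := by
    intro n τ
    have := p.apply_eq_pow_smul_coeff (n := n) (z := τ)
    rw [this, FormalMultilinearSeries.coeff, ← hcoef, Complex.real_smul]
    push_cast
    rfl
  have hrad : ENNReal.ofReal R ≤ p.radius := by
    refine ENNReal.le_of_forall_nnreal_lt fun ρ hρ => ?_
    refine p.le_radius_of_summable ?_
    simp only [hnorm]
    refine hs ρ ρ.2 ?_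
    rwa [← ENNReal.ofReal_coe_nnreal, ENNReal.ofReal_lt_ofReal_iff (by linarith)] at hρ
  have hpos : 0 < p.radius := lt_of_lt_of_le (by simpa using (by linarith : 0 < R)) hrad
  have hball := p.hasFPowerSeriesOnBall hpos
  have hI : IsPreconnected (Set.Ioo (-R) R) := isPreconnected_Ioo
  have hmem : ∀ τ : ℝ, |τ| < R → τ ∈ Metric.eball (0 : ℝ) p.radius := by
    intro τ hτ
    rw [Metric.mem_eball, edist_dist, Real.dist_eq, sub_zero]
    exact lt_of_lt_of_le ((ENNReal.ofReal_lt_ofReal_iff (by linarith)).2 hτ) hrad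
  -- The restriction to the line and the sum of the power series agree near `0`, hence on the whole
  -- interval, by the identity theorem.
  have heq : Set.EqOn ψ p.sum (Set.Ioo (-R) R) := by
    refine AnalyticOnNhd.eqOn_of_preconnected_of_eventuallyEq (z₀ := 0)
      (fun τ hτ => hψa τ (abs_lt.2 hτ)) (fun τ hτ => ?_) hI ⟨by linarith, by linarith⟩ ?_
    · exact hball.analyticAt_of_mem (hmem τ (abs_lt.2 hτ))
    · have e1 := hp.hasFPowerSeriesAt.eventually_hasSum
      have e2 := hball.hasFPowerSeriesAt.eventually_hasSum
      filter_upwards [e1, e2] with τ h1 h2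
      simpa using h1.unique h2
  have h1 : |(1 : ℝ)| < R := by simpa using hR
  have h2 := hball.hasSum (hmem 1 h1)
  rw [zero_add, ← heq ⟨by linarith, hR⟩] at h2
  simpa [happ, hψ] using h2

/-- Functions with vanishing Laplacian on `U`. -/
def LaplaceFree (f : Pt D → ℂ) (U : Set (Pt D)) : Prop :=
  ∀ x ∈ U, ∑ k, pderiv k (pderiv k f) x = 0

lemma LaplaceFree.pderivs (hU : IsOpen U) (hf : AnalyticOnNhd ℝ f U) (h : LaplaceFree f U)
    (L : List (Fin D)) : LaplaceFree (pderivs L f) U := by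
  intro x hx
  have h1 : ∀ k, pderiv k (pderiv k (FreeField.pderivs L f)) x =
      FreeField.pderivs L (pderiv k (pderiv k f)) x := fun k =>
    pderivs_comm hU hf [k, k] L hx
  have h2 : ∀ k ∈ (univ : Finset (Fin D)), AnalyticOnNhd ℝ (pderiv k (pderiv k f)) U := fun k _ =>
    analyticOnNhd_pderivs hf [k, k]
  simp only [h1]
  have h3 : Set.EqOn (fun x => ∑ k, pderiv k (pderiv k f) x) (fun x => 0 * (0 : ℂ)) U :=
    fun x hx => (h x hx).trans (zero_mul _).symm
  have h4 := pderivs_sum hU h2 L hx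
  dsimp only at h4
  rw [← h4, pderivs_congr hU h3 L hx, pderivs_const_mul hU (fun _ _ => analyticAt_const) _ _ hx]
  exact zero_mul _

lemma LaplaceFree.symTraceFree (hU : IsOpen U) (hf : AnalyticOnNhd ℝ f U) (h : LaplaceFree f U)
    {y : Pt D} (hy : y ∈ U) (l : ℕ) : SymTraceFree (derivTensor f y l) := by
  refine ⟨fun σ μ => ?_, fun i j hij μ => ?_⟩
  · exact pderivs_perm hU hf (Equiv.Perm.ofFn_comp_perm σ μ) hy
  · -- Up to a permutation, the two contracted indices come first.
    set rest : List (Fin D) := (((univ.erase i).erase j).toList.map μ)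
    have hperm : ∀ k, (List.ofFn (Function.update (Function.update μ i k) j k)).Perm
        (k :: k :: rest) := by
      intro k
      have hrest : (rest : Multiset (Fin D)) = ((univ.erase i).erase j).val.map μ := by
        rw [← Finset.coe_toList, Multiset.map_coe]
      have hval : (univ : Finset (Fin l)).val = i ::ₘ j ::ₘ ((univ.erase i).erase j).val := by
        rw [Finset.erase_val, Multiset.cons_erase
          (Finset.mem_def.1 (mem_erase.2 ⟨hij.symm, mem_univ j⟩)), Finset.erase_val,
          Multiset.cons_erase (Finset.mem_def.1 (mem_univ i))]
      rw [← Multiset.coe_eq_coe, ← Fin.univ_val_map, hval, Multiset.map_cons, Multiset.map_cons,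
        ← Multiset.cons_coe, ← Multiset.cons_coe, hrest]
      congr 1
      · simp [hij]
      congr 1
      · simp
      refine Multiset.map_congr rfl fun n hn => ?_
      have hn' : n ∈ (univ.erase i).erase j := hn
      simp only [mem_erase, mem_univ, and_true] at hn'
      rw [Function.update_of_ne hn'.1, Function.update_of_ne hn'.2]
    have h1 : ∀ k, derivTensor f y l (Function.update (Function.update μ i k) j k) =
        pderiv k (pderiv k (FreeField.pderivs rest f)) y := fun k =>
      pderivs_perm hU hf (hperm k) hy
    simp only [h1]
    exact h.pderivs hU hf rest y hy

lemma slice_derivTensor (hU : IsOpen U) (hf : AnalyticOnNhd ℝ f U) {y : Pt D} (hy : y ∈ U)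
    (l : ℕ) (k : Fin D) :
    slice (derivTensor f y (l + 1)) k = derivTensor (pderiv k f) y l := by
  ext μ
  rw [slice, derivTensor, List.ofFn_cons]
  exact pderivs_comm hU hf [k] (List.ofFn μ) hy

lemma pderiv_taylorTerm (hU : IsOpen U) (hf : AnalyticOnNhd ℝ f U) (h : LaplaceFree f U)
    {y : Pt D} (hy : y ∈ U) (l : ℕ) (k : Fin D) :
    pderiv k (taylorTerm f y (l + 1)) = taylorTerm (pderiv k f) y l := by
  ext z
  have h1 : taylorTerm f y (l + 1) = fun z =>
    ((l + 1).factorial : ℂ)⁻¹ * contr (derivTensor f y (l + 1)) z := rfl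
  rw [h1, pderiv_const_mul (analyticOnNhd_contr _ Set.univ z trivial).differentiableAt,
    pderiv_contr (h.symTraceFree hU hf hy _), slice_derivTensor hU hf hy, taylorTerm,
    Nat.factorial_succ]
  have h3 : (l.factorial : ℂ) ≠ 0 := by exact_mod_cast l.factorial_ne_zero
  have h4 : (l : ℂ) + 1 ≠ 0 := by exact_mod_cast l.succ_ne_zero
  push_cast
  field_simp

lemma pderiv_taylorTerm_zero (y : Pt D) (k : Fin D) :
    pderiv k (taylorTerm f y 0) = fun _ => 0 := by
  ext z
  have h1 : taylorTerm f y 0 = fun _ => f y := by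
    ext z
    simp [taylorTerm, contr_zero, derivTensor]
  rw [h1, pderiv_const]

lemma pderivs_taylorTerm (hU : IsOpen U) (hf : AnalyticOnNhd ℝ f U) (h : LaplaceFree f U)
    {y : Pt D} (hy : y ∈ U) (L : List (Fin D)) : ∀ n,
    pderivs L (taylorTerm f y (n + L.length)) = taylorTerm (pderivs L f) y n := by
  induction L with
  | nil => exact fun n => rfl
  | cons k L ih =>
    intro n
    rw [pderivs_cons, List.length_cons, ← add_assoc, add_right_comm, ih,
      pderiv_taylorTerm hU (analyticOnNhd_pderivs hf L) (h.pderivs hU hf L) hy]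
    rfl

lemma pderivs_taylorTerm_of_lt (hU : IsOpen U) (hf : AnalyticOnNhd ℝ f U) (h : LaplaceFree f U)
    {y : Pt D} (hy : y ∈ U) (L : List (Fin D)) : ∀ l, l < L.length →
    pderivs L (taylorTerm f y l) = fun _ => 0 := by
  induction L with
  | nil => simp
  | cons k L ih =>
    intro l hl
    rw [pderivs_cons]
    rcases Nat.lt_succ_iff_lt_or_eq.1 (by simpa using hl) with hl | rfl
    · rw [ih l hl]
      exact funext fun z => pderiv_const 0 k
    · have := pderivs_taylorTerm hU hf h hy L 0
      rw [zero_add] at this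
      rw [this, pderiv_taylorTerm_zero]

/-- Differentiating a Taylor term amounts to differentiating the function. -/
lemma tderiv_taylorTerm (hU : IsOpen U) (hf : AnalyticOnNhd ℝ f U) (h : LaplaceFree f U)
    {y : Pt D} (hy : y ∈ U) {k : ℕ} (T : (Fin k → Fin D) → ℂ) (n : ℕ) (z : Pt D) :
    tderiv T (taylorTerm f y (n + k)) z = taylorTerm (tderiv T f) y n z := by
  have h1 : ∀ μ : Fin k → Fin D, pderivs (List.ofFn μ) (taylorTerm f y (n + k)) z =
      taylorTerm (pderivs (List.ofFn μ) f) y n z := fun μ => by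
    have := pderivs_taylorTerm hU hf h hy (List.ofFn μ) n
    rw [List.length_ofFn] at this
    rw [this]
  have h2 : derivTensor (tderiv T f) y n = fun ν =>
      ∑ μ, T μ * derivTensor (pderivs (List.ofFn μ) f) y n ν := by
    ext ν
    have e1 := pderivs_sum (s := univ) (F := fun μ x => T μ * pderivs (List.ofFn μ) f x) hU
      (fun μ _ x hx => analyticAt_const.fun_mul (analyticOnNhd_pderivs hf _ x hx)) (List.ofFn ν) hy
    change pderivs (List.ofFn ν) (fun x => ∑ μ, T μ * pderivs (List.ofFn μ) f x) y = _
    rw [e1]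
    refine sum_congr rfl fun μ _ => ?_
    rw [pderivs_const_mul hU (analyticOnNhd_pderivs hf _) _ _ hy]
    rfl
  simp only [tderiv, h1]
  simp only [taylorTerm, h2, contr, mul_sum, sum_mul]
  rw [sum_comm]
  exact sum_congr rfl fun _ _ => sum_congr rfl fun _ _ => by ring

lemma tderiv_taylorTerm_of_lt (hU : IsOpen U) (hf : AnalyticOnNhd ℝ f U) (h : LaplaceFree f U)
    {y : Pt D} (hy : y ∈ U) {k : ℕ} (T : (Fin k → Fin D) → ℂ) {l : ℕ} (hl : l < k) (z : Pt D) :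
    tderiv T (taylorTerm f y l) z = 0 :=
  sum_eq_zero fun μ _ => by
    rw [pderivs_taylorTerm_of_lt hU hf h hy _ _ (by simpa using hl), mul_zero]

end Taylor

/-! ### Taylor terms in terms of the modes -/

section Level

variable {D : ℕ} (t : TensorBasis D)

/-- Completeness of the tensors `t_{l,m}`. -/
lemma sum_modeTensor {l : ℕ} {S : (Fin l → Fin D) → ℂ} (hS : SymTraceFree S) (μ : Fin l → Fin D) :
    ∑ m, star (modeTensor t ⟨l, m⟩ μ) * ∑ ν, modeTensor t ⟨l, m⟩ ν * S ν = S μ := by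
  let S' : traceFree D l := ⟨WithLp.toLp 2 fun μ => star (S μ), hS.star.symm, hS.star.trace⟩
  have h1 := congrArg (fun s : traceFree D l => star ((s : Tensor D l) μ)) ((t l).sum_repr S')
  have h2 : star ((S' : Tensor D l) μ) = S μ := star_star _
  rw [h2] at h1
  rw [← h1]
  simp only [Submodule.coe_sum, Submodule.coe_smul, WithLp.ofLp_sum, Finset.sum_apply,
    WithLp.ofLp_smul, Pi.smul_apply, smul_eq_mul, star_sum, star_mul']
  refine sum_congr rfl fun m _ => ?_
  rw [mul_comm]
  congr 1
  rw [OrthonormalBasis.repr_apply_apply, Submodule.coe_inner, PiLp.inner_apply, star_sum]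
  refine sum_congr rfl fun ν _ => ?_
  simp [S', modeTensor, mul_comm]

lemma contr_eq_sum_modeTensor {l : ℕ} {S : (Fin l → Fin D) → ℂ} (hS : SymTraceFree S) (z : Pt D) :
    contr S z = ∑ m, (∑ ν, modeTensor t ⟨l, m⟩ ν * S ν) *
      contr (fun μ => star (modeTensor t ⟨l, m⟩ μ)) z := by
  calc contr S z = ∑ μ, (∑ m, star (modeTensor t ⟨l, m⟩ μ) * ∑ ν, modeTensor t ⟨l, m⟩ ν * S ν) *
        ∏ i, (z (μ i) : ℂ) := sum_congr rfl fun μ _ => by rw [sum_modeTensor t hS μ]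
    _ = _ := by
      simp only [contr, sum_mul (s := univ (α := Fin (finrank ℂ (traceFree D l))))]
      rw [sum_comm]
      refine sum_congr rfl fun m _ => ?_
      rw [mul_sum]
      exact sum_congr rfl fun μ _ => by ring

variable [hD : Fact (2 < D)] {U : Set (Pt D)} {f : Pt D → ℂ}

lemma analyticOnNhd_createCoeff (M : Mode D) (U : Set (Pt D)) :
    AnalyticOnNhd ℝ (createCoeff t M) U := by
  rw [createCoeff_eq]
  exact fun x _ => analyticAt_const.fun_mul (analyticOnNhd_contr _ Set.univ x trivial)

/-- The Taylor terms of harmonic functions in terms of the modes of the field. -/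
lemma taylorTerm_eq_sum (hU : IsOpen U) (hf : AnalyticOnNhd ℝ f U) (h : LaplaceFree f U)
    {y : Pt D} (hy : y ∈ U) (l : ℕ) : taylorTerm f y l = fun z =>
      ∑ m, ((√(cConst D l) : ℂ)⁻¹ * tderiv (modeTensor t ⟨l, m⟩) f y) *
        createCoeff t ⟨l, m⟩ z := by
  ext z
  have hc : (√(cConst D l) : ℂ) ≠ 0 := by
    exact_mod_cast (Real.sqrt_pos.2 (cConst_pos hD.out l)).ne'
  rw [taylorTerm, contr_eq_sum_modeTensor t (h.symTraceFree hU hf hy l), mul_sum]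
  refine sum_congr rfl fun m _ => ?_
  rw [createCoeff_eq, harmConst]
  simp only [tderiv, derivTensor]
  push_cast
  field_simp

/-- Expansion of a Taylor term of a harmonic function, with derivatives. -/
lemma tderiv_taylorTerm_eq_sum (hU : IsOpen U) (hf : AnalyticOnNhd ℝ f U) (h : LaplaceFree f U)
    {y : Pt D} (hy : y ∈ U) (l : ℕ) {k : ℕ} (T : (Fin k → Fin D) → ℂ) (z : Pt D) :
    tderiv T (taylorTerm f y l) z = ∑ m, tderiv T (createCoeff t ⟨l, m⟩) z *
      ((√(cConst D l) : ℂ)⁻¹ * tderiv (modeTensor t ⟨l, m⟩) f y) := by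
  rw [taylorTerm_eq_sum t hU hf h hy l, tderiv]
  have h1 : ∀ μ : Fin k → Fin D, _ := fun μ => pderivs_sum (U := Set.univ) (s := univ)
    (F := fun m z => ((√(cConst D l) : ℂ)⁻¹ * tderiv (modeTensor t ⟨l, m⟩) f y) *
        createCoeff t ⟨l, m⟩ z) isOpen_univ
    (fun m _ x hx => analyticAt_const.fun_mul (analyticOnNhd_createCoeff t _ _ x hx))
    (List.ofFn μ) (Set.mem_univ z)
  have h2 : ∀ (μ : Fin k → Fin D) (m), _ := fun μ m => pderivs_const_mul (U := Set.univ)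
    isOpen_univ (analyticOnNhd_createCoeff t ⟨l, m⟩ _)
    ((√(cConst D l) : ℂ)⁻¹ * tderiv (modeTensor t ⟨l, m⟩) f y) (List.ofFn μ) (Set.mem_univ z)
  simp only [h1, h2, mul_sum]
  rw [sum_comm]
  refine sum_congr rfl fun m _ => ?_
  generalize (√(cConst D l) : ℂ)⁻¹ * tderiv (modeTensor t ⟨l, m⟩) f y = c
  rw [tderiv, sum_mul]
  exact sum_congr rfl fun μ _ => by ring

end Level

/-! ### Gradients of harmonic functions -/

section Gradients

variable {D : ℕ}

lemma LaplaceFree.tderiv {U : Set (Pt D)} {f : Pt D → ℂ} (hU : IsOpen U)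
    (hf : AnalyticOnNhd ℝ f U) (h : LaplaceFree f U) {l : ℕ} (T : (Fin l → Fin D) → ℂ) :
    LaplaceFree (tderiv T f) U := by
  intro x hx
  have h1 : ∀ k, pderiv k (pderiv k (FreeField.tderiv T f)) x =
      ∑ μ, T μ * pderiv k (pderiv k (FreeField.pderivs (List.ofFn μ) f)) x := by
    intro k
    have e1 := pderivs_sum (s := univ) (F := fun μ x => T μ * FreeField.pderivs (List.ofFn μ) f x)
      hU (fun μ _ x hx => analyticAt_const.mul (analyticOnNhd_pderivs hf _ x hx)) [k, k] hx
    refine e1.trans (sum_congr rfl fun μ _ => ?_)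
    exact pderivs_const_mul hU (analyticOnNhd_pderivs hf _) (T μ) [k, k] hx
  simp only [h1]
  rw [sum_comm]
  refine sum_eq_zero fun μ _ => ?_
  rw [← mul_sum, h.pderivs hU hf _ x hx, mul_zero]

lemma LaplaceFree.const_mul {U : Set (Pt D)} {f : Pt D → ℂ} (hU : IsOpen U)
    (hf : AnalyticOnNhd ℝ f U) (h : LaplaceFree f U) (c : ℂ) :
    LaplaceFree (fun x => c * f x) U := by
  intro x hx
  have h1 : ∀ k, pderiv k (pderiv k fun x => c * f x) x = c * pderiv k (pderiv k f) x := fun k =>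
    pderivs_const_mul hU hf c [k, k] hx
  simp only [h1, ← mul_sum, h x hx, mul_zero]

/-- If harmonic functions have `∑_i |H_i|² = c |x|^{2s}`, then comparing the Laplacians of both
sides gives the sum of the squares of their gradients. -/
lemma sum_gradient_sq {ι : Type*} [Fintype ι] {H : ι → Pt D → ℂ} {c s : ℝ}
    (hH : ∀ i, AnalyticOnNhd ℝ (H i) {0}ᶜ) (hL : ∀ i, LaplaceFree (H i) {0}ᶜ)
    (h : ∀ x ∈ ({0}ᶜ : Set (Pt D)), ∑ i, H i x * star (H i x) = c * radPow s x)
    {x : Pt D} (hx : x ∈ ({0}ᶜ : Set (Pt D))) :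
    ∑ k, ∑ i, pderiv k (H i) x * star (pderiv k (H i) x) =
      (c * (s * (2 * s + D - 2)) : ℝ) * radPow (s - 1) x := by
  have hd : ∀ i, ∀ x ∈ ({0}ᶜ : Set (Pt D)), DifferentiableAt ℝ (H i) x := fun i x hx =>
    (hH i x hx).differentiableAt
  have hd' : ∀ i k, ∀ x ∈ ({0}ᶜ : Set (Pt D)), DifferentiableAt ℝ (pderiv k (H i)) x :=
    fun i k x hx => (analyticOnNhd_pderiv (hH i) k x hx).differentiableAt
  have h1 : ∀ k, ∀ x ∈ ({0}ᶜ : Set (Pt D)), pderiv k (fun x => ∑ i, H i x * star (H i x)) x =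
      ∑ i, (pderiv k (H i) x * star (H i x) + H i x * star (pderiv k (H i) x)) := by
    intro k x hx
    rw [pderiv_sum (F := fun i x => H i x * star (H i x))
      fun i _ => (hd i x hx).fun_mul (hd i x hx).star]
    refine sum_congr rfl fun i _ => ?_
    rw [pderiv_mul (hd i x hx) (hd i x hx).star, pderiv_star (hd i x hx)]
  have h2 : ∀ k, pderiv k (pderiv k fun x => ∑ i, H i x * star (H i x)) x =
      ∑ i, (pderiv k (pderiv k (H i)) x * star (H i x) +
        2 * (pderiv k (H i) x * star (pderiv k (H i) x)) +
        H i x * star (pderiv k (pderiv k (H i)) x)) := by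
    intro k
    rw [pderiv_congr isOpen_compl_zero (fun x hx => h1 k x hx) k hx,
      pderiv_sum (F := fun i x => pderiv k (H i) x * star (H i x) +
        H i x * star (pderiv k (H i) x)) fun i _ =>
        ((hd' i k x hx).fun_mul (hd i x hx).star).fun_add
          ((hd i x hx).fun_mul (hd' i k x hx).star)]
    refine sum_congr rfl fun i _ => ?_
    rw [pderiv_add ((hd' i k x hx).fun_mul (hd i x hx).star)
      ((hd i x hx).fun_mul (hd' i k x hx).star), pderiv_mul (hd' i k x hx) (hd i x hx).star,
      pderiv_mul (hd i x hx) (hd' i k x hx).star, pderiv_star (hd i x hx),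
      pderiv_star (hd' i k x hx)]
    ring
  have h3 : ∑ k, pderiv k (pderiv k fun x => ∑ i, H i x * star (H i x)) x =
      2 * ∑ k, ∑ i, pderiv k (H i) x * star (pderiv k (H i) x) := by
    simp only [h2, sum_add_distrib, ← mul_sum]
    have e1 : ∑ k, ∑ i, pderiv k (pderiv k (H i)) x * star (H i x) = 0 := by
      rw [sum_comm]
      exact sum_eq_zero fun i _ => by rw [← sum_mul, hL i x hx, zero_mul]
    have e2 : ∑ k, ∑ i, H i x * star (pderiv k (pderiv k (H i)) x) = 0 := by
      rw [sum_comm]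
      exact sum_eq_zero fun i _ => by rw [← mul_sum, ← star_sum, hL i x hx, star_zero, mul_zero]
    rw [e1, e2, zero_add, add_zero]
  have h4 : ∑ k, pderiv k (pderiv k fun x => ∑ i, H i x * star (H i x)) x =
      c * ((2 * s * (2 * s + D - 2) : ℝ) * radPow (s - 1) x) := by
    rw [← laplacian_radPow s hx, mul_sum]
    refine sum_congr rfl fun k _ => ?_
    rw [pderiv_congr isOpen_compl_zero (pderiv_congr isOpen_compl_zero h k) k hx]
    exact pderivs_const_mul isOpen_compl_zero (analyticOnNhd_radPow s) c [k, k] hx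
  rw [h3] at h4
  have h5 : (2 : ℂ) ≠ 0 := two_ne_zero
  refine mul_left_cancel₀ h5 (h4.trans ?_)
  push_cast
  ring

/-- `∏_{j < n} (s - j) (2 (s - j) + D - 2)`, the factor produced by `n` applications of
`sum_gradient_sq` to `|x|^{2s}`. -/
def gradFactor (D : ℕ) (s : ℝ) (n : ℕ) : ℝ := ∏ j ∈ range n, (s - j) * (2 * (s - j) + D - 2)

/-- The iteration of `sum_gradient_sq`, where the derivatives of order `n` of the functions `H_i`
form the next family. -/
lemma sum_pderivs_sq {ι : Type*} [Fintype ι] {H : ι → Pt D → ℂ} {c s : ℝ}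
    (hH : ∀ i, AnalyticOnNhd ℝ (H i) {0}ᶜ) (hL : ∀ i, LaplaceFree (H i) {0}ᶜ)
    (h : ∀ x ∈ ({0}ᶜ : Set (Pt D)), ∑ i, H i x * star (H i x) = c * radPow s x) (n : ℕ) :
    ∀ x ∈ ({0}ᶜ : Set (Pt D)), ∑ p : (Fin n → Fin D) × ι,
      pderivs (List.ofFn p.1) (H p.2) x * star (pderivs (List.ofFn p.1) (H p.2) x) =
        (c * gradFactor D s n : ℝ) * radPow (s - n) x := by
  induction n with
  | zero =>
    intro x hx
    rw [Fintype.sum_prod_type]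
    simpa [gradFactor] using h x hx
  | succ n ih =>
    intro x hx
    have h1 := sum_gradient_sq
      (H := fun (p : (Fin n → Fin D) × ι) => pderivs (List.ofFn p.1) (H p.2))
      (fun p => analyticOnNhd_pderivs (hH _) _)
      (fun p => (hL p.2).pderivs isOpen_compl_zero (hH _) _) ih hx
    rw [Fintype.sum_prod_type, sum_cons]
    simp only [List.ofFn_cons, pderivs_cons]
    simp only [Fintype.sum_prod_type] at h1
    have h2 : gradFactor D s (n + 1) =
        gradFactor D s n * ((s - n) * (2 * (s - n) + D - 2)) := prod_range_succ _ _
    rw [h1, h2, ← mul_assoc c]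
    congr 2
    push_cast
    ring

lemma norm_radPow (s : ℝ) (x : Pt D) : ‖radPow s x‖ = (‖x‖ ^ 2) ^ s := by
  rw [radPow, Complex.norm_real, Real.norm_of_nonneg (by positivity)]

/-- A bound on derivatives contracted with a tensor, by the Cauchy-Schwarz inequality. -/
lemma sum_norm_tderiv_sq_le {ι : Type*} [Fintype ι] {H : ι → Pt D → ℂ} {c s : ℝ}
    (hH : ∀ i, AnalyticOnNhd ℝ (H i) {0}ᶜ) (hL : ∀ i, LaplaceFree (H i) {0}ᶜ)
    (h : ∀ x ∈ ({0}ᶜ : Set (Pt D)), ∑ i, H i x * star (H i x) = c * radPow s x) {n : ℕ}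
    (T : (Fin n → Fin D) → ℂ) {x : Pt D} (hx : x ≠ 0) :
    ∑ i, ‖tderiv T (H i) x‖ ^ 2 ≤
      (∑ μ, ‖T μ‖ ^ 2) * (|c * gradFactor D s n| * (‖x‖ ^ 2) ^ (s - n)) := by
  have h1 := sum_pderivs_sq hH hL h n x hx
  have h2 : ∑ p : (Fin n → Fin D) × ι, ‖pderivs (List.ofFn p.1) (H p.2) x‖ ^ 2 =
      |c * gradFactor D s n| * (‖x‖ ^ 2) ^ (s - n) := by
    have h3 := congrArg norm h1
    rw [norm_mul, norm_radPow, Complex.norm_real, Real.norm_eq_abs] at h3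
    rw [← h3]
    have h4 : ∀ z : ℂ, z * star z = ((‖z‖ ^ 2 : ℝ) : ℂ) := fun z => by
      rw [Complex.star_def, Complex.mul_conj, Complex.normSq_eq_norm_sq]
    simp only [h4, ← Complex.ofReal_sum]
    rw [Complex.norm_real, Real.norm_of_nonneg (sum_nonneg fun _ _ => by positivity)]
  rw [← h2, Fintype.sum_prod_type, sum_comm, mul_sum]
  refine sum_le_sum fun i _ => ?_
  calc ‖tderiv T (H i) x‖ ^ 2
      ≤ (∑ μ, ‖T μ‖ * ‖pderivs (List.ofFn μ) (H i) x‖) ^ 2 := by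
        refine pow_le_pow_left₀ (norm_nonneg _) ((norm_sum_le _ _).trans_eq ?_) 2
        exact sum_congr rfl fun μ _ => norm_mul _ _
    _ ≤ _ := sum_mul_sq_le_sq_mul_sq _ _ _

lemma abs_gradFactor_le {s E : ℝ} {n : ℕ} (h : |s| + n + D + 2 ≤ E) :
    |gradFactor D s n| ≤ (2 * E ^ 2) ^ n := by
  rw [gradFactor, abs_prod]
  refine (prod_le_prod (fun _ _ => abs_nonneg _) (g := fun _ => 2 * E ^ 2) fun j hj => ?_).trans_eq
    (by rw [prod_const, card_range])
  have hj' : (j : ℝ) ≤ n := by exact_mod_cast (mem_range.1 hj).le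
  have hj0 : (0 : ℝ) ≤ j := Nat.cast_nonneg j
  have hD0 : (0 : ℝ) ≤ D := Nat.cast_nonneg D
  have hs := abs_le.1 (le_refl |s|)
  have h1 : |s - j| ≤ E := abs_le.2 ⟨by linarith, by linarith⟩
  have h2 : |2 * (s - j) + D - 2| ≤ 2 * E := abs_le.2 ⟨by linarith, by linarith⟩
  rw [abs_mul]
  calc |s - j| * |2 * (s - j) + D - 2| ≤ E * (2 * E) :=
        mul_le_mul h1 h2 (abs_nonneg _) ((abs_nonneg _).trans h1)
    _ = 2 * E ^ 2 := by ring

lemma laplaceFree_newton : LaplaceFree (newton D) {0}ᶜ := fun _ hx => laplacian_newton hx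

end Gradients

/-! ### Absolute summability over the modes -/

section ModeSums

variable {D : ℕ} (t : TensorBasis D) [hD : Fact (2 < D)]

/-- `∏_{j < l} (D - 2 + j) / (j + 1)`, the Taylor coefficients of `(1 - τ)^{2 - D}`. -/
def lineCoeff (D l : ℕ) : ℝ := ∏ j ∈ range l, ((D : ℝ) - 2 + j) / (j + 1)

lemma lineCoeff_nonneg (l : ℕ) : 0 ≤ lineCoeff D l := by
  have : (2 : ℝ) < D := two_lt_cast
  refine prod_nonneg fun j _ => div_nonneg ?_ (by positivity)
  have : (0 : ℝ) ≤ j := Nat.cast_nonneg j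
  linarith

lemma lineCoeff_le (l : ℕ) : lineCoeff D l ≤ ((l : ℝ) + 1) ^ D := by
  have h2 : (2 : ℝ) < D := two_lt_cast
  induction l with
  | zero => simp [lineCoeff]
  | succ l ih =>
    have hl : (0 : ℝ) < (l : ℝ) + 1 := by positivity
    rw [lineCoeff, prod_range_succ, ← lineCoeff]
    -- Bernoulli's inequality compares the quotient of successive coefficients with that of powers.
    have h3 : ((D : ℝ) - 2 + l) / (l + 1) ≤ (1 + 1 / ((l : ℝ) + 1)) ^ D := by
      refine le_trans ?_ (one_add_mul_le_pow (by
        have : (0 : ℝ) ≤ 1 / ((l : ℝ) + 1) := by positivity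
        linarith) D)
      rw [div_le_iff₀ hl]
      field_simp
      linarith
    have h4 : (((l + 1 : ℕ) : ℝ) + 1) ^ D = ((l : ℝ) + 1) ^ D * (1 + 1 / ((l : ℝ) + 1)) ^ D := by
      rw [← mul_pow]
      congr 1
      push_cast
      field_simp
    rw [h4]
    refine mul_le_mul ih h3 (div_nonneg ?_ hl.le) (by positivity)
    have : (0 : ℝ) ≤ l := Nat.cast_nonneg l
    linarith

/-- Along the ray through `z` the Newton kernel is a power, which determines its Taylor terms. -/
lemma taylorTerm_newton_self {z : Pt D} (hz : z ≠ 0) (l : ℕ) :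
    taylorTerm (newton D) z l z = ((-1) ^ l * lineCoeff D l : ℝ) * newton D z := by
  have hline : ∀ τ : ℝ, -1 < τ → z + τ • z ≠ 0 := fun τ hτ => by
    rw [show z + τ • z = (1 + τ) • z by rw [add_smul, one_smul]]
    exact smul_ne_zero (by linarith) hz
  have h1 : ∀ l : ℕ, ∀ τ : ℝ, -1 < τ →
      iteratedDeriv l (fun τ : ℝ => newton D (z + τ • z)) τ =
        ((-1) ^ l * lineCoeff D l * l.factorial * (1 + τ) ^ (2 - (D : ℝ) - l) : ℝ) *
          newton D z := by
    intro l
    induction l with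
    | zero =>
      intro τ hτ
      have hτ' : 0 < 1 + τ := by linarith
      rw [iteratedDeriv_zero, show z + τ • z = (1 + τ) • z by rw [add_smul, one_smul], newton,
        radPow, radPow, norm_smul, mul_pow, Real.mul_rpow (by positivity) (by positivity),
        Real.norm_of_nonneg hτ'.le, ← Real.rpow_natCast (1 + τ), ← Real.rpow_mul hτ'.le]
      simp only [lineCoeff, range_zero, prod_empty, pow_zero, Nat.factorial_zero]
      rw [show ((2 : ℕ) : ℝ) * (1 - (D : ℝ) / 2) = 2 - (D : ℝ) - (0 : ℕ) by push_cast; ring]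
      push_cast
      ring
    | succ l ih =>
      intro τ hτ
      have hτ' : 0 < 1 + τ := by linarith
      have h2 : iteratedDeriv l (fun τ : ℝ => newton D (z + τ • z)) =ᶠ[nhds τ] fun τ =>
          ((-1) ^ l * lineCoeff D l * l.factorial * (1 + τ) ^ (2 - (D : ℝ) - l) : ℝ) *
            newton D z := Filter.eventually_of_mem (Ioi_mem_nhds hτ) fun s hs => ih s hs
      have h3 : HasDerivAt (fun τ : ℝ => (1 + τ) ^ (2 - (D : ℝ) - l))
          (1 * (2 - (D : ℝ) - l) * (1 + τ) ^ (2 - (D : ℝ) - l - 1)) τ :=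
        ((hasDerivAt_id τ).const_add 1).rpow_const (Or.inl hτ'.ne')
      rw [iteratedDeriv_succ, h2.deriv_eq,
        ((h3.const_mul ((-1) ^ l * lineCoeff D l * l.factorial)).ofReal_comp.mul_const _).deriv]
      rw [show (2 - (D : ℝ) - l - 1) = 2 - (D : ℝ) - (l + 1 : ℕ) by push_cast; ring]
      generalize (1 + τ) ^ (2 - (D : ℝ) - (l + 1 : ℕ)) = q
      congr 2
      have hs : lineCoeff D (l + 1) = lineCoeff D l * (((D : ℝ) - 2 + l) / (l + 1)) :=
        prod_range_succ _ _
      rw [hs, Nat.factorial_succ]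
      push_cast
      have : (l : ℝ) + 1 ≠ 0 := by positivity
      field_simp
      ring
  have h4 := iteratedDeriv_line isOpen_compl_zero analyticOnNhd_newton z z l 0
    (hline 0 (by norm_num))
  rw [h1 l 0 (by norm_num), zero_smul] at h4
  have h5 : (l.factorial : ℂ) ≠ 0 := by exact_mod_cast l.factorial_ne_zero
  rw [add_zero, add_zero, Real.one_rpow] at h4
  rw [taylorTerm, ← h4]
  push_cast
  field_simp

lemma laplaceFree_createCoeff (M : Mode D) (U : Set (Pt D)) :
    LaplaceFree (createCoeff t M) U := by
  have h : LaplaceFree (createCoeff t M) Set.univ := by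
    rw [createCoeff_eq]
    exact LaplaceFree.const_mul isOpen_univ (analyticOnNhd_contr _ _)
      (fun x _ => laplacian_contr (symTraceFree_modeTensor t M).star x) _
  exact fun x _ => h x trivial

lemma analyticOnNhd_annihCoeff (M : Mode D) : AnalyticOnNhd ℝ (annihCoeff t M) {0}ᶜ :=
  AnalyticOnNhd.congr isOpen_compl_zero (fun x hx => analyticAt_const.fun_mul
    (analyticOnNhd_tderiv analyticOnNhd_newton (modeTensor t M) x hx))
    (annihCoeff_eq_tderiv t M).symm

lemma laplaceFree_annihCoeff (M : Mode D) : LaplaceFree (annihCoeff t M) {0}ᶜ := by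
  intro x hx
  have h := LaplaceFree.const_mul isOpen_compl_zero
    (analyticOnNhd_tderiv analyticOnNhd_newton (modeTensor t M))
    (laplaceFree_newton.tderiv isOpen_compl_zero analyticOnNhd_newton (modeTensor t M))
    ((-1) ^ M.1 * (√(cConst D M.1))⁻¹ : ℝ) x hx
  rw [← h]
  exact sum_congr rfl fun k _ =>
    pderivs_congr isOpen_compl_zero (annihCoeff_eq_tderiv t M) [k, k] hx

lemma annihCoeff_eq_star_createCoeff (M : Mode D) {x : Pt D} (hx : x ≠ 0) :
    annihCoeff t M x = radPow (1 - (D : ℝ) / 2 - M.1) x * star (createCoeff t M x) := by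
  rw [annihCoeff_eq t M hx, createCoeff_eq, star_mul', star_contr_star, Complex.star_def,
    Complex.conj_ofReal]
  ring

/-- The squares of the creation coefficients of level `l` add up to a multiple of `|x|^{2l}`: this
sum is, up to powers of `|x|`, the Taylor term of the Newton kernel along a ray. -/
lemma sum_createCoeff_sq (l : ℕ) : ∀ x ∈ ({0}ᶜ : Set (Pt D)),
    ∑ m, createCoeff t ⟨l, m⟩ x * star (createCoeff t ⟨l, m⟩ x) =
      lineCoeff D l * radPow l x := by
  intro x hx
  have h1 := congrFun (taylorTerm_eq_sum t isOpen_compl_zero analyticOnNhd_newton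
    laplaceFree_newton hx l) x
  dsimp only at h1
  rw [taylorTerm_newton_self hx] at h1
  have h2 : ∀ m, (√(cConst D l) : ℂ)⁻¹ * tderiv (modeTensor t ⟨l, m⟩) (newton D) x =
      (-1) ^ l * (radPow (1 - (D : ℝ) / 2 - l) x * star (createCoeff t ⟨l, m⟩ x)) := by
    intro m
    rw [← annihCoeff_eq_star_createCoeff t ⟨l, m⟩ hx, annihCoeff_eq_tderiv t ⟨l, m⟩ hx]
    have : ((-1 : ℂ) ^ l) * (-1) ^ l = 1 := by rw [← mul_pow]; simp
    push_cast
    rw [← mul_assoc, ← mul_assoc, this, one_mul]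
  simp only [h2] at h1
  have h3 : (radPow l x) * radPow (1 - (D : ℝ) / 2 - l) x = newton D x := by
    rw [← radPow_add _ _ hx, newton]
    congr 1
    ring
  have h4 : radPow (1 - (D : ℝ) / 2 - l) x ≠ 0 := by
    rw [radPow]
    exact_mod_cast (Real.rpow_pos_of_pos (norm_sq_pos hx) _).ne'
  have h5 : ((-1 : ℂ) ^ l) ≠ 0 := by simp
  refine mul_left_cancel₀ h4 (mul_left_cancel₀ h5 ?_)
  calc _ = ∑ m, (-1) ^ l * (radPow (1 - (D : ℝ) / 2 - l) x * star (createCoeff t ⟨l, m⟩ x)) *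
        createCoeff t ⟨l, m⟩ x := by
        rw [mul_sum, mul_sum]
        exact sum_congr rfl fun m _ => by ring
    _ = _ := by
        rw [← h1, ← h3]
        push_cast
        ring

/-- The annihilation coefficients are, up to powers of `|x|`, conjugate to the creation
coefficients, so that their squares add up in the same way. -/
lemma sum_annihCoeff_sq (l : ℕ) : ∀ x ∈ ({0}ᶜ : Set (Pt D)),
    ∑ m, annihCoeff t ⟨l, m⟩ x * star (annihCoeff t ⟨l, m⟩ x) =
      lineCoeff D l * radPow (2 - D - l) x := by
  intro x hx
  have h1 : star (radPow (1 - (D : ℝ) / 2 - l) x) = radPow (1 - (D : ℝ) / 2 - l) x := by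
    rw [radPow, Complex.star_def, Complex.conj_ofReal]
  have h2 : radPow (2 - D - l) x = radPow (1 - (D : ℝ) / 2 - l) x *
      radPow (1 - (D : ℝ) / 2 - l) x * radPow l x := by
    rw [← radPow_add _ _ hx, ← radPow_add _ _ hx]
    congr 1
    ring
  rw [h2, mul_left_comm, ← sum_createCoeff_sq t l x hx, mul_sum]
  refine sum_congr rfl fun m _ => ?_
  rw [annihCoeff_eq_star_createCoeff t ⟨l, m⟩ hx, star_mul', star_star, h1]
  ring

/-- The level sums of products of creation and annihilation coefficients grow like a polynomial
times a geometric sequence. -/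
lemma exists_sum_norm_le {k n : ℕ} (T : (Fin k → Fin D) → ℂ) (S : (Fin n → Fin D) → ℂ)
    {z y : Pt D} (hz : z ≠ 0) (hy : y ≠ 0) : ∃ C : ℝ, ∀ l : ℕ,
    ∑ m, ‖tderiv T (createCoeff t ⟨l, m⟩) z‖ * ‖tderiv S (annihCoeff t ⟨l, m⟩) y‖ ≤
      C * (((l : ℝ) + 1) ^ (D + k + n) * (‖z‖ / ‖y‖) ^ l) := by
  -- `E + l` bounds all factors of the two products `gradFactor`, whose parameters are `l` and
  -- `2 - D - l`; the bounds `A` and `B` collect what does not depend on `l`.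
  set E : ℝ := k + n + 2 * D + 4 with hE
  have hz2 := norm_sq_pos hz
  have hy2 := norm_sq_pos hy
  set A : ℝ := (∑ μ, ‖T μ‖ ^ 2) * ((2 * E ^ 2) ^ k * (‖z‖ ^ 2) ^ (-(k : ℝ))) with hA
  set B : ℝ := (∑ μ, ‖S μ‖ ^ 2) * ((2 * E ^ 2) ^ n * (‖y‖ ^ 2) ^ (2 - (D : ℝ) - n)) with hB
  have hT0 : 0 ≤ ∑ μ, ‖T μ‖ ^ 2 := sum_nonneg fun _ _ => by positivity
  have hS0 : 0 ≤ ∑ μ, ‖S μ‖ ^ 2 := sum_nonneg fun _ _ => by positivity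
  have hA0 : 0 ≤ A := by positivity
  have hB0 : 0 ≤ B := by positivity
  refine ⟨√(A * B), fun l => ?_⟩
  set L : ℝ := (l : ℝ) + 1 with hLdef
  have hl0 : (0 : ℝ) ≤ l := Nat.cast_nonneg l
  have hk0 : (0 : ℝ) ≤ k := Nat.cast_nonneg k
  have hn0 : (0 : ℝ) ≤ n := Nat.cast_nonneg n
  have h2 : (2 : ℝ) < D := two_lt_cast
  have hL1 : 1 ≤ L := by linarith
  have hb0 := lineCoeff_nonneg (D := D) l
  have hb := lineCoeff_le (D := D) l
  have hEL : E + l ≤ E * L := by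
    have : 0 ≤ (E - 1) * l := mul_nonneg (by linarith) hl0
    nlinarith
  have hgrad : ∀ (s : ℝ) (j : ℕ), |s| + j + D + 2 ≤ E + l →
      |lineCoeff D l * gradFactor D s j| ≤ L ^ D * ((2 * E ^ 2) ^ j * (L ^ 2) ^ j) := by
    intro s j h
    rw [abs_mul, abs_of_nonneg hb0]
    refine mul_le_mul hb ((abs_gradFactor_le (h.trans hEL)).trans_eq ?_) (abs_nonneg _)
      (by positivity)
    rw [← mul_pow]
    ring
  have h3 := sum_norm_tderiv_sq_le (fun m => analyticOnNhd_createCoeff t ⟨l, m⟩ _)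
    (fun m => laplaceFree_createCoeff t ⟨l, m⟩ _) (sum_createCoeff_sq t l) T hz
  have h4 := sum_norm_tderiv_sq_le (fun m => analyticOnNhd_annihCoeff t ⟨l, m⟩)
    (fun m => laplaceFree_annihCoeff t ⟨l, m⟩)
    (s := 2 - D - l) (fun x hx => by simpa using sum_annihCoeff_sq t l x hx) S hy
  have h5 : ∑ m, ‖tderiv T (createCoeff t ⟨l, m⟩) z‖ ^ 2 ≤
      A * (L ^ D * (L ^ 2) ^ k * (‖z‖ ^ 2) ^ l) := by
    refine (h3.trans (mul_le_mul_of_nonneg_left (mul_le_mul_of_nonneg_right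
      (hgrad l k (by rw [abs_of_nonneg hl0]; linarith)) (by positivity)) hT0)).trans_eq ?_
    rw [hA, sub_eq_add_neg, Real.rpow_add hz2, Real.rpow_natCast]
    ring
  have h6 : ∑ m, ‖tderiv S (annihCoeff t ⟨l, m⟩) y‖ ^ 2 ≤
      B * (L ^ D * (L ^ 2) ^ n * ((‖y‖ ^ 2) ^ l)⁻¹) := by
    refine (h4.trans (mul_le_mul_of_nonneg_left (mul_le_mul_of_nonneg_right
      (hgrad (2 - D - l) n (by
        rw [abs_of_nonpos (by linarith)]
        linarith)) (by positivity)) hS0)).trans_eq ?_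
    rw [hB, show (2 : ℝ) - D - l - n = (2 - (D : ℝ) - n) + -(l : ℝ) by ring,
      Real.rpow_add hy2, Real.rpow_neg hy2.le, Real.rpow_natCast]
    ring
  refine abs_le_of_sq_le_sq' ?_ (by positivity) |>.2
  refine (sum_mul_sq_le_sq_mul_sq _ _ _).trans ?_
  refine (mul_le_mul h5 h6 (sum_nonneg fun _ _ => by positivity) (by positivity)).trans_eq ?_
  rw [mul_pow, Real.sq_sqrt (mul_nonneg hA0 hB0)]
  have hy' : ‖y‖ ≠ 0 := norm_ne_zero_iff.2 hy
  rw [div_pow]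
  clear_value A B L
  field_simp
  ring

/-- Products of derivatives of creation and annihilation coefficients at points of different
norm are absolutely summable over all modes. -/
lemma summable_norm_mul {k n : ℕ} (T : (Fin k → Fin D) → ℂ) (S : (Fin n → Fin D) → ℂ)
    {z y : Pt D} (hz : z ≠ 0) (hzy : ‖z‖ < ‖y‖) : Summable fun M : Mode D =>
      ‖tderiv T (createCoeff t M) z‖ * ‖tderiv S (annihCoeff t M) y‖ := by
  have hy : y ≠ 0 := norm_pos_iff.1 ((norm_nonneg z).trans_lt hzy)
  obtain ⟨C, hC⟩ := exists_sum_norm_le t T S hz hy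
  have hq : ‖z‖ / ‖y‖ < 1 := (div_lt_one (norm_pos_iff.2 hy)).2 hzy
  have hq0 : 0 < ‖z‖ / ‖y‖ := div_pos (norm_pos_iff.2 hz) (norm_pos_iff.2 hy)
  refine (summable_sigma_of_nonneg fun M => by positivity).2
    ⟨fun l => Summable.of_finite, ?_⟩
  simp only [tsum_fintype]
  refine Summable.of_nonneg_of_le (fun l => sum_nonneg fun _ _ => by positivity) hC
    (Summable.mul_left C ?_)
  have h1 := (summable_nat_add_iff 1).2 (summable_pow_mul_geometric_of_norm_lt_one (D + k + n)
    (r := ‖z‖ / ‖y‖) (by rwa [Real.norm_of_nonneg hq0.le]))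
  refine (h1.mul_left (‖z‖ / ‖y‖)⁻¹).congr fun l => ?_
  have := hq0.ne'
  push_cast
  rw [pow_succ (‖z‖ / ‖y‖)]
  field_simp

end ModeSums

/-! ### Degree and parity of derivatives -/

section Parity

variable {D : ℕ}

lemma pderivs_contr_of_lt (L : List (Fin D)) : ∀ {l : ℕ} {T : (Fin l → Fin D) → ℂ},
    SymTraceFree T → l < L.length → ∀ x, pderivs L (contr T) x = 0 := by
  induction L using List.reverseRecOn with
  | nil => simp
  | append_singleton L k ih =>
    intro l T hT hl x
    rw [pderivs_append, pderivs_cons, pderivs_nil]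
    have hzero : pderivs L (fun _ => (0 : ℂ)) x = 0 := by
      have := pderivs_const_mul (U := Set.univ) isOpen_univ (f := fun _ : Pt D => (0 : ℂ))
        (fun _ _ => analyticAt_const) 0 L (Set.mem_univ x)
      simpa using this
    cases l with
    | zero => rwa [show pderiv k (contr T) = fun _ => 0 from funext (pderiv_contr_zero T k)]
    | succ l =>
      rw [show pderiv k (contr T) = fun x => ((l : ℂ) + 1) * contr (slice T k) x from
        funext (pderiv_contr hT k)]
      rw [pderivs_const_mul (U := Set.univ) isOpen_univ (analyticOnNhd_contr _ _) _ L trivial]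
      dsimp only
      rw [ih (hT.slice k) (by simpa using hl), mul_zero]

lemma pderivs_neg {f : Pt D → ℂ} (hf : AnalyticOnNhd ℝ f Set.univ) {ε : ℂ}
    (h : ∀ x, f (-x) = ε * f x) (L : List (Fin D)) :
    ∀ x, pderivs L f (-x) = (-1) ^ L.length * ε * pderivs L f x := by
  induction L with
  | nil => simpa using h
  | cons k L ih =>
    intro x
    have h1 : pderiv k (fun x => pderivs L f (-x)) x = -pderiv k (pderivs L f) (-x) := by
      have h2 := (analyticOnNhd_pderivs hf L (-x) trivial).differentiableAt.hasFDerivAt.comp x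
        (hasFDerivAt_id x).neg
      have h3 : HasFDerivAt (fun x => pderivs L f (-x)) _ x := h2
      rw [pderiv, h3.fderiv]
      simp [pderiv]
    rw [funext ih, pderiv_const_mul (analyticOnNhd_pderivs hf L x trivial).differentiableAt] at h1
    rw [pderivs_cons, ← neg_eq_iff_eq_neg.2 h1, List.length_cons, pow_succ]
    ring

end Parity

/-! ### Expansion of the field about another point -/

section Addition

variable {D : ℕ} (t : TensorBasis D) [hD : Fact (2 < D)]

/-- The coefficients in the expansion of derivatives of the Newton kernel are, up to sign,
derivatives of the annihilation coefficients. -/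
lemma norm_mode_tderiv_newton (M : Mode D) {n : ℕ} (S : (Fin n → Fin D) → ℂ) {y : Pt D}
    (hy : y ≠ 0) : ‖(√(cConst D M.1) : ℂ)⁻¹ * tderiv (modeTensor t M) (tderiv S (newton D)) y‖ =
      ‖tderiv S (annihCoeff t M) y‖ := by
  have ha := analyticOnNhd_tderiv (analyticOnNhd_newton (D := D)) (modeTensor t M)
  rw [tderiv_congr isOpen_compl_zero (annihCoeff_eq_tderiv t M) S hy,
    tderiv_const_mul isOpen_compl_zero ha _ S hy]
  dsimp only
  rw [tderiv_comm isOpen_compl_zero analyticOnNhd_newton S (modeTensor t M) hy]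
  simp

/-- A Taylor expansion that converges, together with absolute convergence over the modes, is an
expansion over the modes. -/
lemma hasSum_mode_of_taylor {U : Set (Pt D)} {f : Pt D → ℂ} (hU : IsOpen U)
    (hf : AnalyticOnNhd ℝ f U) (h : LaplaceFree f U) {y z : Pt D} (hy : y ∈ U) {k : ℕ}
    (T : (Fin k → Fin D) → ℂ) {s : ℂ}
    (hs : Summable fun M : Mode D => tderiv T (createCoeff t M) z *
      ((√(cConst D M.1) : ℂ)⁻¹ * tderiv (modeTensor t M) f y))
    (hsum : HasSum (fun l => taylorTerm (tderiv T f) y l z) s) :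
    HasSum (fun M : Mode D => tderiv T (createCoeff t M) z *
      ((√(cConst D M.1) : ℂ)⁻¹ * tderiv (modeTensor t M) f y)) s := by
  have h1 := hs.hasSum.sigma fun l => hasSum_fintype _
  have h2 : HasSum (fun l => tderiv T (taylorTerm f y l) z) s := by
    have h3 : HasSum (fun n => tderiv T (taylorTerm f y (n + k)) z) s :=
      hasSum_of_eq (fun n => tderiv_taylorTerm hU hf h hy T n z) hsum
    have h4 := (hasSum_nat_add_iff (f := fun l => tderiv T (taylorTerm f y l) z) k).1 h3
    rwa [sum_eq_zero fun l hl => tderiv_taylorTerm_of_lt hU hf h hy T (mem_range.1 hl) z,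
      add_zero] at h4
  have h5 := hasSum_of_eq (fun l => (tderiv_taylorTerm_eq_sum t hU hf h hy l T z).symm) h2
  rw [← h1.unique h5]
  exact hs.hasSum

/-- The expansion of derivatives of the Newton kernel in solid harmonics. -/
lemma hasSum_newton {k n : ℕ} (T : (Fin k → Fin D) → ℂ) (S : (Fin n → Fin D) → ℂ) {y z : Pt D}
    (hz : z ≠ 0) (hzy : ‖z‖ < ‖y‖) :
    HasSum (fun M : Mode D => tderiv T (createCoeff t M) z *
      ((√(cConst D M.1) : ℂ)⁻¹ * tderiv (modeTensor t M) (tderiv S (newton D)) y))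
      (tderiv T (tderiv S (newton D)) (y + z)) := by
  have hy : y ≠ 0 := norm_pos_iff.1 ((norm_nonneg z).trans_lt hzy)
  have hz0 : 0 < ‖z‖ := norm_pos_iff.2 hz
  have hf := analyticOnNhd_tderiv (analyticOnNhd_newton (D := D)) S
  have h : LaplaceFree (tderiv S (newton D)) {0}ᶜ :=
    laplaceFree_newton.tderiv isOpen_compl_zero analyticOnNhd_newton S
  have hterm : ∀ ρ : ℝ, 0 < ρ → ρ * ‖z‖ < ‖y‖ → Summable fun M : Mode D =>
      ‖tderiv T (createCoeff t M) (ρ • z) *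
        ((√(cConst D M.1) : ℂ)⁻¹ * tderiv (modeTensor t M) (tderiv S (newton D)) y)‖ := by
    intro ρ hρ hρz
    refine (summable_norm_mul t T S (smul_ne_zero hρ.ne' hz) (y := y) (by
      rwa [norm_smul, Real.norm_of_nonneg hρ.le])).congr fun M => ?_
    rw [norm_mul, norm_mode_tderiv_newton t M S hy]
  refine hasSum_mode_of_taylor t isOpen_compl_zero hf h hy T ?_ ?_
  · simpa using (hterm 1 one_pos (by simpa using hzy)).of_norm
  · refine hasSum_taylorTerm isOpen_compl_zero (analyticOnNhd_tderiv hf T)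
      ((one_lt_div hz0).2 hzy) (fun τ hτ => ?_) fun ρ hρ0 hρ => ?_
    · rintro h0
      have h1 : y = -(τ • z) := eq_neg_of_add_eq_zero_left h0
      rw [lt_div_iff₀ hz0, ← Real.norm_eq_abs, ← norm_smul, ← norm_neg (τ • z), ← h1] at hτ
      exact lt_irrefl _ hτ
    · -- Scaling the displacement by `r` multiplies the term of degree `l` by `r ^ l`. The bound
      -- over the modes needs a nonzero displacement, so `ρ` is first replaced by a positive radius.
      set r : ℝ := max ρ 1 with hr
      have hr0 : 0 < r := lt_max_of_lt_right one_pos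
      have hrz : r * ‖z‖ < ‖y‖ := (lt_div_iff₀ hz0).1 (max_lt hρ ((one_lt_div hz0).2 hzy))
      have h1 := (hterm r hr0 hrz).sigma
      simp only [tsum_fintype] at h1
      refine Summable.of_nonneg_of_le (fun l => by positivity) (fun l => ?_)
        ((summable_nat_add_iff k).2 h1)
      calc ‖taylorTerm (tderiv T (tderiv S (newton D))) y l z‖ * ρ ^ l
          ≤ ‖taylorTerm (tderiv T (tderiv S (newton D))) y l z‖ * r ^ l := by
            gcongr
            exact le_max_left _ _
        _ = ‖taylorTerm (tderiv T (tderiv S (newton D))) y l (r • z)‖ := by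
            rw [taylorTerm, taylorTerm, contr_smul, norm_mul, norm_mul, norm_mul, norm_pow,
              Complex.norm_real, Real.norm_of_nonneg hr0.le]
            ring
        _ ≤ _ := by
            rw [← tderiv_taylorTerm isOpen_compl_zero hf h hy T l,
              tderiv_taylorTerm_eq_sum t isOpen_compl_zero hf h hy]
            exact norm_sum_le _ _

lemma tderiv_createCoeff_of_lt (N : Mode D) {l : ℕ} (T : (Fin l → Fin D) → ℂ) (h : N.1 < l)
    (x : Pt D) : tderiv T (createCoeff t N) x = 0 := by
  refine sum_eq_zero fun μ _ => ?_
  rw [createCoeff_eq, pderivs_const_mul (U := Set.univ) isOpen_univ (analyticOnNhd_contr _ _) _ _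
    trivial]
  dsimp only
  rw [pderivs_contr_of_lt _ (symTraceFree_modeTensor t N).star (by simpa using h), mul_zero,
    mul_zero]

/-- The expansion of a translated solid harmonic, a finite sum. -/
lemma hasSum_createCoeff {k : ℕ} (T : (Fin k → Fin D) → ℂ) (N : Mode D) (y z : Pt D) :
    HasSum (fun M : Mode D => tderiv T (createCoeff t M) z *
      ((√(cConst D M.1) : ℂ)⁻¹ * tderiv (modeTensor t M) (createCoeff t N) y))
      (tderiv T (createCoeff t N) (y + z)) := by
  have hf := analyticOnNhd_createCoeff t N Set.univ
  have h := laplaceFree_createCoeff t N Set.univ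
  refine hasSum_mode_of_taylor t isOpen_univ hf h trivial T ?_ ?_
  · refine summable_of_ne_finset_zero (s := (range (N.1 + 1)).sigma fun _ => univ) fun M hM => ?_
    rw [tderiv_createCoeff_of_lt t N _ (by simpa using hM), mul_zero, mul_zero]
  · refine hasSum_taylorTerm isOpen_univ (analyticOnNhd_tderiv hf T) one_lt_two
      (fun _ _ => trivial) fun ρ _ _ => ?_
    refine summable_of_ne_finset_zero (s := range (N.1 + 1)) fun l hl => ?_
    rw [← tderiv_taylorTerm isOpen_univ hf h trivial T l,
      tderiv_taylorTerm_eq_sum t isOpen_univ hf h trivial, sum_eq_zero fun m _ => ?_]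
    · simp
    · rw [tderiv_createCoeff_of_lt t N _ (by simp at hl ⊢; omega), mul_zero, mul_zero]

lemma tderiv_createCoeff_neg (M : Mode D) {n : ℕ} (S : (Fin n → Fin D) → ℂ) (x : Pt D) :
    tderiv S (createCoeff t M) (-x) = (-1) ^ n * (-1) ^ M.1 * tderiv S (createCoeff t M) x := by
  have h : ∀ x, createCoeff t M (-x) = (-1) ^ M.1 * createCoeff t M x := by
    intro x
    have h1 := contr_smul (fun μ => star (modeTensor t M μ)) (-1) x
    rw [createCoeff_eq]
    dsimp only
    rw [neg_one_smul] at h1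
    rw [h1]
    push_cast
    ring
  rw [tderiv, tderiv, mul_sum]
  refine sum_congr rfl fun μ _ => ?_
  rw [pderivs_neg (analyticOnNhd_createCoeff t M _) h, List.length_ofFn]
  ring

/-- The contraction of two fields: the derivatives of the Newton kernel at `x - y`, expanded about
`x`. -/
lemma hasSum_annMat_creMat {x y : Pt D} (hy : y ≠ 0) (hyx : ‖y‖ < ‖x‖) (K N : Mode D) :
    HasSum (fun M => annMat t x K M * creMat t y N M) (annMat t (x - y) K N) := by
  have hx : x ≠ 0 := norm_pos_iff.1 ((norm_nonneg y).trans_lt hyx)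
  have hxy : x - y ≠ 0 := fun h => hyx.ne (by rw [sub_eq_zero.1 h])
  have h := (hasSum_newton t (modeTensor t N) (modeTensor t K) (neg_ne_zero.2 hy)
    (by rwa [norm_neg] : ‖-y‖ < ‖x‖)).mul_left
      ((√(cConst D K.1) : ℂ)⁻¹ * ((-1) ^ N.1 * (√(cConst D N.1) : ℂ)⁻¹))
  rw [← sub_eq_add_neg] at h
  have e : annMat t (x - y) K N = (√(cConst D K.1) : ℂ)⁻¹ *
      ((-1) ^ N.1 * (√(cConst D N.1) : ℂ)⁻¹) *
        tderiv (modeTensor t N) (tderiv (modeTensor t K) (newton D)) (x - y) := by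
    rw [annMat_eq t hxy, tderiv_comm isOpen_compl_zero analyticOnNhd_newton _ _ hxy]
    push_cast
    ring
  rw [e]
  refine hasSum_of_eq (fun M => ?_) h
  rw [annMat_eq t hx, creMat_eq, tderiv_createCoeff_neg,
    tderiv_comm isOpen_compl_zero analyticOnNhd_newton (modeTensor t K) (modeTensor t M) hx]
  have h1 : ((-1 : ℂ) ^ N.1) * (-1) ^ N.1 = 1 := by rw [← mul_pow]; simp
  push_cast
  linear_combination (-(√(cConst D K.1) : ℂ)⁻¹ * (√(cConst D N.1) : ℂ)⁻¹ * (-1) ^ M.1 *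
    tderiv (modeTensor t N) (createCoeff t M) y * (√(cConst D M.1) : ℂ)⁻¹ *
    tderiv (modeTensor t M) (tderiv (modeTensor t K) (newton D)) x) * h1

/-- The annihilation part of the field at `x`, expanded about `y`. -/
lemma hasSum_creMat_annMat {x y : Pt D} (hxy : x ≠ y) (h : ‖x - y‖ < ‖y‖) (hx : x ≠ 0)
    (K N : Mode D) : HasSum (fun M => creMat t (x - y) K M * annMat t y M N) (annMat t x K N) := by
  have hy : y ≠ 0 := norm_pos_iff.1 ((norm_nonneg _).trans_lt h)
  have h1 := (hasSum_newton t (modeTensor t K) (modeTensor t N) (sub_ne_zero.2 hxy) h).mul_left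
      ((√(cConst D K.1) : ℂ)⁻¹ * ((-1) ^ N.1 * (√(cConst D N.1) : ℂ)⁻¹))
  rw [add_sub_cancel] at h1
  have e : annMat t x K N = (√(cConst D K.1) : ℂ)⁻¹ *
      ((-1) ^ N.1 * (√(cConst D N.1) : ℂ)⁻¹) *
        tderiv (modeTensor t K) (tderiv (modeTensor t N) (newton D)) x := by
    rw [annMat_eq t hx]
    push_cast
    ring
  rw [e]
  refine hasSum_of_eq (fun M => ?_) h1
  rw [creMat_eq, annMat_eq t hy]
  push_cast
  ring

/-- The creation part of the field at `x`, expanded about `y`. -/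
lemma hasSum_creMat_creMat (x y : Pt D) (K N : Mode D) :
    HasSum (fun M => creMat t (x - y) K M * creMat t y M N) (creMat t x K N) := by
  have h1 := (hasSum_createCoeff t (modeTensor t K) N y (x - y)).mul_left
    (√(cConst D K.1) : ℂ)⁻¹
  rw [add_sub_cancel, ← creMat_eq] at h1
  refine hasSum_of_eq (fun M => ?_) h1
  rw [creMat_eq, creMat_eq]
  ring

theorem exists_hasSum_vertexOp {x y : Pt D} (hxy : x ≠ y) (h1 : ‖x - y‖ < ‖y‖) (h2 : ‖y‖ < ‖x‖)
    (u v w : FieldSpace D) (d : Occ D) : ∃ S : ℂ,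
      HasSum (fun e => vertexOp t x u (fieldVec t e) d * vertexOp t y v w e) S ∧
      HasSum (fun e => vertexOp t (x - y) u v e * vertexOp t y (fieldVec t e) w d) S := by
  have hy : y ≠ 0 := norm_pos_iff.1 ((norm_nonneg _).trans_lt h1)
  have hx : x ≠ 0 := norm_pos_iff.1 ((norm_nonneg _).trans_lt h2)
  exact vertexOp_assoc t (hasSum_annMat_creMat t hy h2) (hasSum_creMat_creMat t x y)
    (hasSum_creMat_annMat t hxy h1 hx) u v w d

end Addition

end

end FreeField

theorem mainTheorem4 (D : ℕ) [Fact (2 < D)] (t : FreeField.TensorBasis D) :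
    (∀ x₁ x₂ x₃ : FreeField.Pt D, x₁ ≠ x₂ → dist x₁ x₂ < dist x₂ x₃ → dist x₂ x₃ < dist x₁ x₃ →
      ∀ a b c d : FreeField.Occ D,
        Summable (fun e => FreeField.opeCoeff t a b e x₁ x₂ * FreeField.opeCoeff t e c d x₂ x₃) ∧
        Summable (fun e => FreeField.opeCoeff t b c e x₂ x₃ * FreeField.opeCoeff t a e d x₁ x₃) ∧
        ∑' e, FreeField.opeCoeff t a b e x₁ x₂ * FreeField.opeCoeff t e c d x₂ x₃ =
          ∑' e, FreeField.opeCoeff t b c e x₂ x₃ * FreeField.opeCoeff t a e d x₁ x₃) ∧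
    (∀ x y : FreeField.Pt D, x ≠ y → ‖x - y‖ < ‖y‖ → ‖y‖ < ‖x‖ →
      ∀ (u v w : FreeField.FieldSpace D) (d : FreeField.Occ D),
        Summable (fun e => FreeField.vertexOp t x u (FreeField.fieldVec t e) d *
          FreeField.vertexOp t y v w e) ∧
        Summable (fun e => FreeField.vertexOp t (x - y) u v e *
          FreeField.vertexOp t y (FreeField.fieldVec t e) w d) ∧
        ∑' e, FreeField.vertexOp t x u (FreeField.fieldVec t e) d *
            FreeField.vertexOp t y v w e =
          ∑' e, FreeField.vertexOp t (x - y) u v e *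
            FreeField.vertexOp t y (FreeField.fieldVec t e) w d) := by
  refine ⟨fun x₁ x₂ x₃ h h1 h2 a b c d => ?_, fun x y h h1 h2 u v w d => ?_⟩
  · rw [dist_eq_norm, dist_eq_norm] at h1 h2
    obtain ⟨S, hl, hr⟩ := FreeField.exists_hasSum_vertexOp t (x := x₁ - x₃) (y := x₂ - x₃)
      (fun h' => h (sub_left_injective h')) (by rwa [sub_sub_sub_cancel_right]) h2
      (FreeField.fieldVec t a) (FreeField.fieldVec t b) (FreeField.fieldVec t c) d
    rw [sub_sub_sub_cancel_right] at hr
    have hl' : HasSum (fun e => FreeField.opeCoeff t b c e x₂ x₃ *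
        FreeField.opeCoeff t a e d x₁ x₃) S :=
      FreeField.hasSum_of_eq (fun e => mul_comm _ _) hl
    exact ⟨hr.summable, hl'.summable, hr.tsum_eq.trans hl'.tsum_eq.symm⟩
  · obtain ⟨S, hl, hr⟩ := FreeField.exists_hasSum_vertexOp t h h1 h2 u v w d
    exact ⟨hl.summable, hr.summable, hl.tsum_eq.trans hr.tsum_eq.symm⟩
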